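/- Let $-\infty<a<b<\infty$, $\Omega=(a,b)$; all functions are real-valued. For $\sigma>0$ let $$({}_aD_x^{-\sigma}w)(x)=\frac1{\Gamma(\sigma)}\int_a^x(x-t)^{\sigma-1}w(t)\,dt,\qquad ({}_xD_b^{-\sigma}w)(x)=\frac1{\Gamma(\sigma)}\int_x^b(t-x)^{\sigma-1}w(t)\,dt,$$ and for $0<\sigma<1$ let ${}_aD_x^{\sigma}w=\frac{d}{dx}\,{}_aD_x^{-(1-\sigma)}w$ and ${}_xD_b^{\sigma}w=-\frac{d}{dx}\,{}_xD_b^{-(1-\sigma)}w$. Write $(g,h)_\Omega=\int_\Omega gh$. For $s\ge 0$, $\widehat H^s(\mathbb R)$ is the space of $w\in L^2(\mathbb R)$ with finite norm $\|w\|_{\widehat H^s(\mathbb R)}=\big(\|w\|_{L^2(\mathbb R)}^2+\|\,|2\pi\xi|^s\widehat w\,\|_{L^2(\mathbb R)}^2\big)^{1/2}$, where $\widehat w(\xi)=\int_{\mathbb R} e^{-2\pi i\xi x}w(x)\,dx$ (extended to $L^2(\mathbb R)$), and $\widehat H^s_0(\Omega)$ is the closure of $C_0^\infty(\Omega)$ in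 the norm $\|u\|_{\widehat H^s_0(\Omega)}=\|\tilde u\|_{\widehat H^s(\mathbb R)}$, where $\tilde u$ is the extension of $u$ by zero. $H(\overline\Omega)$ is the set of functions that are Hölder continuous on $\overline\Omega$ with some positive exponent. $H^*(\Omega)$ is the set of functions $f$ on $\Omega$ of the form $f(x)=g(x)(x-a)^{\varepsilon_1-1}(b-x)^{\varepsilon_2-1}$ with some $\varepsilon_1,\varepsilon_2>0$ and some $g$ that is Hölder continuous on $\overline\Omega$ with an exponent in $(0,1]$ and satisfies $g(a)=g(b)=0$. Assume $0<\alpha,\beta<1$, $\alpha+\beta=1$, $0<\mu<1$; $p,q,k\in C^1(\overline\Omega)$; $p',k'\in H(\overline\Omega)$; $k>0$ and $\frac qk-\frac12\big(\frac pk\big)'\ge 0$ on $\overline\Omega$; and $$\pi(1-\mu^2)\cot\Big(\frac{(1+\mu)\pi}2\Big)+4(b-a)\Big\|\frac{k'}k\Big\|_{L^\infty(\Omega)}<0.$$ Put $s=\frac{1+\mu}2$, $s'=\frac{1-\mu}2$, and for $u,v\in\widehat H^s_0(\Omega)$ $$\begin{aligned}B_2[u,v]={}&-\alpha({}_aD_x^su,{}_xD_b^sv)_\Omega-\beta({}_xD_b^su,{}_aD_x^sv)_\Omega-\alpha\Big(\frac{k'}k\,{}_aD_x^\mu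 u,v\Big)_\Omega+\beta\Big(\frac{k'}k\,{}_xD_b^\mu u,v\Big)_\Omega\\&+\Big({}_aD_x^{s'}u,{}_xD_b^s\Big(\frac pk v\Big)\Big)_\Omega+\Big(\frac qk u,v\Big)_\Omega.\end{aligned}$$ Then: 1. For every $u\in\widehat H^s_0(\Omega)$, the derivatives ${}_aD_x^su$, ${}_xD_b^su$, ${}_aD_x^\mu u$, ${}_xD_b^\mu u$, ${}_aD_x^{s'}u$ and ${}_xD_b^s(\frac pk u)$ exist a.e. on $\Omega$ and belong to $L^2(\Omega)$, and $B_2$ is a bilinear form on $\widehat H^s_0(\Omega)$. 2. There are constants $Q_1,Q_2>0$ such that, for all $u,v\in\widehat H^s_0(\Omega)$, $|B_2[u,v]|\le Q_1\|u\|_{\widehat H^s_0(\Omega)}\|v\|_{\widehat H^s_0(\Omega)}$ and $B_2[u,u]\ge Q_2\|u\|_{\widehat H^s_0(\Omega)}^2$. 3. There is a constant $C>0$, independent of $f$, such that for every $f\in H^*(\Omega)$: the function $\frac fk v$ is integrable on $\Omega$ for all $v\in\widehat H^s_0(\Omega)$; ${}_aD_x^{-s}\frac fk\in L^2(\Omega)$;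 there is a unique $u\in\widehat H^s_0(\Omega)$ with $B_2[u,v]=(\frac fk,v)_\Omega$ for all $v\in\widehat H^s_0(\Omega)$; and this $u$ satisfies $$\|u\|_{\widehat H^s_0(\Omega)}\le C\,\Big\|{}_aD_x^{-s}\frac fk\Big\|_{L^2(\Omega)}.$$ -/

import Mathlib

open MeasureTheory Set Filter Topology FourierTransform
open scoped ENNReal NNReal ContDiff

noncomputable section

/-! ### Riemann-Liouville integrals and derivatives -/

/-- The left Riemann-Liouville integral `(ₐD_x^{-σ} w)(x)` of order `σ > 0`. -/
def leftRLInt (a σ : ℝ) (w : ℝ → ℝ) (x : ℝ) : ℝ :=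
  1 / Real.Gamma σ * ∫ t in a..x, (x - t) ^ (σ - 1) * w t

/-- The right Riemann-Liouville integral `(ₓD_b^{-σ} w)(x)` of order `σ > 0`. -/
def rightRLInt (b σ : ℝ) (w : ℝ → ℝ) (x : ℝ) : ℝ :=
  1 / Real.Gamma σ * ∫ t in x..b, (t - x) ^ (σ - 1) * w t

/-- The left Riemann-Liouville derivative `ₐD_x^σ w = (d/dx) ₐD_x^{-(1-σ)} w`, for `0 < σ < 1`. -/
def leftRLDeriv (a σ : ℝ) (w : ℝ → ℝ) (x : ℝ) : ℝ :=
  deriv (leftRLInt a (1 - σ) w) x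

/-- The right Riemann-Liouville derivative `ₓD_b^σ w = -(d/dx) ₓD_b^{-(1-σ)} w`,
for `0 < σ < 1`. -/
def rightRLDeriv (b σ : ℝ) (w : ℝ → ℝ) (x : ℝ) : ℝ :=
  -deriv (rightRLInt b (1 - σ) w) x

/-- `ₐD_x^σ w` exists almost everywhere on `(a, b)` and belongs to `L²(a, b)`. -/
def LeftRLDerivInL2 (a b σ : ℝ) (w : ℝ → ℝ) : Prop :=
  (∀ᵐ x ∂(volume.restrict (Ioo a b)), DifferentiableAt ℝ (leftRLInt a (1 - σ) w) x) ∧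
    MemLp (leftRLDeriv a σ w) 2 (volume.restrict (Ioo a b))

/-- `ₓD_b^σ w` exists almost everywhere on `(a, b)` and belongs to `L²(a, b)`. -/
def RightRLDerivInL2 (a b σ : ℝ) (w : ℝ → ℝ) : Prop :=
  (∀ᵐ x ∂(volume.restrict (Ioo a b)), DifferentiableAt ℝ (rightRLInt b (1 - σ) w) x) ∧
    MemLp (rightRLDeriv b σ w) 2 (volume.restrict (Ioo a b))

/-! ### Hölder spaces on the interval -/

/-- `g ∈ H^lam([a, b])`, where `0 < lam ≤ 1`. -/
def MemHolderIcc (a b : ℝ) (lam : ℝ≥0) (g : ℝ → ℝ) : Prop :=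
  ∃ C : ℝ≥0, HolderOnWith C lam g (Icc a b)

/-- `g ∈ H([a, b])`, the union of the Hölder spaces of positive order; orders greater than `1`
add nothing to the union. -/
def MemHolderSome (a b : ℝ) (g : ℝ → ℝ) : Prop :=
  ∃ lam : ℝ≥0, 0 < lam ∧ lam ≤ 1 ∧ MemHolderIcc a b lam g

/-- `f ∈ H^*(a, b)`: on `(a, b)`, `f(x) = g(x) / ((x-a)^{1-ε₁} (b-x)^{1-ε₂})` with `ε₁, ε₂ > 0`
and `g` Hölder continuous of some order in `(0, 1]` on `[a, b]` with `g(a) = g(b) = 0`. -/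
def MemHStar (a b : ℝ) (f : ℝ → ℝ) : Prop :=
  ∃ lam : ℝ≥0, 0 < lam ∧ lam ≤ 1 ∧ ∃ ε₁ ε₂ : ℝ, 0 < ε₁ ∧ 0 < ε₂ ∧
    ∃ g : ℝ → ℝ, MemHolderIcc a b lam g ∧ g a = 0 ∧ g b = 0 ∧
      ∀ x ∈ Ioo a b, f x = g x / ((x - a) ^ (1 - ε₁) * (b - x) ^ (1 - ε₂))

/-! ### Fractional Sobolev spaces -/

/-- The Fourier transform `ŵ(ξ) = ∫ e^{-2πiξx} w(x) dx` of a real function `w ∈ L²(ℝ)`, as an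
element of the complex space `L²(ℝ)`. -/
def fourierL2 (w : Lp ℝ 2 (volume : Measure ℝ)) : Lp ℂ 2 (volume : Measure ℝ) :=
  𝓕 (Complex.ofRealCLM.compLpL 2 volume w)

/-- The semi-norm `‖(2π|ξ|)^s ŵ‖_{L²(ℝ)}`, possibly infinite. -/
def hsSeminorm (s : ℝ) (w : Lp ℝ 2 (volume : Measure ℝ)) : ℝ≥0∞ :=
  eLpNorm (fun ξ : ℝ => |2 * Real.pi * ξ| ^ s • fourierL2 w ξ) 2 volume

/-- The norm of `Ĥ^s(ℝ)`, equal to `∞` outside that space. -/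
def hsNorm (s : ℝ) (w : Lp ℝ 2 (volume : Measure ℝ)) : ℝ≥0∞ :=
  (eLpNorm w 2 volume ^ 2 + hsSeminorm s w ^ 2) ^ (1 / 2 : ℝ)

/-- `L²(a, b)`. -/
abbrev L2Ioo (a b : ℝ) : Type := Lp ℝ 2 ((volume : Measure ℝ).restrict (Ioo a b))

/-- The extension `ũ` of `u ∈ L²(a, b)` by zero outside `(a, b)`. -/
def zeroExt {a b : ℝ} (u : L2Ioo a b) : Lp ℝ 2 (volume : Measure ℝ) :=
  ((memLp_indicator_iff_restrict measurableSet_Ioo).2 (Lp.memLp u)).toLp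
    ((Ioo a b).indicator u)

/-- `φ ∈ C_0^∞(a, b)`, as a class in `L²(a, b)`. -/
def IsTest {a b : ℝ} (φ : L2Ioo a b) : Prop :=
  ∃ ψ : ℝ → ℝ, ContDiff ℝ ∞ ψ ∧ HasCompactSupport ψ ∧ tsupport ψ ⊆ Ioo a b ∧
    φ =ᵐ[volume.restrict (Ioo a b)] ψ

lemma zeroExt_coe {a b : ℝ} (u : L2Ioo a b) :
    zeroExt u =ᵐ[volume] (Ioo a b).indicator u := MemLp.coeFn_toLp _

lemma zeroExt_add {a b : ℝ} (u v : L2Ioo a b) : zeroExt (u + v) = zeroExt u + zeroExt v := by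
  apply Lp.ext
  have h := (ae_restrict_iff' measurableSet_Ioo).1 (Lp.coeFn_add u v)
  filter_upwards [h, zeroExt_coe (u + v), zeroExt_coe u, zeroExt_coe v,
    Lp.coeFn_add (zeroExt u) (zeroExt v)] with x h h1 h2 h3 h4
  rw [h4, h1, Pi.add_apply, h2, h3]
  by_cases hx : x ∈ Ioo a b
  · simp only [indicator_of_mem hx]; exact h hx
  · simp [hx]

lemma zeroExt_smul {a b : ℝ} (c : ℝ) (u : L2Ioo a b) : zeroExt (c • u) = c • zeroExt u := by
  apply Lp.ext
  have h := (ae_restrict_iff' measurableSet_Ioo).1 (Lp.coeFn_smul c u)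
  filter_upwards [h, zeroExt_coe (c • u), zeroExt_coe u,
    Lp.coeFn_smul c (zeroExt u)] with x h h1 h2 h3
  rw [h3, h1, Pi.smul_apply, h2]
  by_cases hx : x ∈ Ioo a b
  · simp only [indicator_of_mem hx]; exact h hx
  · simp [hx]

lemma fourierL2_add (v w : Lp ℝ 2 (volume : Measure ℝ)) :
    fourierL2 (v + w) = fourierL2 v + fourierL2 w := by
  rw [fourierL2, map_add, FourierTransform.fourier_add]; rfl

lemma fourierL2_smul (c : ℝ) (w : Lp ℝ 2 (volume : Measure ℝ)) :
    fourierL2 (c • w) = (c : ℂ) • fourierL2 w := by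
  rw [fourierL2, map_smul, fourierL2, ← FourierTransform.fourier_smul]
  congr 1

lemma hsSeminorm_add_le (s : ℝ) (v w : Lp ℝ 2 (volume : Measure ℝ)) :
    hsSeminorm s (v + w) ≤ hsSeminorm s v + hsSeminorm s w := by
  have hm : ∀ z : Lp ℝ 2 (volume : Measure ℝ),
      AEStronglyMeasurable (fun ξ : ℝ => |2 * Real.pi * ξ| ^ s • fourierL2 z ξ) volume := by
    intro z
    refine AEStronglyMeasurable.smul (𝕜 := ℝ) ?_ (Lp.aestronglyMeasurable _)
    exact Measurable.aestronglyMeasurable (by fun_prop)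
  refine le_trans (le_of_eq ?_) (eLpNorm_add_le (hm v) (hm w) one_le_two)
  refine eLpNorm_congr_ae ?_
  rw [fourierL2_add]
  filter_upwards [Lp.coeFn_add (fourierL2 v) (fourierL2 w)] with ξ h
  simp only [h, Pi.add_apply, smul_add]

lemma hsSeminorm_smul (s c : ℝ) (w : Lp ℝ 2 (volume : Measure ℝ)) :
    hsSeminorm s (c • w) = ‖c‖ₑ * hsSeminorm s w := by
  rw [hsSeminorm, hsSeminorm, ← eLpNorm_const_smul]
  refine eLpNorm_congr_ae ?_
  rw [fourierL2_smul]
  filter_upwards [Lp.coeFn_smul (c : ℂ) (fourierL2 w)] with ξ h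
  simp only [h, Pi.smul_apply, Complex.real_smul, smul_eq_mul]
  ring

lemma ennreal_sq_rpow_half (x : ℝ≥0∞) : (x ^ 2) ^ (1 / 2 : ℝ) = x := by
  rw [← ENNReal.rpow_natCast, ← ENNReal.rpow_mul]; norm_num

lemma hsNorm_le (s : ℝ) (w : Lp ℝ 2 (volume : Measure ℝ)) :
    hsNorm s w ≤ eLpNorm w 2 volume + hsSeminorm s w := by
  rw [hsNorm, ← ennreal_sq_rpow_half (eLpNorm w 2 volume + hsSeminorm s w)]
  refine ENNReal.rpow_le_rpow ?_ (by norm_num)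
  rw [add_sq]
  gcongr
  exact le_self_add

lemma eLpNorm_le_hsNorm (s : ℝ) (w : Lp ℝ 2 (volume : Measure ℝ)) :
    eLpNorm w 2 volume ≤ hsNorm s w := by
  conv_lhs => rw [← ennreal_sq_rpow_half (eLpNorm w 2 volume)]
  exact ENNReal.rpow_le_rpow le_self_add (by norm_num)

lemma hsSeminorm_le_hsNorm (s : ℝ) (w : Lp ℝ 2 (volume : Measure ℝ)) :
    hsSeminorm s w ≤ hsNorm s w := by
  conv_lhs => rw [← ennreal_sq_rpow_half (hsSeminorm s w)]
  exact ENNReal.rpow_le_rpow le_add_self (by norm_num)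

lemma hsNorm_add_le (s : ℝ) (v w : Lp ℝ 2 (volume : Measure ℝ)) :
    hsNorm s (v + w) ≤ 2 * (hsNorm s v + hsNorm s w) := by
  have h1 : eLpNorm (v + w : Lp ℝ 2 (volume : Measure ℝ)) 2 volume ≤
      eLpNorm v 2 volume + eLpNorm w 2 volume := by
    rw [eLpNorm_congr_ae (Lp.coeFn_add v w)]
    exact eLpNorm_add_le (Lp.aestronglyMeasurable _) (Lp.aestronglyMeasurable _) one_le_two
  calc hsNorm s (v + w) ≤ _ := hsNorm_le s _
    _ ≤ (hsNorm s v + hsNorm s w) + (hsNorm s v + hsNorm s w) :=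
      add_le_add
        (h1.trans (add_le_add (eLpNorm_le_hsNorm s v) (eLpNorm_le_hsNorm s w)))
        ((hsSeminorm_add_le s v w).trans
          (add_le_add (hsSeminorm_le_hsNorm s v) (hsSeminorm_le_hsNorm s w)))
    _ = 2 * (hsNorm s v + hsNorm s w) := (two_mul _).symm

lemma hsNorm_smul (s c : ℝ) (w : Lp ℝ 2 (volume : Measure ℝ)) :
    hsNorm s (c • w) = ‖c‖ₑ * hsNorm s w := by
  have h1 : eLpNorm (c • w : Lp ℝ 2 (volume : Measure ℝ)) 2 volume =
      ‖c‖ₑ * eLpNorm w 2 volume := by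
    rw [eLpNorm_congr_ae (Lp.coeFn_smul c w), eLpNorm_const_smul]
  rw [hsNorm, h1, hsSeminorm_smul, mul_pow, mul_pow, ← mul_add,
    ENNReal.mul_rpow_of_nonneg _ _ (by norm_num), ennreal_sq_rpow_half, hsNorm]

lemma IsTest.zero (a b : ℝ) : IsTest (0 : L2Ioo a b) :=
  ⟨0, contDiff_const, HasCompactSupport.zero, by simp [tsupport], Lp.coeFn_zero _ _ _⟩

lemma IsTest.add {a b : ℝ} {φ ψ : L2Ioo a b} (h : IsTest φ) (h' : IsTest ψ) :
    IsTest (φ + ψ) := by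
  obtain ⟨f, hf1, hf2, hf3, hf4⟩ := h
  obtain ⟨g, hg1, hg2, hg3, hg4⟩ := h'
  exact ⟨f + g, hf1.add hg1, hf2.add hg2,
    (tsupport_add f g).trans (union_subset hf3 hg3),
    (Lp.coeFn_add φ ψ).trans (hf4.add hg4)⟩

lemma IsTest.smul {a b : ℝ} {φ : L2Ioo a b} (c : ℝ) (h : IsTest φ) : IsTest (c • φ) := by
  obtain ⟨f, hf1, hf2, hf3, hf4⟩ := h
  refine ⟨c • f, hf1.const_smul c, hf2.mono ?_, ?_, (Lp.coeFn_smul c φ).trans (hf4.const_smul c)⟩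
  · exact Function.support_const_smul_subset c f
  · exact (closure_mono (Function.support_const_smul_subset c f)).trans hf3

/-- `Ĥ^s_0(a, b)`: the `u ∈ L²(a, b)` with `ũ ∈ Ĥ^s(ℝ)` that are limits of a sequence of elements
of `C_0^∞(a, b)` in the norm `‖ũ‖_{Ĥ^s(ℝ)}`. -/
def HsZero (s a b : ℝ) : Submodule ℝ (L2Ioo a b) where
  carrier := {u | hsNorm s (zeroExt u) < ⊤ ∧ ∃ φ : ℕ → L2Ioo a b, (∀ n, IsTest (φ n)) ∧
    Tendsto (fun n => hsNorm s (zeroExt (φ n - u))) atTop (𝓝 0)}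
  zero_mem' := by
    have h0 : hsNorm s (zeroExt (0 : L2Ioo a b)) = 0 := by
      have h := zeroExt_smul (0 : ℝ) (0 : L2Ioo a b)
      rw [smul_zero] at h
      rw [h, hsNorm_smul]; simp
    refine ⟨by rw [h0]; exact ENNReal.zero_lt_top, fun _ => 0, fun _ => IsTest.zero a b, ?_⟩
    simp [h0]
  add_mem' := by
    rintro u v ⟨hu, φ, hφ, hφu⟩ ⟨hv, ψ, hψ, hψv⟩
    constructor
    · rw [zeroExt_add]
      exact (hsNorm_add_le s _ _).trans_lt
        (ENNReal.mul_lt_top (by simp) (ENNReal.add_lt_top.2 ⟨hu, hv⟩))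
    · refine ⟨fun n => φ n + ψ n, fun n => (hφ n).add (hψ n), ?_⟩
      have h := ENNReal.Tendsto.const_mul (a := 2) (hφu.add hψv) (Or.inr (by simp))
      rw [add_zero, mul_zero] at h
      refine tendsto_of_tendsto_of_tendsto_of_le_of_le tendsto_const_nhds h
        (fun _ => zero_le) fun n => ?_
      have e : φ n + ψ n - (u + v) = (φ n - u) + (ψ n - v) := by abel
      change hsNorm s (zeroExt (φ n + ψ n - (u + v))) ≤ _
      rw [e, zeroExt_add]
      exact hsNorm_add_le s _ _
  smul_mem' := by
    rintro c u ⟨hu, φ, hφ, hφu⟩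
    constructor
    · rw [zeroExt_smul, hsNorm_smul]
      exact ENNReal.mul_lt_top (by simp) hu
    · refine ⟨fun n => c • φ n, fun n => (hφ n).smul c, ?_⟩
      have h := ENNReal.Tendsto.const_mul (a := ‖c‖ₑ) hφu (Or.inr (by simp))
      rw [mul_zero] at h
      simpa only [← smul_sub, zeroExt_smul, hsNorm_smul] using h

/-- The norm of `Ĥ^s_0(a, b)`. -/
def hsZeroNorm {s a b : ℝ} (u : HsZero s a b) : ℝ :=
  (hsNorm s (zeroExt (u : L2Ioo a b))).toReal

/-! ### The bilinear form -/

/-- `(f, g)_Ω = ∫_Ω f g` for `Ω = (a, b)`. -/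
def pairing (a b : ℝ) (f g : ℝ → ℝ) : ℝ := ∫ x in Ioo a b, f x * g x

/-- The modified bilinear form `B₂[u, v]`, with `s = (1 + μ)/2` and `s' = (1 - μ)/2`. -/
def B2 (a b α β μ : ℝ) (p q k u v : ℝ → ℝ) : ℝ :=
  -α * pairing a b (leftRLDeriv a ((1 + μ) / 2) u) (rightRLDeriv b ((1 + μ) / 2) v)
  - β * pairing a b (rightRLDeriv b ((1 + μ) / 2) u) (leftRLDeriv a ((1 + μ) / 2) v)
  - α * pairing a b (fun x => derivWithin k (Icc a b) x / k x * leftRLDeriv a μ u x) v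
  + β * pairing a b (fun x => derivWithin k (Icc a b) x / k x * rightRLDeriv b μ u x) v
  + pairing a b (leftRLDeriv a ((1 - μ) / 2) u)
      (rightRLDeriv b ((1 + μ) / 2) (fun x => p x / k x * v x))
  + pairing a b (fun x => q x / k x * u x) v

end

noncomputable section

/-! ### Integral operators on `L²` -/

section Kernel

variable {X : Type*} [MeasurableSpace X] {ν : Measure X}

/-! Write `I^σ` for the left and `J^σ` for the right fractional integral on `(a, b)`, and let `s =
(1 + μ)/2`, so that `1/2 < s < 1`. Everything rests on a representation (`exists_rep`): each `u` in
`HsZero s a b` is `u = I^s g = J^s h` with `g, h` in `L²`, where `‖g‖` and `‖h‖` are at most the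
semi-norm `|u|_s`, and `(g, h) = cos(πs) |u|_s²`. For a test function `ψ` one takes `g = I^{1-s} ψ'`
and `h = -J^{1-s} ψ'`. The kernel `y^{σ-1} / Γ(σ)` is damped by `e^{-εy}`, which makes it integrable
with transform `(ε + 2πiξ)^{-σ}`; Parseval's identity and `ε → 0` then give the claims. The norms
are only inequalities, since the fractional integrals do not vanish outside `(a, b)`. The mixed
product is exact: one factor vanishes to the left of `a`, the other to the right of `b`. Density
carries the representation over to the whole space.

By the semigroup law `I^{1-s} u = I^1 g`, so Lebesgue differentiation identifies the left derivative
of order `s` with `g`; derivatives of lower order `τ` are `I^{s-τ} g`. The right-hand derivatives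
behave in the same way. For `P = p/k` the right derivative of `P u` is `P h` minus a commutator
whose kernel is dominated by that of `J^{1-s}` (`kerApply_mul_eq_primitive`). Hence every term of
the form is an inner product of images under bounded operators, and boundedness follows.

For coercivity, the two leading terms give `-cos(πs) |u|_s²`, which has the right sign because `s >
1/2`. The terms with `k'/k` cost at most `L R_{1-s} R_s |u|_s²`, where `R_σ = (b-a)^σ / Γ(σ+1)` is
the Schur bound of `I^σ`. The reflection formula turns positivity of the difference into the
cotangent hypothesis (`coercivity_constant_pos`). The remaining two terms sum to `((q/k - P'/2) u,
u) ≥ 0` (`inner_derivMul`). The inequality `‖u‖ ≤ R_s |u|_s` upgrades the semi-norm to the norm.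

For existence, `-cos(πs) |u|_s ≤ ‖g‖` shows that `u ↦ g` is an isomorphism onto its range with
equivalent norms. The range is closed in `L²` (`isClosed_range_derivL`), hence a Hilbert space, and
Lax-Milgram applies there. The load is `(f/k, v) = (I^s (f/k), h_v)`, with `v = J^s h_v`. Its norm
is at most that of `I^s (f/k)`, which is in `L²` because `f/k` is integrable and the kernel of order
`s > 1/2` is square integrable. -/

lemma eLpNorm_two_sq {Y E : Type*} [MeasurableSpace Y] [NormedAddCommGroup E] (f : Y → E)
    (μ : Measure Y) : eLpNorm f 2 μ ^ 2 = ∫⁻ x, ‖f x‖ₑ ^ 2 ∂μ := by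
  have h := eLpNorm_nnreal_pow_eq_lintegral (f := f) (μ := μ) (p := 2) (by norm_num)
  simp only [NNReal.coe_ofNat, ENNReal.coe_ofNat, ENNReal.rpow_two] at h
  exact h

lemma ennreal_le_of_sq_le_sq {x y : ℝ≥0∞} (h : x ^ 2 ≤ y ^ 2) : x ≤ y := by
  rw [← ennreal_sq_rpow_half x, ← ennreal_sq_rpow_half y]
  exact ENNReal.rpow_le_rpow h (by norm_num)

/-- The integral operator with kernel `K`. -/
def kerApply (ν : Measure X) (K : X → X → ℝ) (f : X → ℝ) (x : X) : ℝ := ∫ t, K x t * f t ∂ν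

lemma kerApply_congr {K : X → X → ℝ} {f g : X → ℝ} (h : f =ᵐ[ν] g) (x : X) :
    kerApply ν K f x = kerApply ν K g x :=
  integral_congr_ae (h.mono fun t ht => by simp only [ht])

/-- The hypotheses of Schur's test with the same bound in both variables. -/
structure IsSchur (ν : Measure X) (K : X → X → ℝ) (A : ℝ≥0) : Prop where
  meas : Measurable (Function.uncurry K)
  row : ∀ᵐ x ∂ν, ∫⁻ t, ‖K x t‖ₑ ∂ν ≤ A
  col : ∀ᵐ t ∂ν, ∫⁻ x, ‖K x t‖ₑ ∂ν ≤ A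

/-- The transposed kernel. -/
def kerT (K : X → X → ℝ) (x t : X) : ℝ := K t x

lemma IsSchur.swap {K : X → X → ℝ} {A : ℝ≥0} (h : IsSchur ν K A) : IsSchur ν (kerT K) A :=
  ⟨h.meas.comp measurable_swap, h.col, h.row⟩

lemma IsSchur.mono {K L : X → X → ℝ} {A : ℝ≥0} (h : IsSchur ν K A)
    (hL : Measurable (Function.uncurry L)) {c : ℝ≥0} (hLK : ∀ᵐ x ∂ν, ∀ᵐ t ∂ν, ‖L x t‖ₑ ≤ c * ‖K x t‖ₑ)
    (hLK' : ∀ᵐ t ∂ν, ∀ᵐ x ∂ν, ‖L x t‖ₑ ≤ c * ‖K x t‖ₑ) :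
    IsSchur ν L (c * A) := by
  have hmeas := h.meas
  refine ⟨hL, ?_, ?_⟩
  · filter_upwards [h.row, hLK] with x hx hx'
    calc ∫⁻ t, ‖L x t‖ₑ ∂ν ≤ ∫⁻ t, c * ‖K x t‖ₑ ∂ν := lintegral_mono_ae hx'
      _ = c * ∫⁻ t, ‖K x t‖ₑ ∂ν := lintegral_const_mul _ (by fun_prop)
      _ ≤ _ := by push_cast; gcongr
  · filter_upwards [h.col, hLK'] with t hx hx'
    calc ∫⁻ x, ‖L x t‖ₑ ∂ν ≤ ∫⁻ x, c * ‖K x t‖ₑ ∂ν := lintegral_mono_ae hx'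
      _ = c * ∫⁻ x, ‖K x t‖ₑ ∂ν := lintegral_const_mul _ (by fun_prop)
      _ ≤ _ := by push_cast; gcongr

/-- Cauchy-Schwarz for the measure with density `k`, after splitting `k` into two square roots. -/
lemma lintegral_mul_sq_le {k w : X → ℝ≥0∞} (hk : AEMeasurable k ν) (hw : AEMeasurable w ν) :
    (∫⁻ t, k t * w t ∂ν) ^ 2 ≤ (∫⁻ t, k t ∂ν) * ∫⁻ t, k t * w t ^ 2 ∂ν := by
  have h := ENNReal.lintegral_mul_le_Lp_mul_Lq ν Real.HolderConjugate.two_two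
    (f := fun t => k t ^ (1 / 2 : ℝ)) (g := fun t => k t ^ (1 / 2 : ℝ) * w t)
    (hk.pow_const _) ((hk.pow_const _).mul hw)
  have hh : ∀ x : ℝ≥0∞, (x ^ (1 / 2 : ℝ)) ^ 2 = x := fun x => by
    rw [← ENNReal.rpow_natCast, ← ENNReal.rpow_mul]; norm_num
  have e1 : ∀ t, k t ^ (1 / 2 : ℝ) * (k t ^ (1 / 2 : ℝ) * w t) = k t * w t := fun t => by
    rw [← mul_assoc, ← sq, hh]
  simp only [Pi.mul_apply, e1] at h
  calc (∫⁻ t, k t * w t ∂ν) ^ 2 ≤ _ := pow_le_pow_left' h 2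
    _ = _ := by
      rw [mul_pow, hh, hh]
      congr 1
      · refine lintegral_congr fun t => ?_
        rw [ENNReal.rpow_two, hh]
      · refine lintegral_congr fun t => ?_
        rw [ENNReal.rpow_two, mul_pow, hh]

lemma enorm_kerApply_le (K : X → X → ℝ) (f : X → ℝ) (x : X) :
    ‖kerApply ν K f x‖ₑ ≤ ∫⁻ t, ‖K x t‖ₑ * ‖f t‖ₑ ∂ν :=
  (enorm_integral_le_lintegral_enorm _).trans (le_of_eq (lintegral_congr fun _ => enorm_mul _ _))

lemma inner_L2_eq (f g : Lp ℝ 2 ν) : inner ℝ f g = ∫ x, f x * g x ∂ν := by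
  rw [L2.inner_def]
  refine integral_congr_ae (ae_of_all _ fun x => ?_)
  simp [mul_comm]

variable [SFinite ν]

/-- A weighted bound for the kernel integral. -/
lemma IsSchur.lintegral_sq_le {K : X → X → ℝ} {A : ℝ≥0} (h : IsSchur ν K A) {f : X → ℝ≥0∞}
    (hf : AEMeasurable f ν) :
    ∫⁻ x, (∫⁻ t, ‖K x t‖ₑ * f t ∂ν) ^ 2 ∂ν ≤ (A : ℝ≥0∞) ^ 2 * ∫⁻ t, f t ^ 2 ∂ν := by
  have hmeas := h.meas
  have hswap : AEMeasurable (Function.uncurry fun x t => ‖K x t‖ₑ * f t ^ 2) (ν.prod ν) := by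
    refine AEMeasurable.mul (by fun_prop) ?_
    exact (hf.pow_const 2).comp_snd
  calc ∫⁻ x, (∫⁻ t, ‖K x t‖ₑ * f t ∂ν) ^ 2 ∂ν
      ≤ ∫⁻ x, A * ∫⁻ t, ‖K x t‖ₑ * f t ^ 2 ∂ν ∂ν := by
        -- Schur's test: weighted Cauchy-Schwarz spends the row bound here; the column bound is
        -- spent after Tonelli.
        refine lintegral_mono_ae (h.row.mono fun x hx => ?_)
        refine (lintegral_mul_sq_le (by fun_prop) hf).trans ?_
        gcongr
    _ = A * ∫⁻ x, ∫⁻ t, ‖K x t‖ₑ * f t ^ 2 ∂ν ∂ν :=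
        lintegral_const_mul' _ _ ENNReal.coe_ne_top
    _ = A * ∫⁻ t, ∫⁻ x, ‖K x t‖ₑ * f t ^ 2 ∂ν ∂ν := by rw [lintegral_lintegral_swap hswap]
    _ = A * ∫⁻ t, (∫⁻ x, ‖K x t‖ₑ ∂ν) * f t ^ 2 ∂ν := by
        congr 1
        refine lintegral_congr fun t => ?_
        rw [lintegral_mul_const _ (by fun_prop)]
    _ ≤ A * ∫⁻ t, A * f t ^ 2 ∂ν := by
        gcongr 1
        refine lintegral_mono_ae (h.col.mono fun t ht => ?_)
        gcongr
    _ = _ := by rw [lintegral_const_mul' _ _ ENNReal.coe_ne_top, sq, mul_assoc]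

lemma aestronglyMeasurable_kerApply {K : X → X → ℝ} (hK : Measurable (Function.uncurry K))
    {f : X → ℝ} (hf : AEStronglyMeasurable f ν) : AEStronglyMeasurable (kerApply ν K f) ν := by
  refine AEStronglyMeasurable.integral_prod_right' (f := fun p : X × X => K p.1 p.2 * f p.2) ?_
  exact hK.aestronglyMeasurable.mul hf.comp_snd

lemma IsSchur.eLpNorm_kerApply_le {K : X → X → ℝ} {A : ℝ≥0} (h : IsSchur ν K A) {f : X → ℝ}
    (hf : AEStronglyMeasurable f ν) :
    eLpNorm (kerApply ν K f) 2 ν ≤ A * eLpNorm f 2 ν := by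
  refine ennreal_le_of_sq_le_sq ?_
  rw [mul_pow, eLpNorm_two_sq, eLpNorm_two_sq]
  refine le_trans (lintegral_mono fun x => ?_) (h.lintegral_sq_le hf.enorm)
  gcongr
  exact enorm_kerApply_le K f x

lemma IsSchur.memLp_kerApply {K : X → X → ℝ} {A : ℝ≥0} (h : IsSchur ν K A) {f : X → ℝ}
    (hf : MemLp f 2 ν) : MemLp (kerApply ν K f) 2 ν :=
  ⟨aestronglyMeasurable_kerApply h.meas hf.1,
    (h.eLpNorm_kerApply_le hf.1).trans_lt (ENNReal.mul_lt_top ENNReal.coe_lt_top hf.2)⟩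

lemma IsSchur.ae_integrable {K : X → X → ℝ} {A : ℝ≥0} (h : IsSchur ν K A) {f : X → ℝ}
    (hf : MemLp f 2 ν) : ∀ᵐ x ∂ν, Integrable (fun t => K x t * f t) ν := by
  have hmeas := h.meas
  have hlt : ∫⁻ x, (∫⁻ t, ‖K x t‖ₑ * ‖f t‖ₑ ∂ν) ^ 2 ∂ν ≠ ⊤ := by
    refine ((h.lintegral_sq_le hf.1.enorm).trans_lt ?_).ne
    rw [← eLpNorm_two_sq]
    exact ENNReal.mul_lt_top (by simp) (ENNReal.pow_lt_top hf.2)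
  have hm : AEMeasurable (fun x => (∫⁻ t, ‖K x t‖ₑ * ‖f t‖ₑ ∂ν) ^ 2) ν := by
    refine AEMeasurable.pow_const ?_ 2
    refine AEMeasurable.lintegral_prod_right' (f := fun p : X × X => ‖K p.1 p.2‖ₑ * ‖f p.2‖ₑ) ?_
    exact AEMeasurable.mul (by fun_prop) hf.1.comp_snd.enorm
  filter_upwards [ae_lt_top' hm hlt] with x hx
  refine ⟨AEStronglyMeasurable.mul (by fun_prop) hf.1, ?_⟩
  rw [hasFiniteIntegral_iff_enorm]
  simp only [enorm_mul]
  exact lt_top_iff_ne_top.2 fun h0 => by simp [h0] at hx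

/-- The operator on `L²` given by a kernel that satisfies Schur's test. -/
def schurOp {K : X → X → ℝ} {A : ℝ≥0} (h : IsSchur ν K A) : Lp ℝ 2 ν →L[ℝ] Lp ℝ 2 ν :=
  LinearMap.mkContinuous
    { toFun := fun f => (h.memLp_kerApply (Lp.memLp f)).toLp
      map_add' := by
        intro f g
        rw [← MemLp.toLp_add]
        refine MemLp.toLp_congr _ _ ?_
        filter_upwards [h.ae_integrable (Lp.memLp f), h.ae_integrable (Lp.memLp g)] with x h1 h2
        rw [kerApply_congr (Lp.coeFn_add f g), Pi.add_apply, kerApply, kerApply, kerApply,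
          ← integral_add h1 h2]
        simp only [Pi.add_apply, mul_add]
      map_smul' := by
        intro c f
        rw [RingHom.id_apply, ← MemLp.toLp_const_smul]
        refine MemLp.toLp_congr _ _ (ae_of_all _ fun x => ?_)
        rw [kerApply_congr (Lp.coeFn_smul c f), Pi.smul_apply, kerApply, kerApply, smul_eq_mul,
          ← integral_const_mul]
        simp only [Pi.smul_apply, smul_eq_mul, mul_left_comm] }
    A (fun f => by
      rw [LinearMap.coe_mk, AddHom.coe_mk, Lp.norm_toLp, Lp.norm_def]
      refine (ENNReal.toReal_mono ?_ (h.eLpNorm_kerApply_le (Lp.memLp f).1)).trans_eq (by simp)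
      exact ENNReal.mul_ne_top ENNReal.coe_ne_top (Lp.memLp f).2.ne)

lemma schurOp_coe {K : X → X → ℝ} {A : ℝ≥0} (h : IsSchur ν K A) (f : Lp ℝ 2 ν) :
    schurOp h f =ᵐ[ν] kerApply ν K f :=
  MemLp.coeFn_toLp (h.memLp_kerApply (Lp.memLp f))

lemma norm_schurOp_le {K : X → X → ℝ} {A : ℝ≥0} (h : IsSchur ν K A) (f : Lp ℝ 2 ν) :
    ‖schurOp h f‖ ≤ A * ‖f‖ :=
  (LinearMap.mkContinuous _ _ _).le_of_opNorm_le
    (LinearMap.mkContinuous_norm_le _ A.coe_nonneg _) f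

/-- Fubini: the composition of two kernels. -/
lemma kerApply_kerApply {K L : X → X → ℝ} {f : X → ℝ} {x : X}
    (h : Integrable (fun p : X × X => K x p.1 * L p.1 p.2 * f p.2) (ν.prod ν)) :
    kerApply ν K (kerApply ν L f) x = kerApply ν (fun x t => ∫ y, K x y * L y t ∂ν) f x := by
  simp only [kerApply, ← integral_const_mul, ← integral_mul_const, ← mul_assoc]
  exact integral_integral_swap h

/-- Fubini at one fixed `x`: it is enough that the composed absolute kernel is bounded in `t`, and
`f` need only be integrable. This yields identities at every point, which differentiation later
requires. -/
lemma integrable_kernel_comp {K L : X → X → ℝ} {f : X → ℝ} {x : X}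
    (hK : Measurable (K x)) (hL : Measurable (Function.uncurry L)) (hf : Integrable f ν)
    {C : ℝ≥0} (hC : ∀ᵐ t ∂ν, ∫⁻ y, ‖K x y * L y t‖ₑ ∂ν ≤ C) :
    Integrable (fun p : X × X => K x p.1 * L p.1 p.2 * f p.2) (ν.prod ν) := by
  have hKL : Measurable fun p : X × X => K x p.1 * L p.1 p.2 :=
    (hK.comp measurable_fst).mul hL
  refine ⟨hKL.aestronglyMeasurable.mul hf.1.comp_snd, ?_⟩
  rw [hasFiniteIntegral_iff_enorm, lintegral_prod_symm]
  · calc ∫⁻ t, ∫⁻ y, ‖K x y * L y t * f t‖ₑ ∂ν ∂ν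
        = ∫⁻ t, (∫⁻ y, ‖K x y * L y t‖ₑ ∂ν) * ‖f t‖ₑ ∂ν := by
          refine lintegral_congr fun t => ?_
          rw [← lintegral_mul_const]
          · simp only [enorm_mul]
          · exact (hKL.comp (measurable_id.prodMk measurable_const)).enorm
      _ ≤ ∫⁻ t, C * ‖f t‖ₑ ∂ν := by
          refine lintegral_mono_ae (hC.mono fun t ht => ?_)
          gcongr
      _ = C * ∫⁻ t, ‖f t‖ₑ ∂ν := lintegral_const_mul' _ _ ENNReal.coe_ne_top
      _ < ⊤ := ENNReal.mul_lt_top ENNReal.coe_lt_top hf.2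
  · exact (hKL.aestronglyMeasurable.mul hf.1.comp_snd).enorm

lemma kerApply_kerApply_of_bound {K L : X → X → ℝ} {f : X → ℝ} {x : X}
    (hK : Measurable (K x)) (hL : Measurable (Function.uncurry L)) (hf : Integrable f ν)
    {C : ℝ≥0} (hC : ∀ᵐ t ∂ν, ∫⁻ y, ‖K x y * L y t‖ₑ ∂ν ≤ C) :
    kerApply ν K (kerApply ν L f) x = kerApply ν (fun x t => ∫ y, K x y * L y t ∂ν) f x :=
  kerApply_kerApply (integrable_kernel_comp hK hL hf hC)

lemma integrable_mul_kerApply {K L : X → X → ℝ} {f : X → ℝ} {x : X}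
    (hK : Measurable (K x)) (hL : Measurable (Function.uncurry L)) (hf : Integrable f ν)
    {C : ℝ≥0} (hC : ∀ᵐ t ∂ν, ∫⁻ y, ‖K x y * L y t‖ₑ ∂ν ≤ C) :
    Integrable (fun y => K x y * kerApply ν L f y) ν := by
  have h := (integrable_kernel_comp hK hL hf hC).integral_prod_left
  simpa only [kerApply, ← integral_const_mul, mul_assoc] using h

/-- Fubini: transposition of a kernel. -/
lemma integral_kerApply_mul {K : X → X → ℝ} {f g : X → ℝ}
    (h : Integrable (fun p : X × X => K p.1 p.2 * f p.2 * g p.1) (ν.prod ν)) :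
    ∫ x, kerApply ν K f x * g x ∂ν = ∫ t, f t * kerApply ν (kerT K) g t ∂ν := by
  simp only [kerApply, kerT, ← integral_const_mul, ← integral_mul_const]
  rw [integral_integral_swap h]
  refine integral_congr_ae (ae_of_all _ fun t => integral_congr_ae (ae_of_all _ fun x => ?_))
  simp only [mul_left_comm, mul_comm]

lemma integrable_kernel_of_lintegral_lt_top {K : X → X → ℝ} {f g : X → ℝ}
    (hK : Measurable (Function.uncurry K)) (hf : AEStronglyMeasurable f ν)
    (hg : AEStronglyMeasurable g ν)
    (h : ∫⁻ x, (∫⁻ t, ‖K x t‖ₑ * ‖f t‖ₑ ∂ν) * ‖g x‖ₑ ∂ν < ⊤) :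
    Integrable (fun p : X × X => K p.1 p.2 * f p.2 * g p.1) (ν.prod ν) := by
  have hm : AEStronglyMeasurable (fun p : X × X => K p.1 p.2 * f p.2 * g p.1) (ν.prod ν) :=
    (hK.aestronglyMeasurable.mul hf.comp_snd).mul hg.comp_fst
  refine ⟨hm, ?_⟩
  rw [hasFiniteIntegral_iff_enorm, lintegral_prod _ hm.enorm]
  refine lt_of_le_of_lt (lintegral_mono fun x => le_of_eq ?_) h
  rw [← lintegral_mul_const'']
  · simp only [enorm_mul]
  · exact AEMeasurable.mul
      (hK.comp (measurable_const.prodMk measurable_id)).enorm.aemeasurable hf.enorm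

/-- Schur's test applied to `|K|` and `|f|` puts the inner integral in `L²`; Hölder's inequality
pairs it with `g`. -/
lemma IsSchur.integrable_kernel {K : X → X → ℝ} {A : ℝ≥0} (h : IsSchur ν K A) {f g : X → ℝ}
    (hf : MemLp f 2 ν) (hg : MemLp g 2 ν) :
    Integrable (fun p : X × X => K p.1 p.2 * f p.2 * g p.1) (ν.prod ν) := by
  have hmeas := h.meas
  refine integrable_kernel_of_lintegral_lt_top hmeas hf.1 hg.1 ?_
  have hm : AEMeasurable (fun x => ∫⁻ t, ‖K x t‖ₑ * ‖f t‖ₑ ∂ν) ν := by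
    refine AEMeasurable.lintegral_prod_right' (f := fun p : X × X => ‖K p.1 p.2‖ₑ * ‖f p.2‖ₑ) ?_
    exact AEMeasurable.mul (by fun_prop) hf.1.comp_snd.enorm
  refine (ENNReal.lintegral_mul_le_Lp_mul_Lq ν Real.HolderConjugate.two_two hm hg.1.enorm).trans_lt
    ?_
  refine ENNReal.mul_lt_top (ENNReal.rpow_lt_top_of_nonneg one_half_pos.le ?_)
    (ENNReal.rpow_lt_top_of_nonneg one_half_pos.le ?_)
  · simp only [ENNReal.rpow_two]
    refine ((h.lintegral_sq_le hf.1.enorm).trans_lt ?_).ne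
    rw [← eLpNorm_two_sq]
    exact ENNReal.mul_lt_top (by simp) (ENNReal.pow_lt_top hf.2)
  · simp only [ENNReal.rpow_two]
    rw [← eLpNorm_two_sq]
    exact (ENNReal.pow_lt_top hg.2).ne

lemma inner_schurOp {K : X → X → ℝ} {A : ℝ≥0} (h : IsSchur ν K A) (f g : Lp ℝ 2 ν) :
    inner ℝ (schurOp h f) g = inner ℝ f (schurOp h.swap g) := by
  rw [inner_L2_eq, inner_L2_eq]
  have e1 : ∫ x, schurOp h f x * g x ∂ν = ∫ x, kerApply ν K f x * g x ∂ν :=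
    integral_congr_ae ((schurOp_coe h f).mono fun x hx => by simp only [hx])
  have e2 : ∫ x, f x * schurOp h.swap g x ∂ν = ∫ x, f x * kerApply ν (kerT K) g x ∂ν :=
    integral_congr_ae ((schurOp_coe h.swap g).mono fun x hx => by simp only [hx])
  rw [e1, e2, integral_kerApply_mul (h.integrable_kernel (Lp.memLp f) (Lp.memLp g))]

end Kernel

/-! ### Riemann-Liouville kernels -/

/-- The kernel of the left Riemann-Liouville integral of order `σ`. -/
def rlKer (σ x t : ℝ) : ℝ := if t < x then (x - t) ^ (σ - 1) / Real.Gamma σ else 0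

/-- Lebesgue measure on `(a, b)`. -/
abbrev volIoo (a b : ℝ) : Measure ℝ := volume.restrict (Ioo a b)

lemma measurable_rlKer (σ : ℝ) : Measurable (Function.uncurry (rlKer σ)) := by
  refine Measurable.ite (measurableSet_lt measurable_snd measurable_fst) ?_ measurable_const
  fun_prop

lemma rlKer_nonneg {σ : ℝ} (hσ : 0 < σ) (x t : ℝ) : 0 ≤ rlKer σ x t := by
  rw [rlKer]
  split_ifs with h
  · have := sub_pos.2 h
    have := Real.Gamma_pos_of_pos hσ
    positivity
  · exact le_rfl

lemma ae_mem_volIoo (a b : ℝ) : ∀ᵐ x ∂volIoo a b, x ∈ Ioo a b := ae_restrict_mem measurableSet_Ioo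

lemma setIntegral_Ioo_ite_lt {a b x : ℝ} (hx : x ∈ Ioo a b) (f : ℝ → ℝ) :
    ∫ t in Ioo a b, (if t < x then f t else 0) = ∫ t in a..x, f t := by
  have h : (fun t => if t < x then f t else 0) = (Iio x).indicator f := by
    ext t; simp [indicator_apply]
  rw [h, setIntegral_indicator measurableSet_Iio, intervalIntegral.integral_of_le hx.1.le,
    integral_Ioc_eq_integral_Ioo]
  congr 2
  ext t
  simp only [mem_inter_iff, mem_Ioo, mem_Iio]
  exact ⟨fun h => ⟨h.1.1, h.2⟩, fun h => ⟨⟨h.1, h.2.trans hx.2⟩, h.2⟩⟩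

lemma setIntegral_Ioo_ite_gt {a b x : ℝ} (hx : x ∈ Ioo a b) (f : ℝ → ℝ) :
    ∫ t in Ioo a b, (if x < t then f t else 0) = ∫ t in x..b, f t := by
  have h : (fun t => if x < t then f t else 0) = (Ioi x).indicator f := by
    ext t; simp [indicator_apply]
  rw [h, setIntegral_indicator measurableSet_Ioi, intervalIntegral.integral_of_le hx.2.le,
    integral_Ioc_eq_integral_Ioo]
  congr 2
  ext t
  simp only [mem_inter_iff, mem_Ioo, mem_Ioi]
  exact ⟨fun h => ⟨h.2, h.1.2⟩, fun h => ⟨⟨hx.1.trans h.1, h.2⟩, h.1⟩⟩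

lemma leftRLInt_eq_kerApply {a b x : ℝ} (hx : x ∈ Ioo a b) (σ : ℝ) (w : ℝ → ℝ) :
    leftRLInt a σ w x = kerApply (volIoo a b) (rlKer σ) w x := by
  rw [leftRLInt, kerApply, ← intervalIntegral.integral_const_mul,
    ← setIntegral_Ioo_ite_lt hx]
  refine integral_congr_ae (ae_of_all _ fun t => ?_)
  simp only [rlKer]
  split_ifs <;> ring

lemma rightRLInt_eq_kerApply {a b x : ℝ} (hx : x ∈ Ioo a b) (σ : ℝ) (w : ℝ → ℝ) :
    rightRLInt b σ w x = kerApply (volIoo a b) (kerT (rlKer σ)) w x := by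
  rw [rightRLInt, kerApply, ← intervalIntegral.integral_const_mul,
    ← setIntegral_Ioo_ite_gt hx]
  refine integral_congr_ae (ae_of_all _ fun t => ?_)
  simp only [rlKer, kerT]
  split_ifs <;> ring

lemma kerApply_rlKer_one {a b x : ℝ} (hx : x ∈ Ioo a b) (w : ℝ → ℝ) :
    kerApply (volIoo a b) (rlKer 1) w x = ∫ t in a..x, w t := by
  rw [← leftRLInt_eq_kerApply hx, leftRLInt]
  simp

lemma kerApply_kerT_rlKer_one {a b x : ℝ} (hx : x ∈ Ioo a b) (w : ℝ → ℝ) :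
    kerApply (volIoo a b) (kerT (rlKer 1)) w x = ∫ t in x..b, w t := by
  rw [← rightRLInt_eq_kerApply hx, rightRLInt]
  simp

lemma lintegral_rlKer_row {σ : ℝ} (hσ : 0 < σ) {a b x : ℝ} (hx : x ∈ Ioo a b) :
    ∫⁻ t, ‖rlKer σ x t‖ₑ ∂volIoo a b = ENNReal.ofReal ((x - a) ^ σ / Real.Gamma (σ + 1)) := by
  have hΓ := Real.Gamma_pos_of_pos hσ
  have hi : ∫ t, rlKer σ x t ∂volIoo a b = (x - a) ^ σ / Real.Gamma (σ + 1) := by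
    have h := leftRLInt_eq_kerApply hx σ (fun _ => 1)
    simp only [kerApply, mul_one, leftRLInt] at h
    rw [← h, intervalIntegral.integral_comp_sub_left (fun t => t ^ (σ - 1)), sub_self,
      integral_rpow (Or.inl (by linarith)), Real.Gamma_add_one hσ.ne']
    rw [sub_add_cancel, Real.zero_rpow hσ.ne']
    field_simp
    ring
  have hpos : 0 < (x - a) ^ σ / Real.Gamma (σ + 1) :=
    div_pos (Real.rpow_pos_of_pos (sub_pos.2 hx.1) _) (Real.Gamma_pos_of_pos (by linarith))
  -- The Bochner integral of a non-integrable function is zero, so a positive value already proves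
  -- integrability.
  have hint : Integrable (rlKer σ x) (volIoo a b) :=
    Integrable.of_integral_ne_zero (by rw [hi]; exact hpos.ne')
  rw [← hi, ofReal_integral_eq_lintegral_ofReal hint (ae_of_all _ fun t => rlKer_nonneg hσ x t)]
  refine lintegral_congr fun t => ?_
  rw [Real.enorm_of_nonneg (rlKer_nonneg hσ x t)]

lemma lintegral_rlKer_col {σ : ℝ} (hσ : 0 < σ) {a b t : ℝ} (ht : t ∈ Ioo a b) :
    ∫⁻ x, ‖rlKer σ x t‖ₑ ∂volIoo a b = ENNReal.ofReal ((b - t) ^ σ / Real.Gamma (σ + 1)) := by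
  have hΓ := Real.Gamma_pos_of_pos hσ
  have hi : ∫ x, rlKer σ x t ∂volIoo a b = (b - t) ^ σ / Real.Gamma (σ + 1) := by
    have h := rightRLInt_eq_kerApply ht σ (fun _ => 1)
    simp only [kerApply, kerT, mul_one, rightRLInt] at h
    rw [← h, intervalIntegral.integral_comp_sub_right (fun t => t ^ (σ - 1)), sub_self,
      integral_rpow (Or.inl (by linarith)), Real.Gamma_add_one hσ.ne']
    rw [sub_add_cancel, Real.zero_rpow hσ.ne']
    field_simp
    ring
  have hpos : 0 < (b - t) ^ σ / Real.Gamma (σ + 1) :=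
    div_pos (Real.rpow_pos_of_pos (sub_pos.2 ht.2) _) (Real.Gamma_pos_of_pos (by linarith))
  have hint : Integrable (fun x => rlKer σ x t) (volIoo a b) :=
    Integrable.of_integral_ne_zero (by rw [hi]; exact hpos.ne')
  rw [← hi, ofReal_integral_eq_lintegral_ofReal hint (ae_of_all _ fun x => rlKer_nonneg hσ x t)]
  refine lintegral_congr fun x => ?_
  rw [Real.enorm_of_nonneg (rlKer_nonneg hσ x t)]

/-- The norm bound of the Riemann-Liouville integral of order `σ` on `(a, b)`. -/
def rlBound (a b σ : ℝ) : ℝ≥0 := ((b - a) ^ σ / Real.Gamma (σ + 1)).toNNReal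

lemma isSchur_rlKer (a b : ℝ) {σ : ℝ} (hσ : 0 < σ) :
    IsSchur (volIoo a b) (rlKer σ) (rlBound a b σ) := by
  have hΓ : 0 < Real.Gamma (σ + 1) := Real.Gamma_pos_of_pos (by linarith)
  refine ⟨measurable_rlKer σ, ?_, ?_⟩
  · filter_upwards [ae_mem_volIoo a b] with x hx
    rw [lintegral_rlKer_row hσ hx]
    refine ENNReal.ofReal_le_ofReal ?_
    have := sub_pos.2 hx.1
    have := hx.2
    gcongr
  · filter_upwards [ae_mem_volIoo a b] with t ht
    rw [lintegral_rlKer_col hσ ht]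
    refine ENNReal.ofReal_le_ofReal ?_
    have := sub_pos.2 ht.2
    have := ht.1
    gcongr

/-- This is Euler's Beta integral scaled to `(0, c)`; it is transported from the complex version. -/
lemma integral_rpow_mul_rpow_sub {σ τ c : ℝ} (hσ : 0 < σ) (hτ : 0 < τ) (hc : 0 < c) :
    ∫ y in (0 : ℝ)..c, y ^ (τ - 1) * (c - y) ^ (σ - 1) =
      c ^ (σ + τ - 1) * (Real.Gamma σ * Real.Gamma τ / Real.Gamma (σ + τ)) := by
  have h := Complex.betaIntegral_scaled τ σ hc
  rw [Complex.betaIntegral_eq_Gamma_mul_div _ _ (by simpa) (by simpa)] at h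
  apply Complex.ofReal_injective
  rw [← intervalIntegral.integral_ofReal]
  convert h using 1
  · refine intervalIntegral.integral_congr fun y hy => ?_
    rw [uIcc_of_le hc.le] at hy
    push_cast
    rw [Complex.ofReal_cpow hy.1, Complex.ofReal_cpow (sub_nonneg.2 hy.2)]
    push_cast
    rfl
  · push_cast
    rw [Complex.ofReal_cpow hc.le, ← Complex.Gamma_ofReal, ← Complex.Gamma_ofReal,
      ← Complex.Gamma_ofReal]
    push_cast
    rw [add_comm (σ : ℂ) τ, mul_comm (Complex.Gamma σ)]

/-- The semigroup property of the Riemann-Liouville kernels. -/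
lemma integral_rlKer_mul_rlKer {σ τ : ℝ} (hσ : 0 < σ) (hτ : 0 < τ) {a b x t : ℝ}
    (hx : x ∈ Ioo a b) (ht : t ∈ Ioo a b) :
    ∫ y, rlKer σ x y * rlKer τ y t ∂volIoo a b = rlKer (σ + τ) x t := by
  have hΓσ := Real.Gamma_pos_of_pos hσ
  have hΓτ := Real.Gamma_pos_of_pos hτ
  by_cases htx : t < x
  · have e : ∀ y, rlKer σ x y * rlKer τ y t =
        if t < y then (if y < x then (x - y) ^ (σ - 1) / Real.Gamma σ *
          ((y - t) ^ (τ - 1) / Real.Gamma τ) else 0) else 0 := fun y => by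
      simp only [rlKer]; split_ifs <;> simp
    simp only [e]
    rw [setIntegral_Ioo_ite_gt ht, intervalIntegral.integral_of_le ht.2.le,
      integral_Ioc_eq_integral_Ioo, setIntegral_Ioo_ite_lt ⟨htx, hx.2⟩]
    have h := intervalIntegral.integral_comp_sub_right
      (fun y => y ^ (τ - 1) * ((x - t) - y) ^ (σ - 1)) (a := t) (b := x) t
    rw [sub_self, integral_rpow_mul_rpow_sub hσ hτ (sub_pos.2 htx)] at h
    have e2 : ∀ y, (x - y) ^ (σ - 1) / Real.Gamma σ * ((y - t) ^ (τ - 1) / Real.Gamma τ) =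
        1 / (Real.Gamma σ * Real.Gamma τ) * ((y - t) ^ (τ - 1) * (x - t - (y - t)) ^ (σ - 1)) :=
      fun y => by rw [show x - t - (y - t) = x - y by ring]; field_simp
    simp only [e2]
    rw [intervalIntegral.integral_const_mul, h, rlKer, if_pos htx]
    field_simp
  · have e : ∀ y, rlKer σ x y * rlKer τ y t = 0 := fun y => by
      simp only [rlKer]
      split_ifs with h1 h2
      · exact absurd (h2.trans h1) htx
      all_goals simp
    simp only [e, integral_zero]
    rw [rlKer, if_neg htx]

/-- The kernels are nonnegative, so the semigroup identity also gives the absolute convergence that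
Fubini needs. -/
lemma lintegral_rlKer_mul_rlKer {σ τ : ℝ} (hσ : 0 < σ) (hτ : 0 < τ) {a b x t : ℝ}
    (hx : x ∈ Ioo a b) (ht : t ∈ Ioo a b) :
    ∫⁻ y, ‖rlKer σ x y * rlKer τ y t‖ₑ ∂volIoo a b = ENNReal.ofReal (rlKer (σ + τ) x t) := by
  have hnn : ∀ y, 0 ≤ rlKer σ x y * rlKer τ y t := fun y =>
    mul_nonneg (rlKer_nonneg hσ x y) (rlKer_nonneg hτ y t)
  have e : ∫⁻ y, ‖rlKer σ x y * rlKer τ y t‖ₑ ∂volIoo a b =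
      ∫⁻ y, ENNReal.ofReal (rlKer σ x y * rlKer τ y t) ∂volIoo a b :=
    lintegral_congr fun y => Real.enorm_of_nonneg (hnn y)
  by_cases htx : t < x
  · have h := integral_rlKer_mul_rlKer hσ hτ hx ht
    have hpos : 0 < rlKer (σ + τ) x t := by
      rw [rlKer, if_pos htx]
      exact div_pos (Real.rpow_pos_of_pos (sub_pos.2 htx) _)
        (Real.Gamma_pos_of_pos (add_pos hσ hτ))
    rw [e, ← h, ofReal_integral_eq_lintegral_ofReal
      (Integrable.of_integral_ne_zero (by rw [h]; exact hpos.ne')) (ae_of_all _ hnn)]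
  · have e0 : ∀ y, rlKer σ x y * rlKer τ y t = 0 := fun y => by
      simp only [rlKer]
      split_ifs with h1 h2
      · exact absurd (h2.trans h1) htx
      all_goals simp
    simp only [e0, enorm_zero, lintegral_zero]
    rw [rlKer, if_neg htx, ENNReal.ofReal_zero]

/-- For `σ < 1` the kernel is singular on the diagonal. Boundedness from order one on is the source
of the condition `1 ≤ σ + τ` in the pointwise composition laws. -/
lemma rlKer_le {σ a b x t : ℝ} (hσ : 1 ≤ σ) (hx : x ∈ Ioo a b) (ht : t ∈ Ioo a b) :
    rlKer σ x t ≤ (b - a) ^ (σ - 1) / Real.Gamma σ := by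
  have hΓ := Real.Gamma_pos_of_pos (zero_lt_one.trans_le hσ)
  have hab := hx.1.trans hx.2
  rw [rlKer]
  split_ifs with h
  · have := sub_pos.2 h
    have := hx.2
    have := ht.1
    gcongr
  · have := sub_pos.2 hab
    positivity

/-- With total order at least one the composed kernel is bounded, so Fubini holds at every `x` in
the interval and not merely almost everywhere. -/
lemma kerApply_rlKer_rlKer {σ τ : ℝ} (hσ : 0 < σ) (hτ : 0 < τ) (hστ : 1 ≤ σ + τ) {a b x : ℝ}
    (hx : x ∈ Ioo a b) {f : ℝ → ℝ} (hf : Integrable f (volIoo a b)) :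
    kerApply (volIoo a b) (rlKer σ) (kerApply (volIoo a b) (rlKer τ) f) x =
      kerApply (volIoo a b) (rlKer (σ + τ)) f x := by
  rw [kerApply_kerApply_of_bound
    ((measurable_rlKer σ).comp (measurable_const.prodMk measurable_id)) (measurable_rlKer τ) hf
    (C := ((b - a) ^ (σ + τ - 1) / Real.Gamma (σ + τ)).toNNReal)]
  · refine integral_congr_ae ?_
    filter_upwards [ae_mem_volIoo a b] with t ht
    simp only [integral_rlKer_mul_rlKer hσ hτ hx ht]
  · filter_upwards [ae_mem_volIoo a b] with t ht
    rw [lintegral_rlKer_mul_rlKer hσ hτ hx ht]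
    exact ENNReal.ofReal_le_ofReal (rlKer_le hστ hx ht)

lemma kerApply_kerT_rlKer_kerT_rlKer {σ τ : ℝ} (hσ : 0 < σ) (hτ : 0 < τ) (hστ : 1 ≤ σ + τ)
    {a b x : ℝ} (hx : x ∈ Ioo a b) {f : ℝ → ℝ} (hf : Integrable f (volIoo a b)) :
    kerApply (volIoo a b) (kerT (rlKer σ)) (kerApply (volIoo a b) (kerT (rlKer τ)) f) x =
      kerApply (volIoo a b) (kerT (rlKer (σ + τ))) f x := by
  rw [kerApply_kerApply_of_bound (K := kerT (rlKer σ)) (L := kerT (rlKer τ))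
    ((measurable_rlKer σ).comp (measurable_id.prodMk measurable_const))
    ((measurable_rlKer τ).comp measurable_swap) hf
    (C := ((b - a) ^ (σ + τ - 1) / Real.Gamma (σ + τ)).toNNReal)]
  · refine integral_congr_ae ?_
    filter_upwards [ae_mem_volIoo a b] with t ht
    simp only [kerT, mul_comm (rlKer σ _ x)]
    -- Transposition reverses the order of composition, hence the exchanged roles of `σ` and `τ`.
    rw [integral_rlKer_mul_rlKer hτ hσ ht hx, add_comm]
  · filter_upwards [ae_mem_volIoo a b] with t ht
    simp only [kerT, mul_comm (rlKer σ _ x)]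
    rw [lintegral_rlKer_mul_rlKer hτ hσ ht hx, add_comm]
    exact ENNReal.ofReal_le_ofReal (rlKer_le hστ ht hx)

lemma integrable_kerT_rlKer_mul {σ τ : ℝ} (hσ : 0 < σ) (hτ : 0 < τ) (hστ : 1 ≤ σ + τ)
    {a b x : ℝ} (hx : x ∈ Ioo a b) {f : ℝ → ℝ} (hf : Integrable f (volIoo a b)) :
    Integrable (fun y => kerT (rlKer σ) x y * kerApply (volIoo a b) (kerT (rlKer τ)) f y)
      (volIoo a b) := by
  refine integrable_mul_kerApply (K := kerT (rlKer σ)) (L := kerT (rlKer τ))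
    ((measurable_rlKer σ).comp (measurable_id.prodMk measurable_const))
    ((measurable_rlKer τ).comp measurable_swap) hf
    (C := ((b - a) ^ (σ + τ - 1) / Real.Gamma (σ + τ)).toNNReal) ?_
  filter_upwards [ae_mem_volIoo a b] with t ht
  simp only [kerT, mul_comm (rlKer σ _ x)]
  rw [lintegral_rlKer_mul_rlKer hτ hσ ht hx, add_comm]
  exact ENNReal.ofReal_le_ofReal (rlKer_le hστ ht hx)

/-! ### Riemann-Liouville derivatives of functions represented by kernels -/

/-- Lebesgue's differentiation theorem: once the integral of order `1 - τ` is a primitive of `h`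
throughout the open interval, `h` is the derivative almost everywhere. -/
lemma leftRLDeriv_of_primitive {a b τ : ℝ} (hab : a < b) {w h : ℝ → ℝ}
    (hh : MemLp h 2 (volIoo a b))
    (H : ∀ x ∈ Ioo a b, leftRLInt a (1 - τ) w x = kerApply (volIoo a b) (rlKer 1) h x) :
    LeftRLDerivInL2 a b τ w ∧ leftRLDeriv a τ w =ᵐ[volIoo a b] h := by
  have hint : IntervalIntegrable h volume a b :=
    (intervalIntegrable_iff_integrableOn_Ioo_of_le hab.le).2 (hh.integrable one_le_two)
  have hd : ∀ᵐ x ∂volIoo a b, HasDerivAt (leftRLInt a (1 - τ) w) (h x) x := by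
    rw [ae_restrict_iff' measurableSet_Ioo]
    filter_upwards [hint.ae_hasDerivAt_integral] with x hx hxab
    rw [uIcc_of_le hab.le] at hx
    refine (hx (Ioo_subset_Icc_self hxab) a (left_mem_Icc.2 hab.le)).congr_of_eventuallyEq ?_
    filter_upwards [isOpen_Ioo.mem_nhds hxab] with y hy
    rw [H y hy, kerApply_rlKer_one hy]
  have hae : leftRLDeriv a τ w =ᵐ[volIoo a b] h := hd.mono fun x hx => hx.deriv
  exact ⟨⟨hd.mono fun x hx => hx.differentiableAt, hh.ae_eq hae.symm⟩, hae⟩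

lemma rightRLDeriv_of_primitive {a b τ : ℝ} (hab : a < b) {w h : ℝ → ℝ}
    (hh : MemLp h 2 (volIoo a b))
    (H : ∀ x ∈ Ioo a b, rightRLInt b (1 - τ) w x = kerApply (volIoo a b) (kerT (rlKer 1)) h x) :
    RightRLDerivInL2 a b τ w ∧ rightRLDeriv b τ w =ᵐ[volIoo a b] h := by
  have hint : IntervalIntegrable h volume a b :=
    (intervalIntegrable_iff_integrableOn_Ioo_of_le hab.le).2 (hh.integrable one_le_two)
  have hd : ∀ᵐ x ∂volIoo a b, HasDerivAt (rightRLInt b (1 - τ) w) (-h x) x := by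
    rw [ae_restrict_iff' measurableSet_Ioo]
    filter_upwards [hint.ae_hasDerivAt_integral] with x hx hxab
    rw [uIcc_of_le hab.le] at hx
    refine (hx (Ioo_subset_Icc_self hxab) b
      (right_mem_Icc.2 hab.le)).neg.congr_of_eventuallyEq ?_
    filter_upwards [isOpen_Ioo.mem_nhds hxab] with y hy
    rw [H y hy, kerApply_kerT_rlKer_one hy, Pi.neg_apply, intervalIntegral.integral_symm]
  have hae : rightRLDeriv b τ w =ᵐ[volIoo a b] h :=
    hd.mono fun x hx => by rw [rightRLDeriv, hx.deriv, neg_neg]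
  exact ⟨⟨hd.mono fun x hx => hx.differentiableAt, hh.ae_eq hae.symm⟩, hae⟩

/-- The orders `1 - s` and `s` add up to one, so the integral to be differentiated is a primitive of
`g`. -/
lemma leftRLDeriv_of_rep {a b s : ℝ} (hab : a < b) (hs : 0 < s) (hs1 : s < 1) {w g : ℝ → ℝ}
    (hg : MemLp g 2 (volIoo a b)) (hw : w =ᵐ[volIoo a b] kerApply (volIoo a b) (rlKer s) g) :
    LeftRLDerivInL2 a b s w ∧ leftRLDeriv a s w =ᵐ[volIoo a b] g := by
  refine leftRLDeriv_of_primitive hab hg fun x hx => ?_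
  rw [leftRLInt_eq_kerApply hx, kerApply_congr hw,
    kerApply_rlKer_rlKer (by linarith) hs (by linarith) hx (hg.integrable one_le_two),
    sub_add_cancel]

lemma rightRLDeriv_of_rep {a b s : ℝ} (hab : a < b) (hs : 0 < s) (hs1 : s < 1) {w g : ℝ → ℝ}
    (hg : MemLp g 2 (volIoo a b))
    (hw : w =ᵐ[volIoo a b] kerApply (volIoo a b) (kerT (rlKer s)) g) :
    RightRLDerivInL2 a b s w ∧ rightRLDeriv b s w =ᵐ[volIoo a b] g := by
  refine rightRLDeriv_of_primitive hab hg fun x hx => ?_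
  rw [rightRLInt_eq_kerApply hx, kerApply_congr hw,
    kerApply_kerT_rlKer_kerT_rlKer (by linarith) hs (by linarith) hx (hg.integrable one_le_two),
    sub_add_cancel]

/-- Both sides of the primitive identity are integrals of `g` of order `1 - τ + s = 1 + (s - τ)`. -/
lemma leftRLDeriv_of_rep_lt {a b s τ : ℝ} (hab : a < b) (hs : 0 < s) (hτs : τ < s) (hτ1 : τ < 1)
    {w g : ℝ → ℝ} (hg : MemLp g 2 (volIoo a b))
    (hw : w =ᵐ[volIoo a b] kerApply (volIoo a b) (rlKer s) g) :
    LeftRLDerivInL2 a b τ w ∧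
      leftRLDeriv a τ w =ᵐ[volIoo a b] kerApply (volIoo a b) (rlKer (s - τ)) g := by
  have hst : 0 < s - τ := by linarith
  refine leftRLDeriv_of_primitive hab ((isSchur_rlKer a b hst).memLp_kerApply hg) fun x hx => ?_
  rw [leftRLInt_eq_kerApply hx, kerApply_congr hw,
    kerApply_rlKer_rlKer (by linarith) hs (by linarith) hx (hg.integrable one_le_two),
    kerApply_rlKer_rlKer one_pos hst (by linarith) hx (hg.integrable one_le_two)]
  congr 2
  ring

lemma rightRLDeriv_of_rep_lt {a b s τ : ℝ} (hab : a < b) (hs : 0 < s) (hτs : τ < s) (hτ1 : τ < 1)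
    {w g : ℝ → ℝ} (hg : MemLp g 2 (volIoo a b))
    (hw : w =ᵐ[volIoo a b] kerApply (volIoo a b) (kerT (rlKer s)) g) :
    RightRLDerivInL2 a b τ w ∧
      rightRLDeriv b τ w =ᵐ[volIoo a b] kerApply (volIoo a b) (kerT (rlKer (s - τ))) g := by
  have hst : 0 < s - τ := by linarith
  refine rightRLDeriv_of_primitive hab ((isSchur_rlKer a b hst).swap.memLp_kerApply hg)
    fun x hx => ?_
  rw [rightRLInt_eq_kerApply hx, kerApply_congr hw,
    kerApply_kerT_rlKer_kerT_rlKer (by linarith) hs (by linarith) hx (hg.integrable one_le_two),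
    kerApply_kerT_rlKer_kerT_rlKer one_pos hst (by linarith) hx (hg.integrable one_le_two)]
  congr 3
  ring

/-! ### Fourier transform of the Riemann-Liouville kernel -/

/-- The density `y^{σ-1} e^{-εy} / Γ(σ)` on `(0, ∞)`. -/
def expKer (σ ε y : ℝ) : ℝ := if 0 < y then y ^ (σ - 1) * Real.exp (-(ε * y)) / Real.Gamma σ else 0

lemma expKer_nonneg {σ : ℝ} (hσ : 0 < σ) (ε y : ℝ) : 0 ≤ expKer σ ε y := by
  rw [expKer]
  split_ifs
  · have := Real.Gamma_pos_of_pos hσ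
    positivity
  · exact le_rfl

lemma measurable_expKer (σ ε : ℝ) : Measurable (expKer σ ε) :=
  Measurable.ite measurableSet_Ioi (by fun_prop) measurable_const

lemma integral_expKer {σ ε : ℝ} (hσ : 0 < σ) (hε : 0 < ε) : ∫ y, expKer σ ε y = ε ^ (-σ) := by
  have h : expKer σ ε = (Ioi 0).indicator fun y =>
      y ^ (σ - 1) * Real.exp (-(ε * y)) / Real.Gamma σ := by
    ext y; simp [expKer, indicator_apply]
  rw [h, integral_indicator measurableSet_Ioi, integral_div,
    Real.integral_rpow_mul_exp_neg_mul_Ioi hσ hε, mul_div_cancel_right₀ _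
    (Real.Gamma_pos_of_pos hσ).ne', Real.rpow_neg hε.le, one_div, Real.inv_rpow hε.le]

lemma integrable_expKer {σ ε : ℝ} (hσ : 0 < σ) (hε : 0 < ε) : Integrable (expKer σ ε) :=
  Integrable.of_integral_ne_zero (by
    rw [integral_expKer hσ hε]; exact (Real.rpow_pos_of_pos hε _).ne')

lemma expKer_mul_exp (σ ε z y : ℝ) : Real.exp (z * -y) * expKer σ ε y = expKer σ (ε + z) y := by
  rw [expKer, expKer]
  split_ifs
  · rw [show -((ε + z) * y) = z * -y + -(ε * y) by ring, Real.exp_add]; ring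
  · simp

/-- Analytic continuation of the Gamma integral. Both sides are analytic in the right half-plane,
the left one as a complex moment generating function, and they agree on the positive real axis. -/
lemma integral_cexp_mul_expKer {σ : ℝ} (hσ : 0 < σ) {z : ℂ} (hz : 0 < z.re) :
    ∫ y : ℝ, Complex.exp (z * ((-y : ℝ) : ℂ)) * (expKer σ 0 y : ℂ) = z ^ (-σ : ℂ) := by
  set m : Measure ℝ := volume.withDensity fun y => ENNReal.ofReal (expKer σ 0 y) with hm
  have hmeas : Measurable fun y => ENNReal.ofReal (expKer σ 0 y) :=
    (measurable_expKer σ 0).ennreal_ofReal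
  have hlt : ∀ᵐ y ∂(volume : Measure ℝ), ENNReal.ofReal (expKer σ 0 y) < ⊤ :=
    ae_of_all _ fun y => ENNReal.ofReal_lt_top
  have hmgf : ∀ z : ℂ, ProbabilityTheory.complexMGF (fun y : ℝ => -y) m z =
      ∫ y : ℝ, Complex.exp (z * ((-y : ℝ) : ℂ)) * (expKer σ 0 y : ℂ) := fun z => by
    rw [ProbabilityTheory.complexMGF, hm, integral_withDensity_eq_integral_toReal_smul hmeas hlt]
    refine integral_congr_ae (ae_of_all _ fun y => ?_)
    simp only [ENNReal.toReal_ofReal (expKer_nonneg hσ 0 y), Complex.real_smul]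
    ring
  have hset : Ioi 0 ⊆ interior (ProbabilityTheory.integrableExpSet (fun y : ℝ => -y) m) := by
    refine interior_maximal (fun t ht => ?_) isOpen_Ioi
    rw [ProbabilityTheory.integrableExpSet, mem_ofPred, hm,
      integrable_withDensity_iff hmeas hlt]
    refine (integrable_expKer hσ ht).congr (ae_of_all _ fun y => ?_)
    simp only [ENNReal.toReal_ofReal (expKer_nonneg hσ 0 y), expKer_mul_exp, zero_add]
  rw [← hmgf]
  have h1 : AnalyticOnNhd ℂ (ProbabilityTheory.complexMGF (fun y : ℝ => -y) m) {z | 0 < z.re} :=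
    ProbabilityTheory.analyticOnNhd_complexMGF.mono fun z hz => hset hz
  have h2 : AnalyticOnNhd ℂ (fun z : ℂ => z ^ (-σ : ℂ)) {z | 0 < z.re} := fun z hz =>
    analyticAt_id.cpow analyticAt_const (Or.inl hz)
  have hreal : ∀ r : ℝ, 0 < r →
      ProbabilityTheory.complexMGF (fun y : ℝ => -y) m (r : ℂ) = (r : ℂ) ^ (-σ : ℂ) := fun r hr => by
    have e : ((r ^ (-σ) : ℝ) : ℂ) = (r : ℂ) ^ (-σ : ℂ) := by
      rw [Complex.ofReal_cpow hr.le]; push_cast; rfl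
    rw [hmgf, ← e, ← integral_expKer hσ hr, ← integral_complex_ofReal]
    refine integral_congr_ae (ae_of_all _ fun y => ?_)
    have := expKer_mul_exp σ 0 r y
    rw [zero_add] at this
    simp only [← this]
    push_cast
    rfl
  -- The positive reals accumulate at `1`, so the identity theorem applies on the connected
  -- half-plane.
  refine h1.eqOn_of_preconnected_of_frequently_eq h2
    ((convex_Ioi (0 : ℝ)).linear_preimage Complex.reLm).isPreconnected
    (z₀ := ((1 : ℝ) : ℂ)) (by simp) ?_ hz
  have hfr : ∃ᶠ r : ℝ in 𝓝[≠] 1, 0 < r :=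
    (eventually_nhdsWithin_of_eventually_nhds (lt_mem_nhds one_pos)).frequently
  have htend : Tendsto (fun r : ℝ => (r : ℂ)) (𝓝[≠] 1) (𝓝[≠] ((1 : ℝ) : ℂ)) :=
    tendsto_nhdsWithin_of_tendsto_nhds_of_eventually_within _
      (Complex.continuous_ofReal.continuousAt.tendsto.mono_left nhdsWithin_le_nhds)
      (eventually_nhdsWithin_of_forall fun r hr => by
        simpa using hr)
  exact htend.frequently (hfr.mono fun r hr => hreal r hr)

lemma fourier_expKer {σ ε : ℝ} (hσ : 0 < σ) (hε : 0 < ε) (ξ : ℝ) :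
    𝓕 (fun y => (expKer σ ε y : ℂ)) ξ =
      ((ε : ℂ) + 2 * Real.pi * ξ * Complex.I) ^ (-σ : ℂ) := by
  rw [Real.fourier_real_eq_integral_exp_smul, ← integral_cexp_mul_expKer hσ (by simpa)]
  refine integral_congr_ae (ae_of_all _ fun y => ?_)
  have := expKer_mul_exp σ 0 ε y
  rw [zero_add] at this
  simp only [← this, smul_eq_mul]
  push_cast
  rw [← mul_assoc, ← Complex.exp_add]
  congr 2
  ring

lemma fourier_comp_neg (f : ℝ → ℂ) (ξ : ℝ) : 𝓕 (fun y => f (-y)) ξ = 𝓕 f (-ξ) := by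
  rw [Real.fourier_real_eq_integral_exp_smul, Real.fourier_real_eq_integral_exp_smul,
    ← integral_neg_eq_self]
  refine integral_congr_ae (ae_of_all _ fun y => ?_)
  simp only [neg_neg]
  congr 3
  push_cast
  ring

lemma fourier_ofReal_neg (f : ℝ → ℝ) (ξ : ℝ) :
    𝓕 (fun y => (f y : ℂ)) (-ξ) = (starRingEnd ℂ) (𝓕 (fun y => (f y : ℂ)) ξ) := by
  rw [Real.fourier_real_eq_integral_exp_smul, Real.fourier_real_eq_integral_exp_smul,
    ← integral_conj]
  refine integral_congr_ae (ae_of_all _ fun y => ?_)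
  simp only [smul_eq_mul, map_mul, Complex.conj_ofReal, ← Complex.exp_conj, Complex.conj_I]
  congr 2
  push_cast
  ring

/-- The Fourier transform is symmetric for the bilinear pairing, without conjugation; this is why
the argument `-ξ` appears. -/
lemma integral_fourierInv_mul {G w : ℝ → ℂ} (hG : Integrable G) (hw : Integrable w) :
    ∫ x, 𝓕⁻ G x * w x = ∫ ξ, G ξ * 𝓕 w (-ξ) := by
  have h : ∫ ξ, 𝓕 (fun y => G (-y)) ξ * w ξ = ∫ x, G (-x) * 𝓕 w x := by
    simpa using! VectorFourier.integral_bilin_fourierIntegral_eq_flip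
      (ContinuousLinearMap.mul ℂ ℂ) (L := innerₗ ℝ)
      Real.continuous_fourierChar continuous_inner hG.comp_neg hw
  simp only [fourier_comp_neg] at h
  simp only [Real.fourierInv_eq_fourier_neg]
  rw [h, ← integral_neg_eq_self]
  simp only [neg_neg]

open scoped Convolution in
/-- Parseval's identity for a pair of convolutions with integrable kernels. -/
lemma integral_convolution_mul_convolution {k₁ k₂ : ℝ → ℂ} (hk₁ : Integrable k₁)
    (hk₂ : Integrable k₂) (g : SchwartzMap ℝ ℂ) :
    ∫ x, (∫ y, k₁ y * g (x - y)) * (∫ y, k₂ y * g (x - y)) =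
      ∫ ξ, (𝓕 k₁ ξ * 𝓕 (g : ℝ → ℂ) ξ) * (𝓕 k₂ (-ξ) * 𝓕 (g : ℝ → ℂ) (-ξ)) := by
  have hgF : Integrable (𝓕 (g : ℝ → ℂ)) := by
    rw [← SchwartzMap.fourier_coe]; exact (𝓕 g).integrable
  set w₁ : ℝ → ℂ := k₁ ⋆[ContinuousLinearMap.mul ℂ ℂ] (g : ℝ → ℂ) with hw₁
  set w₂ : ℝ → ℂ := k₂ ⋆[ContinuousLinearMap.mul ℂ ℂ] (g : ℝ → ℂ) with hw₂
  have i₁ : Integrable w₁ := hk₁.integrable_convolution _ g.integrable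
  have i₂ : Integrable w₂ := hk₂.integrable_convolution _ g.integrable
  have F₁ : 𝓕 w₁ = fun ξ => 𝓕 k₁ ξ * 𝓕 (g : ℝ → ℂ) ξ :=
    funext fun ξ => Real.fourier_mul_convolution_eq hk₁ g.integrable ξ
  have F₂ : 𝓕 w₂ = fun ξ => 𝓕 k₂ ξ * 𝓕 (g : ℝ → ℂ) ξ :=
    funext fun ξ => Real.fourier_mul_convolution_eq hk₂ g.integrable ξ
  -- Continuity of `w₁`, with integrability of `w₁` and of its transform, makes Fourier inversion
  -- hold pointwise.
  have hcont : Continuous w₁ := by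
    refine BddAbove.continuous_convolution_right_of_integrable _ ?_ hk₁ g.continuous
    obtain ⟨C, hC⟩ := g.decay 0 0
    exact ⟨C, by rintro _ ⟨x, rfl⟩; simpa using hC.2 x⟩
  have hk₁F : Continuous (𝓕 k₁) := by
    exact VectorFourier.fourierIntegral_continuous Real.continuous_fourierChar continuous_inner hk₁
  have hint : Integrable (𝓕 w₁) := by
    rw [F₁]
    refine hgF.bdd_mul (c := ∫ y, ‖k₁ y‖) hk₁F.aestronglyMeasurable (ae_of_all _ fun ξ => ?_)
    exact VectorFourier.norm_fourierIntegral_le_integral_norm _ _ _ _ _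
  have hinv := hcont.fourierInv_fourier_eq i₁ hint
  calc ∫ x, (∫ y, k₁ y * g (x - y)) * (∫ y, k₂ y * g (x - y))
      = ∫ x, 𝓕⁻ (𝓕 w₁) x * w₂ x := by rw [hinv]; rfl
    _ = _ := by rw [integral_fourierInv_mul hint i₂, F₁, F₂]

/-! ### Parseval's identity for convolutions of real functions -/

section ConvolutionReal

/-- `k * g` for real functions. -/
def realConv (k g : ℝ → ℝ) (x : ℝ) : ℝ := ∫ y, k y * g (x - y)

lemma realConv_eq_convolution (k g : ℝ → ℝ) :
    realConv k g = MeasureTheory.convolution k g (ContinuousLinearMap.mul ℝ ℝ) volume := rfl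

variable {k k₁ k₂ g : ℝ → ℝ}

lemma bounded_of_hasCompactSupport (hg : Continuous g) (hc : HasCompactSupport g) :
    ∃ M : ℝ, 0 ≤ M ∧ ∀ x, |g x| ≤ M := by
  obtain ⟨M, hM⟩ := hg.bounded_above_of_compact_support hc
  exact ⟨M, (norm_nonneg _).trans (hM 0), hM⟩

/-- Both convolutions are integrable, and the first is also bounded because `g` is. -/
lemma integrable_realConv_mul_realConv (hk₁ : Integrable k₁) (hk₂ : Integrable k₂)
    (hg : Continuous g) (hc : HasCompactSupport g) :
    Integrable fun x => realConv k₁ g x * realConv k₂ g x := by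
  obtain ⟨M, hM0, hM⟩ := bounded_of_hasCompactSupport hg hc
  have hgi : Integrable g := hg.integrable_of_hasCompactSupport hc
  have i₁ : Integrable (realConv k₁ g) := by
    rw [realConv_eq_convolution]; exact hk₁.integrable_convolution _ hgi
  have i₂ : Integrable (realConv k₂ g) := by
    rw [realConv_eq_convolution]; exact hk₂.integrable_convolution _ hgi
  refine i₂.bdd_mul (c := ∫ y, ‖k₁ y‖ * M) i₁.aestronglyMeasurable (ae_of_all _ fun x => ?_)
  refine norm_integral_le_of_norm_le (hk₁.norm.mul_const M) (ae_of_all _ fun y => ?_)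
  rw [norm_mul]
  exact mul_le_mul_of_nonneg_left (hM _) (norm_nonneg _)

/-- Parseval's identity for real convolutions. -/
lemma integral_realConv_mul_realConv (hk₁ : Integrable k₁) (hk₂ : Integrable k₂)
    (hg : ContDiff ℝ ∞ g) (hc : HasCompactSupport g) :
    ∫ x, realConv k₁ g x * realConv k₂ g x =
      ∫ ξ, (𝓕 (fun y => (k₁ y : ℂ)) ξ * 𝓕 (fun y => (k₂ y : ℂ)) (-ξ)).re *
        ‖𝓕 (fun y => (g y : ℂ)) ξ‖ ^ 2 := by
  have hcC : HasCompactSupport (fun y => (g y : ℂ)) := hc.comp_left Complex.ofReal_zero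
  have hgC : ContDiff ℝ ∞ (fun y => (g y : ℂ)) := Complex.ofRealCLM.contDiff.comp hg
  set G : SchwartzMap ℝ ℂ := hcC.toSchwartzMap hgC with hG
  have hGco : (G : ℝ → ℂ) = fun y => (g y : ℂ) := rfl
  have hk₁C : Integrable (fun y => (k₁ y : ℂ)) := hk₁.ofReal
  have hk₂C : Integrable (fun y => (k₂ y : ℂ)) := hk₂.ofReal
  have h := integral_convolution_mul_convolution hk₁C hk₂C G
  have hGF : 𝓕 (G : ℝ → ℂ) = (𝓕 G : SchwartzMap ℝ ℂ) := (SchwartzMap.fourier_coe G).symm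
  have hFk : ∀ k : ℝ → ℝ, Integrable k → Continuous (𝓕 fun y => (k y : ℂ)) := fun k hk =>
    VectorFourier.fourierIntegral_continuous Real.continuous_fourierChar continuous_inner hk.ofReal
  have hbd : ∀ (k : ℝ → ℝ) (ξ : ℝ), ‖𝓕 (fun y => (k y : ℂ)) ξ‖ ≤ ∫ y, ‖(k y : ℂ)‖ := fun k ξ =>
    VectorFourier.norm_fourierIntegral_le_integral_norm _ _ _ _ _
  -- For real `g` the transform at `-ξ` is the conjugate of that at `ξ`, so the two factors from `g`
  -- combine to a squared modulus.
  have hpt : ∀ ξ, (𝓕 (fun y => (k₁ y : ℂ)) ξ * 𝓕 (G : ℝ → ℂ) ξ) *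
      (𝓕 (fun y => (k₂ y : ℂ)) (-ξ) * 𝓕 (G : ℝ → ℂ) (-ξ)) =
      (𝓕 (fun y => (k₁ y : ℂ)) ξ * 𝓕 (fun y => (k₂ y : ℂ)) (-ξ)) *
        ((‖𝓕 (fun y => (g y : ℂ)) ξ‖ ^ 2 : ℝ) : ℂ) := fun ξ => by
    rw [hGco, fourier_ofReal_neg g ξ, Complex.ofReal_pow, ← Complex.mul_conj']
    ring
  have hint : Integrable fun ξ => (𝓕 (fun y => (k₁ y : ℂ)) ξ * 𝓕 (fun y => (k₂ y : ℂ)) (-ξ)) *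
        ((‖𝓕 (fun y => (g y : ℂ)) ξ‖ ^ 2 : ℝ) : ℂ) := by
    have hsq : Integrable fun ξ => ((‖𝓕 (fun y => (g y : ℂ)) ξ‖ ^ 2 : ℝ) : ℂ) := by
      rw [← hGco, hGF]
      exact ((𝓕 G).memLp 2 volume).integrable_norm_pow two_ne_zero |>.ofReal
    refine hsq.bdd_mul (c := (∫ y, ‖(k₁ y : ℂ)‖) * ∫ y, ‖(k₂ y : ℂ)‖)
      ((hFk k₁ hk₁).mul ((hFk k₂ hk₂).comp continuous_neg)).aestronglyMeasurable
      (ae_of_all _ fun ξ => ?_)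
    rw [norm_mul]
    exact mul_le_mul (hbd k₁ ξ) (hbd k₂ _) (norm_nonneg _) (integral_nonneg fun y => norm_nonneg _)
  simp only [hpt] at h
  have h2 := congrArg Complex.re h
  have hL : ∀ x, (∫ y, (k₁ y : ℂ) * G (x - y)) * (∫ y, (k₂ y : ℂ) * G (x - y)) =
      ((realConv k₁ g x * realConv k₂ g x : ℝ) : ℂ) := fun x => by
    rw [Complex.ofReal_mul, realConv, realConv, ← integral_complex_ofReal,
      ← integral_complex_ofReal]
    simp only [Complex.ofReal_mul]
    rfl
  simp only [hL] at h2
  rw [integral_complex_ofReal, Complex.ofReal_re] at h2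
  rw [h2, ← Complex.reCLM_apply, ← Complex.reCLM.integral_comp_comm hint]
  refine integral_congr_ae (ae_of_all _ fun ξ => ?_)
  simp only [Complex.reCLM_apply, Complex.re_mul_ofReal]

end ConvolutionReal

lemma expKer_sub (σ ε x t : ℝ) : expKer σ ε (x - t) = rlKer σ x t * Real.exp (-(ε * (x - t))) := by
  rw [expKer, rlKer]
  simp only [sub_pos]
  split_ifs <;> ring

lemma expKer_sub_le {σ ε : ℝ} (hσ : 0 < σ) (hε : 0 ≤ ε) (x t : ℝ) :
    expKer σ ε (x - t) ≤ rlKer σ x t := by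
  rw [expKer, rlKer]
  simp only [sub_pos]
  split_ifs with h
  · have := Real.Gamma_pos_of_pos hσ
    have h1 : Real.exp (-(ε * (x - t))) ≤ 1 :=
      Real.exp_le_one_iff.2 (neg_nonpos.2 (mul_nonneg hε (sub_pos.2 h).le))
    have h2 : 0 ≤ (x - t) ^ (σ - 1) := Real.rpow_nonneg (sub_pos.2 h).le _
    have := mul_le_mul_of_nonneg_left h1 h2
    rw [mul_one] at this
    gcongr
  · exact le_rfl

/-! ### Exponentially damped kernels and their limit -/

section Truncation

variable {a b σ : ℝ} {g : ℝ → ℝ}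

lemma realConv_expKer (hsupp : ∀ t, t ∉ Ioo a b → g t = 0) (ε x : ℝ) :
    realConv (expKer σ ε) g x = ∫ t, expKer σ ε (x - t) * g t ∂volIoo a b := by
  rw [realConv, ← integral_sub_left_eq_self _ volume x,
    setIntegral_eq_integral_of_forall_compl_eq_zero fun t ht => by rw [hsupp t ht, mul_zero]]
  simp only [sub_sub_cancel]

lemma realConv_expKer_neg (hsupp : ∀ t, t ∉ Ioo a b → g t = 0) (ε x : ℝ) :
    realConv (fun y => expKer σ ε (-y)) g x = ∫ t, expKer σ ε (t - x) * g t ∂volIoo a b := by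
  rw [realConv, ← integral_sub_left_eq_self _ volume x,
    setIntegral_eq_integral_of_forall_compl_eq_zero fun t ht => by rw [hsupp t ht, mul_zero]]
  simp only [sub_sub_cancel, neg_sub]

/-- The left convolution looks only at points to the left of `x`. Together with its mirror image
this confines the product of a left and a right convolution to `(a, b)`. -/
lemma realConv_expKer_of_le (hsupp : ∀ t, t ∉ Ioo a b → g t = 0) (ε : ℝ) {x : ℝ} (hx : x ≤ a) :
    realConv (expKer σ ε) g x = 0 := by
  rw [realConv_expKer hsupp]
  refine setIntegral_eq_zero_of_forall_eq_zero fun t ht => ?_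
  rw [expKer, if_neg (by linarith [ht.1]), zero_mul]

lemma realConv_expKer_neg_of_le (hsupp : ∀ t, t ∉ Ioo a b → g t = 0) (ε : ℝ) {x : ℝ} (hx : b ≤ x) :
    realConv (fun y => expKer σ ε (-y)) g x = 0 := by
  rw [realConv_expKer_neg hsupp]
  refine setIntegral_eq_zero_of_forall_eq_zero fun t ht => ?_
  rw [expKer, if_neg (by linarith [ht.2]), zero_mul]

lemma integrable_rlKer_row (hσ : 0 < σ) {x : ℝ} (hx : x ∈ Ioo a b) :
    Integrable (rlKer σ x) (volIoo a b) := by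
  refine ⟨((measurable_rlKer σ).comp
    (measurable_const.prodMk measurable_id)).aestronglyMeasurable, ?_⟩
  rw [hasFiniteIntegral_iff_enorm, lintegral_rlKer_row hσ hx]
  exact ENNReal.ofReal_lt_top

lemma integrable_rlKer_col (hσ : 0 < σ) {t : ℝ} (ht : t ∈ Ioo a b) :
    Integrable (fun x => rlKer σ x t) (volIoo a b) := by
  refine ⟨((measurable_rlKer σ).comp
    (measurable_id.prodMk measurable_const)).aestronglyMeasurable, ?_⟩
  rw [hasFiniteIntegral_iff_enorm, lintegral_rlKer_col hσ ht]
  exact ENNReal.ofReal_lt_top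

lemma integral_rlKer_row_le (hσ : 0 < σ) {x : ℝ} (hx : x ∈ Ioo a b) :
    ∫ t, rlKer σ x t ∂volIoo a b ≤ rlBound a b σ := by
  have h := lintegral_rlKer_row hσ hx
  have hΓ : 0 < Real.Gamma (σ + 1) := Real.Gamma_pos_of_pos (by linarith)
  have h1 := sub_pos.2 hx.1
  have h2 := hx.2
  rw [integral_eq_lintegral_of_nonneg_ae (ae_of_all _ fun t => rlKer_nonneg hσ x t)
    (integrable_rlKer_row hσ hx).1]
  simp only [Real.enorm_of_nonneg (rlKer_nonneg hσ x _)] at h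
  rw [h, ENNReal.toReal_ofReal (by positivity), rlBound]
  refine le_trans ?_ (Real.le_coe_toNNReal _)
  gcongr

lemma integral_rlKer_col_le (hσ : 0 < σ) {t : ℝ} (ht : t ∈ Ioo a b) :
    ∫ x, rlKer σ x t ∂volIoo a b ≤ rlBound a b σ := by
  have h := lintegral_rlKer_col hσ ht
  have hΓ : 0 < Real.Gamma (σ + 1) := Real.Gamma_pos_of_pos (by linarith)
  have h1 := sub_pos.2 ht.2
  have h2 := ht.1
  rw [integral_eq_lintegral_of_nonneg_ae (ae_of_all _ fun x => rlKer_nonneg hσ x t)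
    (integrable_rlKer_col hσ ht).1]
  simp only [Real.enorm_of_nonneg (rlKer_nonneg hσ _ t)] at h
  rw [h, ENNReal.toReal_ofReal (by positivity), rlBound]
  refine le_trans ?_ (Real.le_coe_toNNReal _)
  gcongr

/-- The parameters of the exponential cut-off. -/
def cutoff (n : ℕ) : ℝ := 1 / ((n : ℝ) + 1)

lemma cutoff_pos (n : ℕ) : 0 < cutoff n := by unfold cutoff; positivity

lemma tendsto_cutoff : Tendsto cutoff atTop (𝓝 0) := tendsto_one_div_add_atTop_nhds_zero_nat

lemma tendsto_expKer_cutoff (x t : ℝ) :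
    Tendsto (fun n => expKer σ (cutoff n) (x - t)) atTop (𝓝 (rlKer σ x t)) := by
  simp only [expKer_sub]
  have h : Tendsto (fun n => rlKer σ x t * Real.exp (-(cutoff n * (x - t)))) atTop
      (𝓝 (rlKer σ x t * Real.exp (-(0 * (x - t))))) :=
    ((Real.continuous_exp.tendsto _).comp (tendsto_cutoff.mul_const _).neg).const_mul _
  simpa using h

/-- Dominated convergence: the undamped kernel, integrable on the bounded interval, majorises all
damped ones. -/
lemma tendsto_realConv_expKer (hσ : 0 < σ) (hg : Measurable g) (hsupp : ∀ t, t ∉ Ioo a b → g t = 0)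
    {M : ℝ} (hM : ∀ t, |g t| ≤ M) {x : ℝ} (hx : x ∈ Ioo a b) :
    Tendsto (fun n => realConv (expKer σ (cutoff n)) g x) atTop
      (𝓝 (kerApply (volIoo a b) (rlKer σ) g x)) := by
  simp only [realConv_expKer hsupp]
  refine tendsto_integral_of_dominated_convergence (fun t => rlKer σ x t * M) (fun n => ?_)
    ((integrable_rlKer_row hσ hx).mul_const M) (fun n => ae_of_all _ fun t => ?_)
    (ae_of_all _ fun t => (tendsto_expKer_cutoff x t).mul_const _)
  · exact (((measurable_expKer σ _).comp (measurable_const.sub measurable_id)).mul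
      hg).aestronglyMeasurable
  · rw [norm_mul, Real.norm_of_nonneg (expKer_nonneg hσ _ _)]
    exact mul_le_mul (expKer_sub_le hσ (cutoff_pos n).le x t) (hM t) (norm_nonneg _)
      (rlKer_nonneg hσ x t)

lemma tendsto_realConv_expKer_neg (hσ : 0 < σ) (hg : Measurable g)
    (hsupp : ∀ t, t ∉ Ioo a b → g t = 0)
    {M : ℝ} (hM : ∀ t, |g t| ≤ M) {x : ℝ} (hx : x ∈ Ioo a b) :
    Tendsto (fun n => realConv (fun y => expKer σ (cutoff n) (-y)) g x) atTop
      (𝓝 (kerApply (volIoo a b) (kerT (rlKer σ)) g x)) := by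
  simp only [realConv_expKer_neg hsupp]
  refine tendsto_integral_of_dominated_convergence (fun t => rlKer σ t x * M) (fun n => ?_)
    ((integrable_rlKer_col hσ hx).mul_const M) (fun n => ae_of_all _ fun t => ?_)
    (ae_of_all _ fun t => (tendsto_expKer_cutoff t x).mul_const _)
  · exact (((measurable_expKer σ _).comp (measurable_id.sub measurable_const)).mul
      hg).aestronglyMeasurable
  · rw [norm_mul, Real.norm_of_nonneg (expKer_nonneg hσ _ _)]
    exact mul_le_mul (expKer_sub_le hσ (cutoff_pos n).le t x) (hM t) (norm_nonneg _)
      (rlKer_nonneg hσ t x)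

lemma abs_realConv_expKer_le (hσ : 0 < σ) (hsupp : ∀ t, t ∉ Ioo a b → g t = 0)
    {M : ℝ} (hM : ∀ t, |g t| ≤ M) {x : ℝ} (hx : x ∈ Ioo a b) (n : ℕ) :
    |realConv (expKer σ (cutoff n)) g x| ≤ rlBound a b σ * M := by
  have hM0 : 0 ≤ M := (abs_nonneg _).trans (hM 0)
  rw [realConv_expKer hsupp, ← Real.norm_eq_abs]
  refine (norm_integral_le_of_norm_le ((integrable_rlKer_row hσ hx).mul_const M)
    (ae_of_all _ fun t => ?_)).trans ?_
  · rw [norm_mul, Real.norm_of_nonneg (expKer_nonneg hσ _ _)]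
    exact mul_le_mul (expKer_sub_le hσ (cutoff_pos n).le x t) (hM t) (norm_nonneg _)
      (rlKer_nonneg hσ x t)
  · rw [integral_mul_const]
    exact mul_le_mul_of_nonneg_right (integral_rlKer_row_le hσ hx) hM0

lemma abs_realConv_expKer_neg_le (hσ : 0 < σ) (hsupp : ∀ t, t ∉ Ioo a b → g t = 0)
    {M : ℝ} (hM : ∀ t, |g t| ≤ M) {x : ℝ} (hx : x ∈ Ioo a b) (n : ℕ) :
    |realConv (fun y => expKer σ (cutoff n) (-y)) g x| ≤ rlBound a b σ * M := by
  have hM0 : 0 ≤ M := (abs_nonneg _).trans (hM 0)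
  rw [realConv_expKer_neg hsupp, ← Real.norm_eq_abs]
  refine (norm_integral_le_of_norm_le ((integrable_rlKer_col hσ hx).mul_const M)
    (ae_of_all _ fun t => ?_)).trans ?_
  · rw [norm_mul, Real.norm_of_nonneg (expKer_nonneg hσ _ _)]
    exact mul_le_mul (expKer_sub_le hσ (cutoff_pos n).le t x) (hM t) (norm_nonneg _)
      (rlKer_nonneg hσ t x)
  · rw [integral_mul_const]
    exact mul_le_mul_of_nonneg_right (integral_rlKer_col_le hσ hx) hM0

end Truncation

/-! ### Test functions: energy identities -/

/-- The squared semi-norm of order `s` of a smooth function with compact support. -/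
def hsEnergy (s : ℝ) (ψ : ℝ → ℝ) : ℝ := ∫ ξ, (|2 * Real.pi * ξ| ^ s * ‖𝓕 (fun y => (ψ y : ℂ)) ξ‖) ^ 2

section Test

variable {a b σ s : ℝ} {ψ : ℝ → ℝ}

/-- A smooth function with compact support as a complex Schwartz function. -/
def testSchwartz (hψ : ContDiff ℝ ∞ ψ) (hc : HasCompactSupport ψ) : SchwartzMap ℝ ℂ :=
  HasCompactSupport.toSchwartzMap (f := fun y => (ψ y : ℂ)) (hc.comp_left Complex.ofReal_zero)
    (Complex.ofRealCLM.contDiff.comp hψ)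

lemma testSchwartz_coe (hψ : ContDiff ℝ ∞ ψ) (hc : HasCompactSupport ψ) :
    (testSchwartz hψ hc : ℝ → ℂ) = fun y => (ψ y : ℂ) := rfl

lemma fourier_testSchwartz (hψ : ContDiff ℝ ∞ ψ) (hc : HasCompactSupport ψ) :
    (𝓕 (testSchwartz hψ hc) : SchwartzMap ℝ ℂ) = 𝓕 (fun y => (ψ y : ℂ)) :=
  SchwartzMap.fourier_coe _

lemma integrable_norm_fourier_sq (hψ : ContDiff ℝ ∞ ψ) (hc : HasCompactSupport ψ) :
    Integrable fun ξ => ‖𝓕 (fun y => (ψ y : ℂ)) ξ‖ ^ 2 := by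
  rw [← fourier_testSchwartz hψ hc]
  exact ((𝓕 (testSchwartz hψ hc)).memLp 2 volume).integrable_norm_pow two_ne_zero

lemma contDiff_deriv_of_contDiff (hψ : ContDiff ℝ ∞ ψ) : ContDiff ℝ ∞ (deriv ψ) :=
  (contDiff_infty_iff_deriv.1 hψ).2

lemma norm_fourier_deriv (hψ : ContDiff ℝ ∞ ψ) (hc : HasCompactSupport ψ) (ξ : ℝ) :
    ‖𝓕 (fun y => ((deriv ψ y : ℝ) : ℂ)) ξ‖ = |2 * Real.pi * ξ| * ‖𝓕 (fun y => (ψ y : ℂ)) ξ‖ := by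
  have hd : ∀ y, HasDerivAt (fun y => (ψ y : ℂ)) ((deriv ψ y : ℝ) : ℂ) y := fun y =>
    ((hψ.differentiable (by simp)).differentiableAt.hasDerivAt (x := y)).ofReal_comp
  have hd' : deriv (fun y => (ψ y : ℂ)) = fun y => ((deriv ψ y : ℝ) : ℂ) := funext fun y => (hd y).deriv
  have h1 : Integrable fun y => (ψ y : ℂ) := (testSchwartz hψ hc).integrable
  have h2 : Integrable fun y => ((deriv ψ y : ℝ) : ℂ) :=
    (testSchwartz (contDiff_deriv_of_contDiff hψ) hc.deriv).integrable
  have h := Real.fourier_deriv h1 (fun y => (hd y).differentiableAt) (by rw [hd']; exact h2)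
  rw [← hd', h]
  simp only [smul_eq_mul, norm_mul]
  congr 1
  simp [abs_mul]

lemma measurable_abs_rpow (s : ℝ) : Measurable fun ξ : ℝ => |2 * Real.pi * ξ| ^ s := by fun_prop

lemma continuous_fourier_test (hψ : ContDiff ℝ ∞ ψ) (hc : HasCompactSupport ψ) :
    Continuous (𝓕 (fun y => (ψ y : ℂ))) := by
  rw [← fourier_testSchwartz hψ hc]
  exact (𝓕 (testSchwartz hψ hc)).continuous

lemma aestronglyMeasurable_energy (s : ℝ) (hψ : ContDiff ℝ ∞ ψ) (hc : HasCompactSupport ψ) :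
    AEStronglyMeasurable
      (fun ξ => (|2 * Real.pi * ξ| ^ s * ‖𝓕 (fun y => (ψ y : ℂ)) ξ‖) ^ 2) volume :=
  (((measurable_abs_rpow s).aestronglyMeasurable).mul
    (continuous_fourier_test hψ hc).norm.aestronglyMeasurable).pow 2

/-- For `0 ≤ s ≤ 1` one has `y^{2s} ≤ 1 + y²`, so the energy is controlled by the `L²` norms of the
transforms of `ψ` and `ψ'`. -/
lemma integrable_hsEnergy (hs0 : 0 ≤ s) (hs1 : s ≤ 1) (hψ : ContDiff ℝ ∞ ψ)
    (hc : HasCompactSupport ψ) :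
    Integrable fun ξ => (|2 * Real.pi * ξ| ^ s * ‖𝓕 (fun y => (ψ y : ℂ)) ξ‖) ^ 2 := by
  refine Integrable.mono' ((integrable_norm_fourier_sq hψ hc).add
    (integrable_norm_fourier_sq (contDiff_deriv_of_contDiff hψ) hc.deriv))
    (aestronglyMeasurable_energy s hψ hc) (ae_of_all _ fun ξ => ?_)
  rw [Real.norm_of_nonneg (sq_nonneg _), Pi.add_apply, norm_fourier_deriv hψ hc, mul_pow, mul_pow,
    ← one_add_mul]
  gcongr
  set y := |2 * Real.pi * ξ|
  have hy : 0 ≤ y := abs_nonneg _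
  rcases le_total y 1 with h | h
  · nlinarith [Real.rpow_le_one hy h hs0, Real.rpow_nonneg hy s, sq_nonneg y]
  · have h1 := Real.rpow_le_rpow_of_exponent_le h hs1
    rw [Real.rpow_one] at h1
    nlinarith [Real.rpow_nonneg hy s]

lemma hsEnergy_nonneg (s : ℝ) (ψ : ℝ → ℝ) : 0 ≤ hsEnergy s ψ :=
  integral_nonneg fun _ => sq_nonneg _

/-- Schwartz functions are the bridge between the transform defined on `L²` and the one given by an
integral. -/
lemma fourierL2_zeroExt_test {φ : L2Ioo a b} (hψ : ContDiff ℝ ∞ ψ) (hc : HasCompactSupport ψ)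
    (hsupp : ∀ t, t ∉ Ioo a b → ψ t = 0) (hφ : φ =ᵐ[volIoo a b] ψ) :
    fourierL2 (zeroExt φ) =ᵐ[volume] 𝓕 (fun y => (ψ y : ℂ)) := by
  have h : Complex.ofRealCLM.compLpL 2 volume (zeroExt φ) = (testSchwartz hψ hc).toLp 2 := by
    apply Lp.ext
    have h1 := (ae_restrict_iff' measurableSet_Ioo).1 hφ
    filter_upwards [Complex.ofRealCLM.coeFn_compLpL (zeroExt φ), zeroExt_coe φ, h1,
      (testSchwartz hψ hc).coeFn_toLp 2 volume] with x e1 e2 e3 e4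
    rw [e1, e2, e4, testSchwartz_coe, Complex.ofRealCLM_apply]
    by_cases hx : x ∈ Ioo a b
    · rw [indicator_of_mem hx, e3 hx]
    · rw [indicator_of_notMem hx]
      simp only [hsupp x hx]
  rw [fourierL2, h, SchwartzMap.toLp_fourier_eq, ← fourier_testSchwartz hψ hc]
  exact SchwartzMap.coeFn_toLp _ 2 volume

lemma hsSeminorm_test_sq (hs0 : 0 ≤ s) (hs1 : s ≤ 1) {φ : L2Ioo a b} (hψ : ContDiff ℝ ∞ ψ)
    (hc : HasCompactSupport ψ) (hsupp : ∀ t, t ∉ Ioo a b → ψ t = 0) (hφ : φ =ᵐ[volIoo a b] ψ) :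
    hsSeminorm s (zeroExt φ) ^ 2 = ENNReal.ofReal (hsEnergy s ψ) := by
  rw [hsSeminorm, eLpNorm_two_sq, hsEnergy,
    ofReal_integral_eq_lintegral_ofReal (integrable_hsEnergy hs0 hs1 hψ hc)
      (ae_of_all _ fun _ => sq_nonneg _)]
  refine lintegral_congr_ae ?_
  filter_upwards [fourierL2_zeroExt_test hψ hc hsupp hφ] with ξ h
  rw [h, enorm_smul, Real.enorm_of_nonneg (Real.rpow_nonneg (abs_nonneg _) _),
    ← ofReal_norm, ← ENNReal.ofReal_mul (Real.rpow_nonneg (abs_nonneg _) _),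
    ← ENNReal.ofReal_pow (by positivity)]

/-- The modulus of `ε + iη` is at least `|η|` and the exponent is negative. The bound does not
depend on `ε`, so it serves as a majorant in the limit. -/
lemma norm_cutoff_cpow_le {σ ε ξ : ℝ} (hσ : 0 < σ) (hξ : ξ ≠ 0) :
    ‖((ε : ℂ) + 2 * Real.pi * ξ * Complex.I) ^ (-σ : ℂ)‖ ≤ |2 * Real.pi * ξ| ^ (-σ) := by
  rw [← Complex.ofReal_neg, Complex.norm_cpow_real]
  have hpos : 0 < |2 * Real.pi * ξ| := by positivity
  refine Real.rpow_le_rpow_of_nonpos hpos ?_ (by linarith)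
  have h := Complex.abs_im_le_norm ((ε : ℂ) + 2 * Real.pi * ξ * Complex.I)
  simpa using h

/-- A purely imaginary number has argument `±π/2`, so the square of its power `-σ` has argument
`∓πσ`; the cosine ignores the sign. -/
lemma re_cpow_sq {σ ξ : ℝ} (hξ : ξ ≠ 0) :
    (((2 * Real.pi * ξ * Complex.I : ℂ) ^ (-σ : ℂ)) ^ 2).re =
      Real.cos (Real.pi * σ) * (|2 * Real.pi * ξ| ^ (-σ)) ^ 2 := by
  set z : ℂ := 2 * Real.pi * ξ * Complex.I with hz
  have hz' : z = ((2 * Real.pi * ξ : ℝ) : ℂ) * Complex.I := by rw [hz]; push_cast; ring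
  have hnorm : ‖z‖ = |2 * Real.pi * ξ| := by rw [hz']; simp
  have hz0 : z ≠ 0 := by
    rw [← norm_pos_iff, hnorm]; positivity
  have hpos : 0 < ‖z‖ := norm_pos_iff.2 hz0
  have hlog : z ^ (-σ : ℂ) =
      ((‖z‖ ^ (-σ) : ℝ) : ℂ) * Complex.exp (((-σ * z.arg : ℝ) : ℂ) * Complex.I) := by
    rw [Complex.cpow_def_of_ne_zero hz0, Real.rpow_def_of_pos hpos, Complex.ofReal_exp,
      ← Complex.exp_add]
    congr 1
    rw [Complex.log]
    push_cast
    ring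
  have harg : Real.cos (2 * (-σ * z.arg)) = Real.cos (Real.pi * σ) := by
    rcases lt_or_gt_of_ne hξ with h | h
    · have : z.arg = -(Real.pi / 2) := by
        rw [Complex.arg_eq_neg_pi_div_two_iff, hz']
        simp only [Complex.re_ofReal_mul, Complex.I_re, mul_zero, Complex.im_ofReal_mul,
          Complex.I_im, mul_one, true_and]
        exact mul_neg_of_pos_of_neg (by positivity) h
      rw [this]; congr 1; ring
    · have : z.arg = Real.pi / 2 := by
        rw [Complex.arg_eq_pi_div_two_iff, hz']
        simp only [Complex.re_ofReal_mul, Complex.I_re, mul_zero, Complex.im_ofReal_mul,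
          Complex.I_im, mul_one, true_and]
        positivity
      rw [this, ← Real.cos_neg]; congr 1; ring
  rw [hlog, mul_pow, ← Complex.exp_nat_mul, ← Complex.ofReal_pow, Complex.re_ofReal_mul]
  rw [show ((2 : ℕ) : ℂ) * (((-σ * z.arg : ℝ) : ℂ) * Complex.I) =
    ((2 * (-σ * z.arg) : ℝ) : ℂ) * Complex.I by push_cast; ring, Complex.exp_ofReal_mul_I_re,
    harg, hnorm, mul_comm]

lemma energy_deriv_eq (hψ : ContDiff ℝ ∞ ψ) (hc : HasCompactSupport ψ) {ξ : ℝ}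
    (hξ : ξ ≠ 0) :
    (|2 * Real.pi * ξ| ^ (-σ)) ^ 2 * ‖𝓕 (fun y => ((deriv ψ y : ℝ) : ℂ)) ξ‖ ^ 2 =
      (|2 * Real.pi * ξ| ^ (1 - σ) * ‖𝓕 (fun y => (ψ y : ℂ)) ξ‖) ^ 2 := by
  have hpos : 0 < |2 * Real.pi * ξ| := by positivity
  rw [norm_fourier_deriv hψ hc, ← mul_pow, ← mul_assoc, sub_eq_neg_add, Real.rpow_add hpos,
    Real.rpow_one]

lemma ae_ne_zero_real : ∀ᵐ ξ : ℝ, ξ ≠ 0 := by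
  simp [ae_iff]

lemma deriv_eq_zero_of_tsupport (hs : tsupport ψ ⊆ Ioo a b) : ∀ t, t ∉ Ioo a b → deriv ψ t = 0 :=
  fun t ht => by
    have h : t ∉ tsupport ψ := fun h => ht (hs h)
    exact image_eq_zero_of_notMem_tsupport fun h' => h (tsupport_deriv_subset h')

lemma eq_zero_of_tsupport (hs : tsupport ψ ⊆ Ioo a b) : ∀ t, t ∉ Ioo a b → ψ t = 0 :=
  fun _ ht => image_eq_zero_of_notMem_tsupport fun h => ht (hs h)

/-- The disjunction in `hkF` covers the damped kernel and its reflection at once, the latter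
replacing `ξ` by `-ξ`. -/
lemma integral_sq_realConv_le {k : ℝ → ℝ} {ε : ℝ} (hσ : 0 < σ) (hσ1 : σ < 1)
    (hk : Integrable k)
    (hkF : ∀ ξ, 𝓕 (fun y => (k y : ℂ)) ξ * 𝓕 (fun y => (k y : ℂ)) (-ξ) =
      ((‖((ε : ℂ) + 2 * Real.pi * ξ * Complex.I) ^ (-σ : ℂ)‖ ^ 2 : ℝ) : ℂ) ∨
      𝓕 (fun y => (k y : ℂ)) ξ * 𝓕 (fun y => (k y : ℂ)) (-ξ) =
      ((‖((ε : ℂ) + 2 * Real.pi * (-ξ : ℝ) * Complex.I) ^ (-σ : ℂ)‖ ^ 2 : ℝ) : ℂ))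
    (hψ : ContDiff ℝ ∞ ψ) (hc : HasCompactSupport ψ) :
    ∫ x, realConv k (deriv ψ) x * realConv k (deriv ψ) x ≤ hsEnergy (1 - σ) ψ := by
  rw [integral_realConv_mul_realConv hk hk (contDiff_deriv_of_contDiff hψ) hc.deriv]
  refine integral_mono_of_nonneg (ae_of_all _ fun ξ => ?_)
    (integrable_hsEnergy (by linarith) (by linarith) hψ hc) ?_
  · refine mul_nonneg ?_ (sq_nonneg _)
    rcases hkF ξ with h | h <;> rw [h, Complex.ofReal_re] <;> positivity
  · filter_upwards [ae_ne_zero_real] with ξ hξ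
    rw [← energy_deriv_eq hψ hc hξ]
    refine mul_le_mul_of_nonneg_right ?_ (sq_nonneg _)
    rcases hkF ξ with h | h <;> rw [h, Complex.ofReal_re]
    · exact pow_le_pow_left₀ (norm_nonneg _) (norm_cutoff_cpow_le hσ hξ) 2
    · have := norm_cutoff_cpow_le (ε := ε) hσ (neg_ne_zero.2 hξ)
      rw [mul_neg, abs_neg] at this
      exact pow_le_pow_left₀ (norm_nonneg _) this 2

/-- Restricting a square to `(a, b)` only lowers its integral; uniform bounds on the interval then
permit passage to the limit. -/
lemma integral_sq_kerApply_le_of_tendsto {w : ℕ → ℝ → ℝ} {W : ℝ → ℝ} {C E : ℝ}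
    (hw : ∀ n, Integrable fun x => w n x * w n x)
    (hwm : ∀ n, AEStronglyMeasurable (w n) (volIoo a b))
    (hlim : ∀ x ∈ Ioo a b, Tendsto (fun n => w n x) atTop (𝓝 (W x)))
    (hbd : ∀ n, ∀ x ∈ Ioo a b, |w n x| ≤ C) (hE : ∀ n, ∫ x, w n x * w n x ≤ E) :
    ∫ x, W x * W x ∂volIoo a b ≤ E := by
  have h : Tendsto (fun n => ∫ x, w n x * w n x ∂volIoo a b) atTop
      (𝓝 (∫ x, W x * W x ∂volIoo a b)) := by
    refine tendsto_integral_of_dominated_convergence (fun _ => C * C)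
      (fun n => (hwm n).mul (hwm n)) (integrable_const _) (fun n => ?_) ?_
    · filter_upwards [ae_mem_volIoo a b] with x hx
      rw [norm_mul, Real.norm_eq_abs]
      exact mul_le_mul (hbd n x hx) (hbd n x hx) (abs_nonneg _) ((abs_nonneg _).trans (hbd n x hx))
    · filter_upwards [ae_mem_volIoo a b] with x hx using (hlim x hx).mul (hlim x hx)
  refine le_of_tendsto' h fun n => le_trans ?_ (hE n)
  exact setIntegral_le_integral (hw n) (ae_of_all _ fun x => mul_self_nonneg _)

lemma fourier_expKer_mul_neg (hσ : 0 < σ) {ε : ℝ} (hε : 0 < ε) (ξ : ℝ) :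
    𝓕 (fun y => (expKer σ ε y : ℂ)) ξ * 𝓕 (fun y => (expKer σ ε y : ℂ)) (-ξ) =
      ((‖((ε : ℂ) + 2 * Real.pi * ξ * Complex.I) ^ (-σ : ℂ)‖ ^ 2 : ℝ) : ℂ) := by
  rw [fourier_ofReal_neg, fourier_expKer hσ hε, Complex.mul_conj']
  push_cast
  rfl

lemma aestronglyMeasurable_realConv {k g : ℝ → ℝ} (hk : Integrable k) (hg : Integrable g)
    (μ : Measure ℝ) (hμ : μ ≤ volume) : AEStronglyMeasurable (realConv k g) μ := by
  have : Integrable (realConv k g) := by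
    rw [realConv_eq_convolution]; exact hk.integrable_convolution _ hg
  exact this.aestronglyMeasurable.mono_measure hμ

/-- The left fractional derivative of a test function is bounded by its semi-norm. -/
lemma integral_sq_left_le_hsEnergy (hσ : 0 < σ) (hσ1 : σ < 1) (hψ : ContDiff ℝ ∞ ψ)
    (hc : HasCompactSupport ψ) (hs : tsupport ψ ⊆ Ioo a b) :
    ∫ x, kerApply (volIoo a b) (rlKer σ) (deriv ψ) x * kerApply (volIoo a b) (rlKer σ) (deriv ψ) x
      ∂volIoo a b ≤ hsEnergy (1 - σ) ψ := by
  have hg := contDiff_deriv_of_contDiff hψ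
  have hsupp := deriv_eq_zero_of_tsupport hs
  obtain ⟨M, -, hM⟩ := bounded_of_hasCompactSupport hg.continuous hc.deriv
  have hk : ∀ n, Integrable (expKer σ (cutoff n)) := fun n => integrable_expKer hσ (cutoff_pos n)
  exact integral_sq_kerApply_le_of_tendsto (w := fun n => realConv (expKer σ (cutoff n)) (deriv ψ))
    (fun n => integrable_realConv_mul_realConv (hk n) (hk n) hg.continuous hc.deriv)
    (fun n => aestronglyMeasurable_realConv (hk n)
      (hg.continuous.integrable_of_hasCompactSupport hc.deriv) _ Measure.restrict_le_self)
    (fun x hx => tendsto_realConv_expKer hσ hg.continuous.measurable hsupp hM hx)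
    (fun n x hx => abs_realConv_expKer_le hσ hsupp hM hx n)
    (fun n => integral_sq_realConv_le hσ hσ1 (hk n)
      (fun ξ => Or.inl (fourier_expKer_mul_neg hσ (cutoff_pos n) ξ)) hψ hc)

/-- The right fractional derivative of a test function is bounded by its semi-norm. -/
lemma integral_sq_right_le_hsEnergy (hσ : 0 < σ) (hσ1 : σ < 1) (hψ : ContDiff ℝ ∞ ψ)
    (hc : HasCompactSupport ψ) (hs : tsupport ψ ⊆ Ioo a b) :
    ∫ x, kerApply (volIoo a b) (kerT (rlKer σ)) (deriv ψ) x *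
      kerApply (volIoo a b) (kerT (rlKer σ)) (deriv ψ) x ∂volIoo a b ≤ hsEnergy (1 - σ) ψ := by
  have hg := contDiff_deriv_of_contDiff hψ
  have hsupp := deriv_eq_zero_of_tsupport hs
  obtain ⟨M, -, hM⟩ := bounded_of_hasCompactSupport hg.continuous hc.deriv
  have hk : ∀ n, Integrable (fun y => expKer σ (cutoff n) (-y)) := fun n =>
    (integrable_expKer hσ (cutoff_pos n)).comp_neg
  refine integral_sq_kerApply_le_of_tendsto
    (w := fun n => realConv (fun y => expKer σ (cutoff n) (-y)) (deriv ψ))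
    (fun n => integrable_realConv_mul_realConv (hk n) (hk n) hg.continuous hc.deriv)
    (fun n => aestronglyMeasurable_realConv (hk n)
      (hg.continuous.integrable_of_hasCompactSupport hc.deriv) _ Measure.restrict_le_self)
    (fun x hx => tendsto_realConv_expKer_neg hσ hg.continuous.measurable hsupp hM hx)
    (fun n x hx => abs_realConv_expKer_neg_le hσ hsupp hM hx n)
    (fun n => integral_sq_realConv_le (ε := cutoff n) hσ hσ1 (hk n) (fun ξ => Or.inr ?_) hψ hc)
  have e := fun ξ => fourier_comp_neg (fun y => (expKer σ (cutoff n) y : ℂ)) ξ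
  rw [e, e, fourier_expKer_mul_neg hσ (cutoff_pos n)]

/-- The product of the left and the right fractional derivatives of a test function. -/
lemma integral_left_mul_right (hσ : 0 < σ) (hσ1 : σ < 1) (hψ : ContDiff ℝ ∞ ψ)
    (hc : HasCompactSupport ψ) (hs : tsupport ψ ⊆ Ioo a b) :
    ∫ x, kerApply (volIoo a b) (rlKer σ) (deriv ψ) x *
      kerApply (volIoo a b) (kerT (rlKer σ)) (deriv ψ) x ∂volIoo a b =
        Real.cos (Real.pi * σ) * hsEnergy (1 - σ) ψ := by
  have hg := contDiff_deriv_of_contDiff hψ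
  have hsupp := deriv_eq_zero_of_tsupport hs
  obtain ⟨M, hM0, hM⟩ := bounded_of_hasCompactSupport hg.continuous hc.deriv
  have hgi := hg.continuous.integrable_of_hasCompactSupport (μ := volume) hc.deriv
  have hk : ∀ n, Integrable (expKer σ (cutoff n)) := fun n => integrable_expKer hσ (cutoff_pos n)
  have hk' : ∀ n, Integrable (fun y => expKer σ (cutoff n) (-y)) := fun n => (hk n).comp_neg
  have h1 : Tendsto (fun n => ∫ x, realConv (expKer σ (cutoff n)) (deriv ψ) x *
      realConv (fun y => expKer σ (cutoff n) (-y)) (deriv ψ) x ∂volIoo a b) atTop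
      (𝓝 (∫ x, kerApply (volIoo a b) (rlKer σ) (deriv ψ) x *
      kerApply (volIoo a b) (kerT (rlKer σ)) (deriv ψ) x ∂volIoo a b)) := by
    refine tendsto_integral_of_dominated_convergence
      (fun _ => (rlBound a b σ * M) * (rlBound a b σ * M)) (fun n => ?_) (integrable_const _)
      (fun n => ?_) ?_
    · exact (aestronglyMeasurable_realConv (hk n) hgi _ Measure.restrict_le_self).mul
        (aestronglyMeasurable_realConv (hk' n) hgi _ Measure.restrict_le_self)
    · filter_upwards [ae_mem_volIoo a b] with x hx
      rw [norm_mul]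
      exact mul_le_mul (abs_realConv_expKer_le hσ hsupp hM hx n)
        (abs_realConv_expKer_neg_le hσ hsupp hM hx n) (norm_nonneg _) (by positivity)
    · filter_upwards [ae_mem_volIoo a b] with x hx
      exact (tendsto_realConv_expKer hσ hg.continuous.measurable hsupp hM hx).mul
        (tendsto_realConv_expKer_neg hσ hg.continuous.measurable hsupp hM hx)
  have h2 : ∀ n, ∫ x, realConv (expKer σ (cutoff n)) (deriv ψ) x *
      realConv (fun y => expKer σ (cutoff n) (-y)) (deriv ψ) x ∂volIoo a b =
      ∫ ξ : ℝ, ((((cutoff n : ℝ) : ℂ) + 2 * Real.pi * ξ * Complex.I) ^ (-σ : ℂ) *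
        (((cutoff n : ℝ) : ℂ) + 2 * Real.pi * ξ * Complex.I) ^ (-σ : ℂ)).re *
        ‖𝓕 (fun y => ((deriv ψ y : ℝ) : ℂ)) ξ‖ ^ 2 := fun n => by
    -- The product vanishes outside `(a, b)`, so Parseval on the line gives an equality here.
    rw [setIntegral_eq_integral_of_forall_compl_eq_zero,
      integral_realConv_mul_realConv (hk n) (hk' n) hg hc.deriv]
    · have e := fun ξ => fourier_comp_neg (fun y => (expKer σ (cutoff n) y : ℂ)) ξ
      simp only [e, neg_neg, fourier_expKer hσ (cutoff_pos n)]
    · intro x hx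
      rw [mem_Ioo, not_and_or, not_lt, not_lt] at hx
      rcases hx with hx | hx
      · rw [realConv_expKer_of_le hsupp _ hx, zero_mul]
      · rw [realConv_expKer_neg_of_le hsupp _ hx, mul_zero]
  simp only [h2] at h1
  refine tendsto_nhds_unique h1 ?_
  rw [hsEnergy, ← integral_const_mul]
  -- The limit `ε → 0` on the frequency side, with the energy density as majorant.
  refine tendsto_integral_of_dominated_convergence
    (fun ξ => (|2 * Real.pi * ξ| ^ (1 - σ) * ‖𝓕 (fun y => (ψ y : ℂ)) ξ‖) ^ 2) (fun n => ?_)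
    (integrable_hsEnergy (by linarith) (by linarith) hψ hc) (fun n => ?_) ?_
  · refine AEStronglyMeasurable.mul ?_
      ((continuous_fourier_test hg hc.deriv).norm.pow 2).aestronglyMeasurable
    exact Measurable.aestronglyMeasurable (by fun_prop)
  · filter_upwards [ae_ne_zero_real] with ξ hξ
    rw [← energy_deriv_eq hψ hc hξ, norm_mul, Real.norm_of_nonneg (sq_nonneg (‖_‖))]
    refine mul_le_mul_of_nonneg_right ?_ (sq_nonneg _)
    refine (Complex.abs_re_le_norm _).trans ?_
    rw [norm_mul, sq]
    have := norm_cutoff_cpow_le (ε := cutoff n) hσ hξ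
    exact mul_le_mul this this (norm_nonneg _) (by positivity)
  · filter_upwards [ae_ne_zero_real] with ξ hξ
    rw [← energy_deriv_eq hψ hc hξ, ← mul_assoc, ← re_cpow_sq hξ, sq (_ ^ _)]
    refine Tendsto.mul_const _ ?_
    have hz : (2 * Real.pi * ξ * Complex.I : ℂ) ∈ Complex.slitPlane := by
      right
      have : (2 * Real.pi * ξ * Complex.I : ℂ).im = 2 * Real.pi * ξ := by simp
      rw [this]; positivity
    have ht : Tendsto (fun n => ((cutoff n : ℝ) : ℂ) + 2 * Real.pi * ξ * Complex.I) atTop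
        (𝓝 (2 * Real.pi * ξ * Complex.I)) := by
      have := ((Complex.continuous_ofReal.tendsto 0).comp tendsto_cutoff).add_const
        (2 * Real.pi * ξ * Complex.I : ℂ)
      simpa using this
    have hcp := (continuousAt_cpow_const (b := (-σ : ℂ)) hz).tendsto.comp ht
    exact (Complex.continuous_re.tendsto _).comp (hcp.mul hcp)

end Test

/-! ### Structure of `Ĥ^s_0(a, b)` -/

section Space

variable {a b s : ℝ}

lemma eLpNorm_zeroExt (u : L2Ioo a b) : eLpNorm (zeroExt u) 2 volume = eLpNorm u 2 (volIoo a b) := by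
  rw [eLpNorm_congr_ae (zeroExt_coe u), eLpNorm_indicator_eq_eLpNorm_restrict measurableSet_Ioo]

variable (a b) in
/-- Extension by zero as a linear isometry. -/
def zeroExtLI : L2Ioo a b →ₗᵢ[ℝ] Lp ℝ 2 (volume : Measure ℝ) where
  toFun := zeroExt
  map_add' := zeroExt_add
  map_smul' := zeroExt_smul
  norm_map' u := by
    rw [Lp.norm_def, Lp.norm_def]
    exact congrArg ENNReal.toReal (eLpNorm_zeroExt u)

lemma continuous_fourierL2 : Continuous fourierL2 :=
  (FourierTransform.continuous_fourier).comp
    (Complex.ofRealCLM.compLpL 2 (volume : Measure ℝ)).continuous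

/-- Lower semicontinuity of the semi-norm under convergence in `L²`. -/
lemma hsSeminorm_le_of_tendsto {v : ℕ → L2Ioo a b} {w : L2Ioo a b} (hv : Tendsto v atTop (𝓝 w))
    {C : ℝ≥0∞} (hC : ∀ n, hsSeminorm s (zeroExt (v n)) ≤ C) : hsSeminorm s (zeroExt w) ≤ C := by
  have h1 : Tendsto (fun n => fourierL2 (zeroExt (v n))) atTop (𝓝 (fourierL2 (zeroExt w))) :=
    (continuous_fourierL2.tendsto _).comp (((zeroExtLI a b).continuous.tendsto w).comp hv)
  -- The transforms converge in `L²`, hence almost everywhere along a subsequence; Fatou's lemma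
  -- then bounds the weighted norm of the limit.
  obtain ⟨φ, -, hφ⟩ := (tendstoInMeasure_of_tendsto_Lp h1).exists_seq_tendsto_ae
  have hm : ∀ z : Lp ℝ 2 (volume : Measure ℝ),
      AEStronglyMeasurable (fun ξ : ℝ => |2 * Real.pi * ξ| ^ s • fourierL2 z ξ) volume := by
    intro z
    refine AEStronglyMeasurable.smul (𝕜 := ℝ) ?_ (Lp.aestronglyMeasurable _)
    exact Measurable.aestronglyMeasurable (by fun_prop)
  refine (Lp.eLpNorm_lim_le_liminf_eLpNorm (p := 2)
    (f := fun n ξ => |2 * Real.pi * ξ| ^ s • fourierL2 (zeroExt (v (φ n))) ξ)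
    (fun n => hm _) _ ?_).trans ?_
  · filter_upwards [hφ] with ξ h using h.const_smul _
  · refine liminf_le_of_frequently_le' (Eventually.frequently ?_)
    exact Eventually.of_forall fun n => hC (φ n)

lemma hsSeminorm_lt_top (u : HsZero s a b) : hsSeminorm s (zeroExt (u : L2Ioo a b)) < ⊤ :=
  (hsSeminorm_le_hsNorm s _).trans_lt u.2.1

variable (a b s) in
/-- The semi-norm of `Ĥ^s_0(a, b)`. -/
def hsSemi : Seminorm ℝ (HsZero s a b) :=
  Seminorm.of (fun u => (hsSeminorm s (zeroExt (u : L2Ioo a b))).toReal)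
    (fun u v => by
      have hu := hsSeminorm_lt_top u
      have hv := hsSeminorm_lt_top v
      rw [← ENNReal.toReal_add hu.ne hv.ne, Submodule.coe_add, zeroExt_add]
      exact ENNReal.toReal_mono (ENNReal.add_lt_top.2 ⟨hu, hv⟩).ne (hsSeminorm_add_le s _ _))
    (fun c u => by
      rw [Submodule.coe_smul, zeroExt_smul, hsSeminorm_smul, ENNReal.toReal_mul, toReal_enorm])

lemma hsSemi_apply (u : HsZero s a b) :
    hsSemi a b s u = (hsSeminorm s (zeroExt (u : L2Ioo a b))).toReal := rfl

lemma hsZeroNorm_sq (u : HsZero s a b) :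
    hsZeroNorm u ^ 2 = ‖(u : L2Ioo a b)‖ ^ 2 + hsSemi a b s u ^ 2 := by
  have hu := (hsSeminorm_lt_top u).ne
  have hu2 : eLpNorm (u : L2Ioo a b) 2 (volIoo a b) ≠ ⊤ := (Lp.memLp _).2.ne
  rw [hsZeroNorm, hsNorm, eLpNorm_zeroExt, ← ENNReal.toReal_rpow, ← Real.sqrt_eq_rpow,
    Real.sq_sqrt ENNReal.toReal_nonneg, ENNReal.toReal_add (by simp [hu2]) (by simp [hu]),
    ENNReal.toReal_pow, ENNReal.toReal_pow, hsSemi_apply, Lp.norm_def]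

lemma hsZeroNorm_nonneg (u : HsZero s a b) : 0 ≤ hsZeroNorm u := ENNReal.toReal_nonneg

lemma norm_le_hsZeroNorm (u : HsZero s a b) : ‖(u : L2Ioo a b)‖ ≤ hsZeroNorm u := by
  refine le_of_sq_le_sq ?_ (hsZeroNorm_nonneg u)
  rw [hsZeroNorm_sq]; nlinarith [sq_nonneg (hsSemi a b s u)]

lemma hsSemi_le_hsZeroNorm (u : HsZero s a b) : hsSemi a b s u ≤ hsZeroNorm u := by
  refine le_of_sq_le_sq ?_ (hsZeroNorm_nonneg u)
  rw [hsZeroNorm_sq]; nlinarith [sq_nonneg ‖(u : L2Ioo a b)‖]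

lemma hsZeroNorm_le (u : HsZero s a b) : hsZeroNorm u ≤ ‖(u : L2Ioo a b)‖ + hsSemi a b s u := by
  refine le_of_sq_le_sq ?_ (add_nonneg (norm_nonneg _) (apply_nonneg _ _))
  rw [hsZeroNorm_sq]
  nlinarith [mul_nonneg (norm_nonneg (u : L2Ioo a b)) (apply_nonneg (hsSemi a b s) u)]

lemma IsTest.mem_hsZero (hs0 : 0 ≤ s) (hs1 : s ≤ 1) {φ : L2Ioo a b} (hφ : IsTest φ) :
    φ ∈ HsZero s a b := by
  refine ⟨?_, fun _ => φ, fun _ => hφ, ?_⟩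
  · obtain ⟨ψ, h1, h2, h3, h4⟩ := hφ
    refine (hsNorm_le s _).trans_lt (ENNReal.add_lt_top.2 ⟨(Lp.memLp (zeroExt φ)).2, ?_⟩)
    have h := hsSeminorm_test_sq hs0 hs1 h1 h2 (eq_zero_of_tsupport h3) h4
    by_contra hc
    rw [not_lt, top_le_iff] at hc
    rw [hc] at h
    simp at h
  · have h0 : hsNorm s (zeroExt (φ - φ)) = 0 := by
      have h := zeroExt_smul (0 : ℝ) φ
      rw [zero_smul] at h
      rw [sub_self, h, zero_smul, ← zero_smul ℝ (0 : Lp ℝ 2 (volume : Measure ℝ)), hsNorm_smul]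
      simp
    exact tendsto_const_nhds.congr fun _ => h0.symm

lemma exists_test_seq (hs0 : 0 ≤ s) (hs1 : s ≤ 1) (u : HsZero s a b) :
    ∃ φ : ℕ → HsZero s a b, (∀ n, IsTest (φ n : L2Ioo a b)) ∧
      Tendsto (fun n => hsZeroNorm (φ n - u)) atTop (𝓝 0) := by
  obtain ⟨-, φ, hφ, ht⟩ := u.2
  refine ⟨fun n => ⟨φ n, (hφ n).mem_hsZero hs0 hs1⟩, hφ, ?_⟩
  have := (ENNReal.tendsto_toReal ENNReal.zero_ne_top).comp ht
  exact this

lemma tendsto_of_tendsto_hsZeroNorm {φ : ℕ → HsZero s a b} {u : HsZero s a b}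
    (h : Tendsto (fun n => hsZeroNorm (φ n - u)) atTop (𝓝 0)) :
    Tendsto (fun n => (φ n : L2Ioo a b)) atTop (𝓝 (u : L2Ioo a b)) := by
  rw [tendsto_iff_norm_sub_tendsto_zero]
  exact squeeze_zero (fun n => norm_nonneg _) (fun n => norm_le_hsZeroNorm (φ n - u)) h

lemma tendsto_hsSemi_of_tendsto_hsZeroNorm {φ : ℕ → HsZero s a b} {u : HsZero s a b}
    (h : Tendsto (fun n => hsZeroNorm (φ n - u)) atTop (𝓝 0)) :
    Tendsto (fun n => hsSemi a b s (φ n)) atTop (𝓝 (hsSemi a b s u)) := by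
  rw [tendsto_iff_norm_sub_tendsto_zero]
  refine squeeze_zero (fun n => norm_nonneg _) (fun n => ?_) h
  exact ((hsSemi a b s).norm_sub_map_le_sub (φ n) u).trans (hsSemi_le_hsZeroNorm _)

/-! ### Fractional derivatives on `Ĥ^s_0(a, b)` -/

/-- The left Riemann-Liouville integral on `L²(a, b)`. -/
def leftOp (a b : ℝ) {σ : ℝ} (hσ : 0 < σ) : L2Ioo a b →L[ℝ] L2Ioo a b :=
  schurOp (isSchur_rlKer a b hσ)

/-- The right Riemann-Liouville integral on `L²(a, b)`. -/
def rightOp (a b : ℝ) {σ : ℝ} (hσ : 0 < σ) : L2Ioo a b →L[ℝ] L2Ioo a b :=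
  schurOp (isSchur_rlKer a b hσ).swap

lemma leftOp_coe {σ : ℝ} (hσ : 0 < σ) (g : L2Ioo a b) :
    leftOp a b hσ g =ᵐ[volIoo a b] kerApply (volIoo a b) (rlKer σ) g := schurOp_coe _ g

lemma rightOp_coe {σ : ℝ} (hσ : 0 < σ) (g : L2Ioo a b) :
    rightOp a b hσ g =ᵐ[volIoo a b] kerApply (volIoo a b) (kerT (rlKer σ)) g := schurOp_coe _ g

lemma leftRLDeriv_leftOp (hab : a < b) (hs : 0 < s) (hs1 : s < 1) (g : L2Ioo a b) :
    leftRLDeriv a s (leftOp a b hs g) =ᵐ[volIoo a b] g :=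
  (leftRLDeriv_of_rep hab hs hs1 (Lp.memLp g) (leftOp_coe hs g)).2

lemma rightRLDeriv_rightOp (hab : a < b) (hs : 0 < s) (hs1 : s < 1) (g : L2Ioo a b) :
    rightRLDeriv b s (rightOp a b hs g) =ᵐ[volIoo a b] g :=
  (rightRLDeriv_of_rep hab hs hs1 (Lp.memLp g) (rightOp_coe hs g)).2

/-- The fractional derivative is a left inverse. Injectivity makes the representing function unique,
hence linear in `u`. -/
lemma leftOp_injective (hab : a < b) (hs : 0 < s) (hs1 : s < 1) :
    Function.Injective (leftOp a b hs) := fun g h hgh => by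
  apply Lp.ext
  have := leftRLDeriv_leftOp hab hs hs1 g
  rw [hgh] at this
  exact this.symm.trans (leftRLDeriv_leftOp hab hs hs1 h)

lemma rightOp_injective (hab : a < b) (hs : 0 < s) (hs1 : s < 1) :
    Function.Injective (rightOp a b hs) := fun g h hgh => by
  apply Lp.ext
  have := rightRLDeriv_rightOp hab hs hs1 g
  rw [hgh] at this
  exact this.symm.trans (rightRLDeriv_rightOp hab hs hs1 h)

lemma integral_deriv_left {ψ : ℝ → ℝ} (hψ : ContDiff ℝ ∞ ψ) (hs : tsupport ψ ⊆ Ioo a b) {x : ℝ} :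
    ∫ t in a..x, deriv ψ t = ψ x := by
  rw [intervalIntegral.integral_deriv_eq_sub (fun y _ => hψ.differentiable (by simp) y)
    ((contDiff_deriv_of_contDiff hψ).continuous.intervalIntegrable _ _),
    eq_zero_of_tsupport hs a (by simp), sub_zero]

lemma integral_deriv_right {ψ : ℝ → ℝ} (hψ : ContDiff ℝ ∞ ψ) (hs : tsupport ψ ⊆ Ioo a b) {x : ℝ} :
    ∫ t in x..b, deriv ψ t = -ψ x := by
  rw [intervalIntegral.integral_deriv_eq_sub (fun y _ => hψ.differentiable (by simp) y)
    ((contDiff_deriv_of_contDiff hψ).continuous.intervalIntegrable _ _),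
    eq_zero_of_tsupport hs b (by simp), zero_sub]

lemma memLp_deriv_test {ψ : ℝ → ℝ} (hψ : ContDiff ℝ ∞ ψ) (hc : HasCompactSupport ψ) :
    MemLp (deriv ψ) 2 (volIoo a b) :=
  ((contDiff_deriv_of_contDiff hψ).continuous.memLp_of_hasCompactSupport hc.deriv).restrict _

/-- The composition is `I^1 ψ' = ψ`, because `ψ` vanishes at `a`. -/
lemma leftOp_toLp_deriv (hs0 : 0 < s) (hs1 : 0 < 1 - s) {φ : L2Ioo a b} {ψ : ℝ → ℝ}
    (hψ : ContDiff ℝ ∞ ψ) (hc : HasCompactSupport ψ) (hs : tsupport ψ ⊆ Ioo a b)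
    (hφ : φ =ᵐ[volIoo a b] ψ) :
    leftOp a b hs0 (leftOp a b hs1 ((memLp_deriv_test hψ hc).toLp)) = φ := by
  have hmem := memLp_deriv_test (a := a) (b := b) hψ hc
  apply Lp.ext
  refine (leftOp_coe hs0 _).trans ?_
  filter_upwards [hφ, ae_mem_volIoo a b] with x h1 hx
  rw [kerApply_congr (leftOp_coe hs1 _), show kerApply (volIoo a b) (rlKer (1 - s)) (hmem.toLp) =
      kerApply (volIoo a b) (rlKer (1 - s)) (deriv ψ) from
      funext fun y => kerApply_congr hmem.coeFn_toLp y,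
    kerApply_rlKer_rlKer hs0 hs1 (by linarith) hx (hmem.integrable one_le_two),
    add_sub_cancel, kerApply_rlKer_one hx, integral_deriv_left hψ hs, h1]

lemma rightOp_toLp_deriv (hs0 : 0 < s) (hs1 : 0 < 1 - s) {φ : L2Ioo a b} {ψ : ℝ → ℝ}
    (hψ : ContDiff ℝ ∞ ψ) (hc : HasCompactSupport ψ) (hs : tsupport ψ ⊆ Ioo a b)
    (hφ : φ =ᵐ[volIoo a b] ψ) :
    rightOp a b hs0 (-rightOp a b hs1 ((memLp_deriv_test hψ hc).toLp)) = φ := by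
  have hmem := memLp_deriv_test (a := a) (b := b) hψ hc
  rw [map_neg, neg_eq_iff_eq_neg]
  apply Lp.ext
  refine (rightOp_coe hs0 _).trans ?_
  filter_upwards [hφ, ae_mem_volIoo a b, Lp.coeFn_neg φ] with x h1 hx h2
  rw [kerApply_congr (rightOp_coe hs1 _),
    show kerApply (volIoo a b) (kerT (rlKer (1 - s))) (hmem.toLp) =
      kerApply (volIoo a b) (kerT (rlKer (1 - s))) (deriv ψ) from
      funext fun y => kerApply_congr hmem.coeFn_toLp y,
    kerApply_kerT_rlKer_kerT_rlKer hs0 hs1 (by linarith) hx (hmem.integrable one_le_two),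
    add_sub_cancel, kerApply_kerT_rlKer_one hx, integral_deriv_right hψ hs, h2, Pi.neg_apply, h1]

/-- The witnesses are `I^{1-s} ψ'` and `-J^{1-s} ψ'`, and the three estimates are the energy
identities for order `σ = 1 - s`. -/
lemma IsTest.exists_rep (hs0 : 0 < s) (hs1 : s < 1) {u : HsZero s a b}
    (hu : IsTest (u : L2Ioo a b)) :
    ∃ g h : L2Ioo a b, leftOp a b hs0 g = u ∧ rightOp a b hs0 h = u ∧
      ‖g‖ ≤ hsSemi a b s u ∧ ‖h‖ ≤ hsSemi a b s u ∧
      inner ℝ g h = Real.cos (Real.pi * s) * hsSemi a b s u ^ 2 := by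
  obtain ⟨ψ, h1, h2, h3, h4⟩ := hu
  have hs1' : 0 < 1 - s := by linarith
  have hmem := memLp_deriv_test (a := a) (b := b) h1 h2
  have hE : hsSemi a b s u ^ 2 = hsEnergy s ψ := by
    rw [hsSemi_apply, ← ENNReal.toReal_pow,
      hsSeminorm_test_sq hs0.le hs1.le h1 h2 (eq_zero_of_tsupport h3) h4,
      ENNReal.toReal_ofReal (hsEnergy_nonneg _ _)]
  have eL : leftOp a b hs1' hmem.toLp =ᵐ[volIoo a b]
      kerApply (volIoo a b) (rlKer (1 - s)) (deriv ψ) :=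
    (leftOp_coe hs1' _).trans (ae_of_all _ fun x => kerApply_congr hmem.coeFn_toLp x)
  have eR : rightOp a b hs1' hmem.toLp =ᵐ[volIoo a b]
      kerApply (volIoo a b) (kerT (rlKer (1 - s))) (deriv ψ) :=
    (rightOp_coe hs1' _).trans (ae_of_all _ fun x => kerApply_congr hmem.coeFn_toLp x)
  have iL := integral_sq_left_le_hsEnergy (a := a) (b := b) hs1' (by linarith) h1 h2 h3
  have iR := integral_sq_right_le_hsEnergy (a := a) (b := b) hs1' (by linarith) h1 h2 h3
  have iLR := integral_left_mul_right (a := a) (b := b) hs1' (by linarith) h1 h2 h3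
  rw [sub_sub_cancel] at iL iR iLR
  refine ⟨leftOp a b hs1' hmem.toLp, -rightOp a b hs1' hmem.toLp,
    leftOp_toLp_deriv hs0 hs1' h1 h2 h3 h4, rightOp_toLp_deriv hs0 hs1' h1 h2 h3 h4, ?_, ?_, ?_⟩
  · refine le_of_sq_le_sq ?_ (apply_nonneg _ _)
    rw [hE, ← real_inner_self_eq_norm_sq, inner_L2_eq]
    refine le_trans (le_of_eq (integral_congr_ae ?_)) iL
    filter_upwards [eL] with x h using by rw [h]
  · refine le_of_sq_le_sq ?_ (apply_nonneg _ _)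
    rw [norm_neg, hE, ← real_inner_self_eq_norm_sq, inner_L2_eq]
    refine le_trans (le_of_eq (integral_congr_ae ?_)) iR
    filter_upwards [eR] with x h using by rw [h]
  · rw [inner_neg_right, inner_L2_eq, hE]
    -- The minus sign in the right-hand witness turns `cos(π(1-s))` into `cos(πs)`.
    have hcos : Real.cos (Real.pi * s) = -Real.cos (Real.pi * (1 - s)) := by
      rw [← Real.cos_pi_sub]; congr 1; ring
    rw [hcos, neg_mul, ← iLR]
    congr 1
    refine integral_congr_ae ?_
    filter_upwards [eL, eR] with x e1 e2 using by rw [e1, e2]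

lemma exists_tendsto_of_norm_sub_le {V : Type*} [NormedAddCommGroup V] [CompleteSpace V]
    {g : ℕ → V} {r : ℕ → ℝ} (hr : Tendsto r atTop (𝓝 0)) (h : ∀ n m, ‖g n - g m‖ ≤ r n + r m) :
    ∃ l, Tendsto g atTop (𝓝 l) := by
  refine cauchySeq_tendsto_of_complete (Metric.cauchySeq_iff.2 fun ε hε => ?_)
  obtain ⟨N, hN⟩ := (hr.eventually (gt_mem_nhds (half_pos hε))).exists_forall_of_atTop
  refine ⟨N, fun m hm n hn => ?_⟩
  rw [dist_eq_norm]
  linarith [h m n, hN m hm, hN n hn]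

/-- The representation of the elements of `Ĥ^s_0(a, b)` by fractional integrals. -/
lemma exists_rep (hab : a < b) (hs0 : 0 < s) (hs1 : s < 1) (u : HsZero s a b) :
    ∃ g h : L2Ioo a b, leftOp a b hs0 g = u ∧ rightOp a b hs0 h = u ∧
      ‖g‖ ≤ hsSemi a b s u ∧ ‖h‖ ≤ hsSemi a b s u ∧
      inner ℝ g h = Real.cos (Real.pi * s) * hsSemi a b s u ^ 2 := by
  obtain ⟨φ, hφ, hlim⟩ := exists_test_seq hs0.le hs1.le u
  choose g h e1 e2 e3 e4 e5 using fun n => (hφ n).exists_rep hs0 hs1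
  have hdiff : ∀ n m, hsSemi a b s (φ n - φ m) ≤
      hsZeroNorm (φ n - u) + hsZeroNorm (φ m - u) := fun n m => by
    calc hsSemi a b s (φ n - φ m) = hsSemi a b s ((φ n - u) - (φ m - u)) := by
          rw [sub_sub_sub_cancel_right]
      _ ≤ hsSemi a b s (φ n - u) + hsSemi a b s (φ m - u) := map_sub_le_add _ _ _
      _ ≤ _ := add_le_add (hsSemi_le_hsZeroNorm _) (hsSemi_le_hsZeroNorm _)
  have htest : ∀ n m, IsTest ((φ n - φ m : HsZero s a b) : L2Ioo a b) := fun n m => by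
    have := (hφ n).add ((hφ m).smul (-1))
    rwa [neg_one_smul, ← sub_eq_add_neg] at this
  -- The difference of two test functions is again one and its representing function is unique, so
  -- the semi-norm estimate makes the representing functions a Cauchy sequence.
  have hg : ∀ n m, ‖g n - g m‖ ≤ hsZeroNorm (φ n - u) + hsZeroNorm (φ m - u) := fun n m => by
    obtain ⟨g', -, e, -, e', -⟩ := (htest n m).exists_rep hs0 hs1
    have : g n - g m = g' := leftOp_injective hab hs0 hs1 (by
      rw [e, map_sub, e1, e1]; rfl)
    rw [this]
    exact e'.trans (hdiff n m)
  have hh : ∀ n m, ‖h n - h m‖ ≤ hsZeroNorm (φ n - u) + hsZeroNorm (φ m - u) := fun n m => by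
    obtain ⟨-, h', -, e, -, e', -⟩ := (htest n m).exists_rep hs0 hs1
    have : h n - h m = h' := rightOp_injective hab hs0 hs1 (by
      rw [e, map_sub, e2, e2]; rfl)
    rw [this]
    exact e'.trans (hdiff n m)
  obtain ⟨gl, hgl⟩ := exists_tendsto_of_norm_sub_le hlim hg
  obtain ⟨hl, hhl⟩ := exists_tendsto_of_norm_sub_le hlim hh
  have hu := tendsto_of_tendsto_hsZeroNorm hlim
  have hsm := tendsto_hsSemi_of_tendsto_hsZeroNorm hlim
  refine ⟨gl, hl, ?_, ?_, ?_, ?_, ?_⟩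
  · refine tendsto_nhds_unique (((leftOp a b hs0).continuous.tendsto gl).comp hgl) ?_
    exact hu.congr fun n => (e1 n).symm
  · refine tendsto_nhds_unique (((rightOp a b hs0).continuous.tendsto hl).comp hhl) ?_
    exact hu.congr fun n => (e2 n).symm
  · exact le_of_tendsto_of_tendsto' hgl.norm hsm e3
  · exact le_of_tendsto_of_tendsto' hhl.norm hsm e4
  · refine tendsto_nhds_unique (hgl.inner hhl) ?_
    exact ((hsm.pow 2).const_mul _).congr fun n => (e5 n).symm

lemma exists_rep_left (hab : a < b) (hs0 : 0 < s) (hs1 : s < 1) (u : HsZero s a b) :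
    ∃ g : L2Ioo a b, leftOp a b hs0 g = u :=
  (exists_rep hab hs0 hs1 u).imp fun _ h => h.choose_spec.1

lemma exists_rep_right (hab : a < b) (hs0 : 0 < s) (hs1 : s < 1) (u : HsZero s a b) :
    ∃ h : L2Ioo a b, rightOp a b hs0 h = u := by
  obtain ⟨-, h, -, e, -⟩ := exists_rep hab hs0 hs1 u
  exact ⟨h, e⟩

/-- The left fractional derivative of order `s` on `Ĥ^s_0(a, b)`. -/
def derivL (hab : a < b) (hs0 : 0 < s) (hs1 : s < 1) : HsZero s a b →ₗ[ℝ] L2Ioo a b where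
  toFun u := (exists_rep_left hab hs0 hs1 u).choose
  map_add' u v := leftOp_injective hab hs0 hs1 (by
    rw [map_add, (exists_rep_left hab hs0 hs1 u).choose_spec,
      (exists_rep_left hab hs0 hs1 v).choose_spec,
      (exists_rep_left hab hs0 hs1 (u + v)).choose_spec]; rfl)
  map_smul' c u := leftOp_injective hab hs0 hs1 (by
    rw [RingHom.id_apply, map_smul, (exists_rep_left hab hs0 hs1 u).choose_spec,
      (exists_rep_left hab hs0 hs1 (c • u)).choose_spec]; rfl)

/-- The right fractional derivative of order `s` on `Ĥ^s_0(a, b)`. -/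
def derivR (hab : a < b) (hs0 : 0 < s) (hs1 : s < 1) : HsZero s a b →ₗ[ℝ] L2Ioo a b where
  toFun u := (exists_rep_right hab hs0 hs1 u).choose
  map_add' u v := rightOp_injective hab hs0 hs1 (by
    rw [map_add, (exists_rep_right hab hs0 hs1 u).choose_spec,
      (exists_rep_right hab hs0 hs1 v).choose_spec,
      (exists_rep_right hab hs0 hs1 (u + v)).choose_spec]; rfl)
  map_smul' c u := rightOp_injective hab hs0 hs1 (by
    rw [RingHom.id_apply, map_smul, (exists_rep_right hab hs0 hs1 u).choose_spec,
      (exists_rep_right hab hs0 hs1 (c • u)).choose_spec]; rfl)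

variable (hab : a < b) (hs0 : 0 < s) (hs1 : s < 1)

lemma leftOp_derivL (u : HsZero s a b) : leftOp a b hs0 (derivL hab hs0 hs1 u) = u :=
  (exists_rep_left hab hs0 hs1 u).choose_spec

lemma rightOp_derivR (u : HsZero s a b) : rightOp a b hs0 (derivR hab hs0 hs1 u) = u :=
  (exists_rep_right hab hs0 hs1 u).choose_spec

lemma derivL_derivR_spec (u : HsZero s a b) :
    ‖derivL hab hs0 hs1 u‖ ≤ hsSemi a b s u ∧ ‖derivR hab hs0 hs1 u‖ ≤ hsSemi a b s u ∧
      inner ℝ (derivL hab hs0 hs1 u) (derivR hab hs0 hs1 u) =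
        Real.cos (Real.pi * s) * hsSemi a b s u ^ 2 := by
  obtain ⟨g, h, e1, e2, e3⟩ := exists_rep hab hs0 hs1 u
  have hg : derivL hab hs0 hs1 u = g :=
    leftOp_injective hab hs0 hs1 (by rw [leftOp_derivL, e1])
  have hh : derivR hab hs0 hs1 u = h :=
    rightOp_injective hab hs0 hs1 (by rw [rightOp_derivR, e2])
  rwa [hg, hh]

lemma norm_derivL_le (u : HsZero s a b) : ‖derivL hab hs0 hs1 u‖ ≤ hsSemi a b s u :=
  (derivL_derivR_spec hab hs0 hs1 u).1

lemma norm_derivR_le (u : HsZero s a b) : ‖derivR hab hs0 hs1 u‖ ≤ hsSemi a b s u :=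
  (derivL_derivR_spec hab hs0 hs1 u).2.1

lemma inner_derivL_derivR (u : HsZero s a b) :
    inner ℝ (derivL hab hs0 hs1 u) (derivR hab hs0 hs1 u) =
      Real.cos (Real.pi * s) * hsSemi a b s u ^ 2 :=
  (derivL_derivR_spec hab hs0 hs1 u).2.2

lemma derivL_injective : Function.Injective (derivL hab hs0 hs1) := fun u v h => by
  apply Subtype.ext
  rw [← leftOp_derivL hab hs0 hs1 u, h, leftOp_derivL hab hs0 hs1 v]

/-- A fractional Poincaré inequality: `u` is the integral of order `s` of its derivative. -/
lemma norm_le_rlBound_mul_derivL (u : HsZero s a b) :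
    ‖(u : L2Ioo a b)‖ ≤ rlBound a b s * ‖derivL hab hs0 hs1 u‖ := by
  conv_lhs => rw [← leftOp_derivL hab hs0 hs1 u]
  exact norm_schurOp_le _ _

/-- Cauchy-Schwarz in `(g, h) = cos(πs) |u|_s²` together with `‖h‖ ≤ |u|_s`. For `cos(πs) < 0` the
left derivative alone controls the semi-norm. -/
lemma hsSemi_le_derivL (u : HsZero s a b) :
    -Real.cos (Real.pi * s) * hsSemi a b s u ≤ ‖derivL hab hs0 hs1 u‖ := by
  have h1 := inner_derivL_derivR hab hs0 hs1 u
  have h2 := (neg_le_abs _).trans (abs_real_inner_le_norm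
    (derivL hab hs0 hs1 u) (derivR hab hs0 hs1 u))
  rw [h1] at h2
  have h3 := norm_derivR_le hab hs0 hs1 u
  rcases (apply_nonneg (hsSemi a b s) u).eq_or_lt with h | h
  · rw [← h, mul_zero]; exact norm_nonneg _
  · refine le_of_mul_le_mul_right ?_ h
    calc _ = -(Real.cos (Real.pi * s) * hsSemi a b s u ^ 2) := by ring
      _ ≤ _ := h2
      _ ≤ _ := by gcongr

end Space

/-! ### Closed range of the fractional derivative and Lax-Milgram -/

section Closed

variable {a b s : ℝ} (hab : a < b) (hs0 : 0 < s) (hs1 : s < 1)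

lemma tendsto_of_le_two_mul_add {x y z : ℕ → ℝ≥0∞} (hx : Tendsto x atTop (𝓝 0))
    (hy : Tendsto y atTop (𝓝 0)) (h : ∀ n, z n ≤ 2 * (x n + y n)) : Tendsto z atTop (𝓝 0) := by
  have h2 := ENNReal.Tendsto.const_mul (a := 2) (hx.add hy) (Or.inr (by simp))
  rw [add_zero, mul_zero] at h2
  exact tendsto_of_tendsto_of_tendsto_of_le_of_le tendsto_const_nhds h2 (fun _ => zero_le) h

/-- The left fractional derivative has closed range. -/
lemma isClosed_range_derivL (hcos : Real.cos (Real.pi * s) < 0) :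
    IsClosed (LinearMap.range (derivL hab hs0 hs1) : Set (L2Ioo a b)) := by
  refine IsSeqClosed.isClosed fun g l hg hgl => ?_
  choose u hu using hg
  set c := -Real.cos (Real.pi * s) with hc
  have hc0 : 0 < c := by rw [hc]; linarith
  -- The candidate preimage of `l`; the task is to show that it belongs to the Sobolev space.
  set w : L2Ioo a b := leftOp a b hs0 l with hw
  have hul : Tendsto (fun n => (u n : L2Ioo a b)) atTop (𝓝 w) := by
    refine (((leftOp a b hs0).continuous.tendsto l).comp hgl).congr fun n => ?_
    rw [Function.comp_apply, ← hu n, leftOp_derivL]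
  set r : ℕ → ℝ := fun n => c⁻¹ * ‖g n - l‖ with hr
  have hr0 : Tendsto r atTop (𝓝 0) := by
    have := (tendsto_iff_norm_sub_tendsto_zero.1 hgl).const_mul c⁻¹
    rwa [mul_zero] at this
  have hum : ∀ n m, hsSemi a b s (u n - u m) ≤ r n + r m := fun n m => by
    have h1 := hsSemi_le_derivL hab hs0 hs1 (u n - u m)
    rw [map_sub (derivL hab hs0 hs1), hu, hu, ← hc] at h1
    have h2 : ‖g n - g m‖ ≤ ‖g n - l‖ + ‖g m - l‖ := by
      rw [← sub_sub_sub_cancel_right (g n) (g m) l]; exact norm_sub_le _ _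
    rw [hr]
    simp only
    rw [← mul_add, inv_mul_eq_div, le_div_iff₀ hc0, mul_comm]
    exact h1.trans h2
  -- Lower semicontinuity in `m` of the Cauchy estimate `hum`; the shift by `N` keeps `r (m + N)`
  -- below `1 / (n + 1)`.
  have hsem : ∀ n, hsSeminorm s (zeroExt ((u n : L2Ioo a b) - w)) ≤
      ENNReal.ofReal (r n + 1 / ((n : ℝ) + 1)) := fun n => by
    obtain ⟨N, hN⟩ := (hr0.eventually
      (gt_mem_nhds (show (0 : ℝ) < 1 / ((n : ℝ) + 1) by positivity))).exists_forall_of_atTop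
    refine hsSeminorm_le_of_tendsto (v := fun m => (u n : L2Ioo a b) - (u (m + N) : L2Ioo a b))
      (tendsto_const_nhds.sub (hul.comp (tendsto_add_atTop_nat N))) fun m => ?_
    have h1 := hum n (m + N)
    rw [hsSemi_apply] at h1
    refine (ENNReal.le_ofReal_iff_toReal_le (hsSeminorm_lt_top (u n - u (m + N))).ne ?_).2
      (h1.trans (by have := hN (m + N) (by omega); linarith))
    have : 0 ≤ r n := by rw [hr]; positivity
    positivity
  have hnorm : Tendsto (fun n => hsNorm s (zeroExt ((u n : L2Ioo a b) - w))) atTop (𝓝 0) := by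
    have h1 : Tendsto (fun n => ENNReal.ofReal ‖(u n : L2Ioo a b) - w‖) atTop (𝓝 0) := by
      have := ENNReal.tendsto_ofReal (tendsto_iff_norm_sub_tendsto_zero.1 hul)
      rwa [ENNReal.ofReal_zero] at this
    have h2 : Tendsto (fun n : ℕ => ENNReal.ofReal (r n + 1 / ((n : ℝ) + 1))) atTop (𝓝 0) := by
      have := ENNReal.tendsto_ofReal (hr0.add tendsto_one_div_add_atTop_nhds_zero_nat)
      rwa [add_zero, ENNReal.ofReal_zero] at this
    refine tendsto_of_le_two_mul_add h1 h2 fun n => (hsNorm_le s _).trans ?_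
    rw [eLpNorm_zeroExt, ← Lp.enorm_def, ← ofReal_norm]
    exact (add_le_add_right (hsem n) _).trans (le_mul_of_one_le_left' one_le_two)
  -- A diagonal choice: a test function close to each `u n` gives a single sequence of test
  -- functions that converges to `w`.
  have hφ : ∀ n, ∃ φ : L2Ioo a b, IsTest φ ∧
      hsNorm s (zeroExt (φ - (u n : L2Ioo a b))) ≤ ENNReal.ofReal (1 / ((n : ℝ) + 1)) := fun n => by
    obtain ⟨-, φ, hφ, ht⟩ := (u n).2
    have hpos : (0 : ℝ≥0∞) < ENNReal.ofReal (1 / ((n : ℝ) + 1)) :=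
      ENNReal.ofReal_pos.2 (by positivity)
    obtain ⟨m, hm⟩ := (ht.eventually (gt_mem_nhds hpos)).exists
    exact ⟨φ m, hφ m, hm.le⟩
  choose φ hφ1 hφ2 using hφ
  have htest : Tendsto (fun n => hsNorm s (zeroExt (φ n - w))) atTop (𝓝 0) := by
    have h2 : Tendsto (fun n : ℕ => ENNReal.ofReal (1 / ((n : ℝ) + 1))) atTop (𝓝 0) := by
      have := ENNReal.tendsto_ofReal tendsto_one_div_add_atTop_nhds_zero_nat
      rwa [ENNReal.ofReal_zero] at this
    refine tendsto_of_le_two_mul_add h2 hnorm fun n => ?_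
    rw [← sub_add_sub_cancel (φ n) (u n : L2Ioo a b) w, zeroExt_add]
    refine (hsNorm_add_le s _ _).trans ?_
    gcongr
    exact hφ2 n
  have hfin : hsNorm s (zeroExt w) < ⊤ := by
    obtain ⟨n, hn⟩ := (htest.eventually (gt_mem_nhds one_pos)).exists
    have e : w = φ n + (-1 : ℝ) • (φ n - w) := by
      rw [neg_one_smul, ← sub_eq_add_neg, sub_sub_cancel]
    rw [e, zeroExt_add]
    refine (hsNorm_add_le s _ _).trans_lt (ENNReal.mul_lt_top (by simp)
      (ENNReal.add_lt_top.2 ⟨((hφ1 n).mem_hsZero hs0.le hs1.le).1, ?_⟩))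
    rw [zeroExt_smul, hsNorm_smul]
    exact ENNReal.mul_lt_top (by simp) (hn.trans ENNReal.one_lt_top)
  refine ⟨⟨w, hfin, φ, hφ1, htest⟩, leftOp_injective hab hs0 hs1 ?_⟩
  rw [leftOp_derivL]

/-- The Lax-Milgram theorem for a space that is isomorphic to a Hilbert space. -/
lemma exists_of_coercive {V H : Type*} [AddCommGroup V] [Module ℝ V] [NormedAddCommGroup H]
    [InnerProductSpace ℝ H] [CompleteSpace H] (e : V ≃ₗ[ℝ] H) (B : LinearMap.BilinForm ℝ V)
    {C c M : ℝ} (hB : ∀ u v, |B u v| ≤ C * ‖e u‖ * ‖e v‖) (hc : 0 < c)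
    (hcoer : ∀ u, c * ‖e u‖ ^ 2 ≤ B u u) (l : V →ₗ[ℝ] ℝ) (hl : ∀ v, |l v| ≤ M * ‖e v‖) :
    ∃ u, ∀ v, B u v = l v := by
  set B' : H →L[ℝ] H →L[ℝ] ℝ := LinearMap.mkContinuous₂
    (B.compl₁₂ (e.symm : H →ₗ[ℝ] V) (e.symm : H →ₗ[ℝ] V)) C (fun x y => by
      simpa using hB (e.symm x) (e.symm y)) with hB'
  have hBa : ∀ x y, B' x y = B (e.symm x) (e.symm y) := fun x y => rfl
  have hco : IsCoercive B' := ⟨c, hc, fun x => by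
    rw [hBa]
    have := hcoer (e.symm x)
    rw [e.apply_symm_apply, sq, ← mul_assoc] at this
    exact this⟩
  set l' : StrongDual ℝ H := (l ∘ₗ (e.symm : H →ₗ[ℝ] V)).mkContinuous M (fun x => by
    simpa using hl (e.symm x)) with hl'
  set f : H := (InnerProductSpace.toDual ℝ H).symm l'
  set x : H := hco.continuousLinearEquivOfBilin.symm f
  refine ⟨e.symm x, fun v => ?_⟩
  have h1 := hco.continuousLinearEquivOfBilin_apply x (e v)
  rw [ContinuousLinearEquiv.apply_symm_apply, InnerProductSpace.toDual_symm_apply, hBa,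
    e.symm_apply_apply] at h1
  rw [← h1, hl']
  simp

end Closed

/-! ### Multiplication by a `C¹` function -/

section Multiplication

variable {a b s M : ℝ} {P P' : ℝ → ℝ}

lemma kerT_rlKer_one (x t : ℝ) : kerT (rlKer 1) x t = if x < t then 1 else 0 := by
  simp [kerT, rlKer]

/-- The kernel of the commutator of the right fractional derivative and the multiplication
by `P`. -/
def commKer (s : ℝ) (P : ℝ → ℝ) (y t : ℝ) : ℝ :=
  if y < t then s / Real.Gamma (1 - s) * ((t - y) ^ (-s - 1) * (P t - P y)) else 0

lemma measurable_commKer (s : ℝ) (hP : Continuous P) :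
    Measurable (Function.uncurry (commKer s P)) := by
  have := hP.measurable
  refine Measurable.ite (measurableSet_lt measurable_fst measurable_snd) ?_ measurable_const
  fun_prop

lemma abs_sub_le_of_hasDerivAt (hd : ∀ x ∈ Ioo a b, HasDerivAt P (P' x) x)
    (hM : ∀ x ∈ Ioo a b, |P' x| ≤ M) {x t : ℝ} (hx : x ∈ Ioo a b) (ht : t ∈ Ioo a b) :
    |P t - P x| ≤ M * |t - x| :=
  Convex.norm_image_sub_le_of_norm_hasDerivWithin_le (fun y hy => (hd y hy).hasDerivWithinAt)
    hM (convex_Ioo a b) hx ht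

/-- The mean value inequality absorbs one power of `t - y`, so the strong singularity `-s - 1`
becomes the integrable `-s`. -/
lemma abs_commKer_le (hs0 : 0 < s) (hs1 : s < 1) (hd : ∀ x ∈ Ioo a b, HasDerivAt P (P' x) x)
    (hM : ∀ x ∈ Ioo a b, |P' x| ≤ M) {y t : ℝ} (hy : y ∈ Ioo a b) (ht : t ∈ Ioo a b) :
    |commKer s P y t| ≤ s * M * kerT (rlKer (1 - s)) y t := by
  have hΓ : 0 < Real.Gamma (1 - s) := Real.Gamma_pos_of_pos (by linarith)
  rw [commKer, kerT, rlKer]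
  split_ifs with h
  · have hpos := sub_pos.2 h
    have h1 := abs_sub_le_of_hasDerivAt hd hM hy ht
    rw [abs_of_pos hpos] at h1
    rw [abs_mul, abs_mul, abs_of_pos (div_pos hs0 hΓ), abs_of_pos (Real.rpow_pos_of_pos hpos _)]
    have e : (t - y) ^ (1 - s - 1) = (t - y) ^ (-s - 1) * (t - y) := by
      conv_rhs => rw [← Real.rpow_one (t - y), ← Real.rpow_mul hpos.le, one_mul,
        ← Real.rpow_add hpos]
      congr 1; ring
    rw [e]
    calc s / Real.Gamma (1 - s) * ((t - y) ^ (-s - 1) * |P t - P y|)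
        ≤ s / Real.Gamma (1 - s) * ((t - y) ^ (-s - 1) * (M * (t - y))) := by
          have := Real.rpow_pos_of_pos hpos (-s - 1)
          gcongr
      _ = _ := by field_simp
  · simp

lemma isSchur_commKer (hs0 : 0 < s) (hs1 : s < 1) (hP : Continuous P)
    (hd : ∀ x ∈ Ioo a b, HasDerivAt P (P' x) x) (hM0 : 0 ≤ M) (hM : ∀ x ∈ Ioo a b, |P' x| ≤ M) :
    IsSchur (volIoo a b) (commKer s P) ((s * M).toNNReal * rlBound a b (1 - s)) := by
  have key : ∀ y ∈ Ioo a b, ∀ t ∈ Ioo a b,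
      ‖commKer s P y t‖ₑ ≤ (s * M).toNNReal * ‖kerT (rlKer (1 - s)) y t‖ₑ := fun y hy t ht => by
    have hsM : 0 ≤ s * M := by positivity
    rw [← ofReal_norm, ← ofReal_norm]
    rw [show ((s * M).toNNReal : ℝ≥0∞) = ENNReal.ofReal (s * M) from rfl, ← ENNReal.ofReal_mul hsM]
    refine ENNReal.ofReal_le_ofReal ?_
    have hk : 0 ≤ kerT (rlKer (1 - s)) y t := rlKer_nonneg (by linarith) _ _
    rw [Real.norm_of_nonneg hk]
    exact abs_commKer_le hs0 hs1 hd hM hy ht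
  refine (isSchur_rlKer a b (sub_pos.2 hs1)).swap.mono (measurable_commKer s hP) ?_ ?_
  · filter_upwards [ae_mem_volIoo a b] with y hy
    filter_upwards [ae_mem_volIoo a b] with t ht using key y hy t ht
  · filter_upwards [ae_mem_volIoo a b] with t ht
    filter_upwards [ae_mem_volIoo a b] with y hy using key y hy t ht

/-- Only the endpoint `y = t` matters: there the Lipschitz bound on `P` leaves `M (t - y)^{1-s}`,
which tends to zero. -/
lemma continuousOn_kernel (hs1 : s < 1) (hP : Continuous P)
    (hd : ∀ x ∈ Ioo a b, HasDerivAt P (P' x) x)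
    (hM : ∀ x ∈ Ioo a b, |P' x| ≤ M) {x t : ℝ} (hx : x ∈ Ioo a b) (ht : t ∈ Ioo a b) :
    ContinuousOn (fun y => (t - y) ^ (-s) * (P t - P y)) (Icc x t) := by
  intro y hy
  rcases hy.2.lt_or_eq with h | rfl
  · refine ContinuousAt.continuousWithinAt ?_
    refine ContinuousAt.mul ?_ (by fun_prop)
    exact ContinuousAt.rpow_const (by fun_prop) (Or.inl (sub_pos.2 h).ne')
  · rw [ContinuousWithinAt, sub_self (P y), mul_zero]
    have hlim : Tendsto (fun z => M * (y - z) ^ (1 - s)) (𝓝[Icc x y] y) (𝓝 0) := by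
      have hc : ContinuousAt (fun z => M * (y - z) ^ (1 - s)) y :=
        continuousAt_const.mul (ContinuousAt.rpow_const (by fun_prop) (Or.inr (by linarith)))
      have := hc.tendsto.mono_left (nhdsWithin_le_nhds (s := Icc x y))
      simpa [Real.zero_rpow (by linarith : (1 - s) ≠ 0)] using this
    refine squeeze_zero_norm' ?_ hlim
    filter_upwards [self_mem_nhdsWithin] with z hz
    rcases hz.2.lt_or_eq with h | rfl
    · have hpos := sub_pos.2 h
      have h1 := abs_sub_le_of_hasDerivAt hd hM (x := z) ⟨hx.1.trans_le hz.1, h.trans ht.2⟩ ht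
      rw [abs_of_pos hpos] at h1
      rw [norm_mul, Real.norm_of_nonneg (Real.rpow_pos_of_pos hpos _).le, Real.norm_eq_abs,
        sub_eq_add_neg 1 s, Real.rpow_add hpos, Real.rpow_one]
      have := (Real.rpow_pos_of_pos hpos (-s)).le
      calc (y - z) ^ (-s) * |P y - P z| ≤ (y - z) ^ (-s) * (M * (y - z)) := by gcongr
        _ = _ := by ring
    · simp [Real.zero_rpow (by linarith : (1 - s) ≠ 0)]

lemma intervalIntegrable_sub_rpow (hs1 : s < 1) (x t : ℝ) :
    IntervalIntegrable (fun y => (t - y) ^ (-s)) volume x t := by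
  have h := (intervalIntegral.intervalIntegrable_rpow' (a := 0) (b := t - x) (r := -s)
    (by linarith)).comp_sub_left t
  simpa using h.symm

/-- The fundamental theorem of calculus up to the singular endpoint, where the primitive is
continuous with value zero and its derivative is dominated by `(s + 1) M (t - y)^{-s}`. -/
lemma integral_deriv_kernel (hs0 : 0 < s) (hs1 : s < 1) (hP : Continuous P) (hP' : Continuous P')
    (hd : ∀ x ∈ Ioo a b, HasDerivAt P (P' x) x) (hM : ∀ x ∈ Ioo a b, |P' x| ≤ M) {x t : ℝ}
    (hx : x ∈ Ioo a b) (ht : t ∈ Ioo a b) (hxt : x < t) :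
    ∫ y in x..t, (s * ((t - y) ^ (-s - 1) * (P t - P y)) - (t - y) ^ (-s) * P' y) =
      -((t - x) ^ (-s) * (P t - P x)) := by
  have hsub : ∀ y ∈ Ioo x t, y ∈ Ioo a b := fun y hy => ⟨hx.1.trans hy.1, hy.2.trans ht.2⟩
  have hM0 : 0 ≤ M := (abs_nonneg _).trans (hM x hx)
  rw [intervalIntegral.integral_eq_sub_of_hasDerivAt_of_le hxt.le
    (continuousOn_kernel hs1 hP hd hM hx ht)]
  · simp
  · intro y hy
    have hpos := sub_pos.2 hy.2
    have h1 : HasDerivAt (fun y => (t - y) ^ (-s)) (s * (t - y) ^ (-s - 1)) y := by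
      have := ((hasDerivAt_id y).const_sub t).rpow_const (p := -s) (Or.inl hpos.ne')
      simpa [mul_comm, mul_left_comm] using this
    have h2 := h1.mul ((hd y (hsub y hy)).const_sub (P t))
    convert! h2 using 1
    ring
  · rw [intervalIntegrable_iff_integrableOn_Ioo_of_le hxt.le]
    have hi := ((intervalIntegrable_iff_integrableOn_Ioo_of_le hxt.le).1
      (intervalIntegrable_sub_rpow hs1 x t)).const_mul ((s + 1) * M)
    refine Integrable.mono' hi ?_ ?_
    · have := hP.measurable
      have := hP'.measurable
      exact Measurable.aestronglyMeasurable (by fun_prop)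
    · filter_upwards [ae_restrict_mem measurableSet_Ioo] with y hy
      have hpos := sub_pos.2 hy.2
      have h1 := abs_sub_le_of_hasDerivAt hd hM (hsub y hy) ht
      rw [abs_of_pos hpos] at h1
      have hr := (Real.rpow_pos_of_pos hpos (-s)).le
      have hr1 := (Real.rpow_pos_of_pos hpos (-s - 1)).le
      have e : (t - y) ^ (-s) = (t - y) ^ (-s - 1) * (t - y) := by
        conv_rhs => rw [← Real.rpow_one (t - y), ← Real.rpow_mul hpos.le, one_mul,
          ← Real.rpow_add hpos]
        congr 1; ring
      calc ‖s * ((t - y) ^ (-s - 1) * (P t - P y)) - (t - y) ^ (-s) * P' y‖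
          ≤ ‖s * ((t - y) ^ (-s - 1) * (P t - P y))‖ + ‖(t - y) ^ (-s) * P' y‖ := norm_sub_le _ _
        _ = s * ((t - y) ^ (-s - 1) * |P t - P y|) + (t - y) ^ (-s) * |P' y| := by
          rw [norm_mul, norm_mul, norm_mul, Real.norm_of_nonneg hs0.le, Real.norm_of_nonneg hr,
            Real.norm_of_nonneg hr1, Real.norm_eq_abs, Real.norm_eq_abs]
        _ ≤ s * ((t - y) ^ (-s - 1) * (M * (t - y))) + (t - y) ^ (-s) * M := by
          gcongr
          exact hM y (hsub y hy)
        _ = (s + 1) * M * (t - y) ^ (-s) := by rw [e]; ring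

/-- The kernel of the derivative of `y ↦ (t - y)^{-s} (P t - P y) / Γ(1 - s)`. -/
def commKer' (s : ℝ) (P P' : ℝ → ℝ) (y t : ℝ) : ℝ :=
  commKer s P y t - kerT (rlKer (1 - s)) y t * P' y

/-- The two indicator conditions cut the integral down to `x < y < t`, where the integrand is an
exact derivative in `y` that vanishes at `t` before differentiation. -/
lemma integral_kerT_rlKer_one_mul_commKer' (hs0 : 0 < s) (hs1 : s < 1) (hP : Continuous P)
    (hP' : Continuous P') (hd : ∀ x ∈ Ioo a b, HasDerivAt P (P' x) x)
    (hM : ∀ x ∈ Ioo a b, |P' x| ≤ M) {x t : ℝ} (hx : x ∈ Ioo a b) (ht : t ∈ Ioo a b) :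
    ∫ y, kerT (rlKer 1) x y * commKer' s P P' y t ∂volIoo a b =
      -(kerT (rlKer (1 - s)) x t * (P t - P x)) := by
  by_cases hxt : x < t
  · have e : ∀ y, kerT (rlKer 1) x y * commKer' s P P' y t =
        if x < y then (if y < t then 1 / Real.Gamma (1 - s) *
          (s * ((t - y) ^ (-s - 1) * (P t - P y)) - (t - y) ^ (-s) * P' y) else 0) else 0 :=
      fun y => by
        rw [kerT_rlKer_one, commKer', commKer, kerT, rlKer, show 1 - s - 1 = -s by ring]
        split_ifs <;> ring
    simp only [e]
    rw [setIntegral_Ioo_ite_gt hx, intervalIntegral.integral_of_le hx.2.le,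
      integral_Ioc_eq_integral_Ioo, setIntegral_Ioo_ite_lt ⟨hxt, ht.2⟩,
      intervalIntegral.integral_const_mul, integral_deriv_kernel hs0 hs1 hP hP' hd hM hx ht hxt,
      kerT, rlKer, if_pos hxt, show 1 - s - 1 = -s by ring]
    ring
  · have e : ∀ y, kerT (rlKer 1) x y * commKer' s P P' y t = 0 := fun y => by
      rw [kerT_rlKer_one, commKer', commKer, kerT, rlKer]
      split_ifs with h1 h2
      · exact absurd (h1.trans h2) hxt
      all_goals simp
    simp only [e, integral_zero]
    rw [kerT, rlKer, if_neg hxt]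
    simp

lemma enorm_kerT_rlKer_one_le (x y : ℝ) : ‖kerT (rlKer 1) x y‖ₑ ≤ 1 := by
  rw [kerT_rlKer_one]
  split_ifs <;> simp

lemma isSchur_commKer' (hs0 : 0 < s) (hs1 : s < 1) (hP : Continuous P) (hP' : Continuous P')
    (hd : ∀ x ∈ Ioo a b, HasDerivAt P (P' x) x) (hM0 : 0 ≤ M) (hM : ∀ x ∈ Ioo a b, |P' x| ≤ M) :
    IsSchur (volIoo a b) (commKer' s P P')
      (((s + 1) * M).toNNReal * rlBound a b (1 - s)) := by
  have key : ∀ y ∈ Ioo a b, ∀ t ∈ Ioo a b,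
      ‖commKer' s P P' y t‖ₑ ≤ ((s + 1) * M).toNNReal * ‖kerT (rlKer (1 - s)) y t‖ₑ :=
    fun y hy t ht => by
    have hsM : 0 ≤ (s + 1) * M := by positivity
    rw [← ofReal_norm, ← ofReal_norm]
    rw [show (((s + 1) * M).toNNReal : ℝ≥0∞) = ENNReal.ofReal ((s + 1) * M) from rfl,
      ← ENNReal.ofReal_mul hsM]
    refine ENNReal.ofReal_le_ofReal ?_
    have hk : 0 ≤ kerT (rlKer (1 - s)) y t := rlKer_nonneg (by linarith) _ _
    rw [Real.norm_of_nonneg hk, commKer']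
    refine (norm_sub_le _ _).trans ?_
    rw [norm_mul, Real.norm_of_nonneg hk, Real.norm_eq_abs, Real.norm_eq_abs]
    have h1 := abs_commKer_le hs0 hs1 hd hM hy ht
    have h2 := mul_le_mul_of_nonneg_left (hM y hy) hk
    nlinarith
  refine (isSchur_rlKer a b (sub_pos.2 hs1)).swap.mono ?_ ?_ ?_
  · exact (measurable_commKer s hP).sub
      (((measurable_rlKer (1 - s)).comp measurable_swap).mul (hP'.measurable.comp measurable_fst))
  · filter_upwards [ae_mem_volIoo a b] with y hy
    filter_upwards [ae_mem_volIoo a b] with t ht using key y hy t ht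
  · filter_upwards [ae_mem_volIoo a b] with t ht
    filter_upwards [ae_mem_volIoo a b] with y hy using key y hy t ht

/-- The primitive of a product. -/
lemma mul_integral_right_eq (hab : a < b) (hP' : Continuous P')
    (hd : ∀ x ∈ Ioo a b, HasDerivAt P (P' x) x) (hM : ∀ x ∈ Ioo a b, |P' x| ≤ M)
    {h : ℝ → ℝ} (hh : MemLp h 2 (volIoo a b)) (hPh : MemLp (fun y => P y * h y) 2 (volIoo a b))
    {x : ℝ} (hx : x ∈ Ioo a b) :
    P x * kerApply (volIoo a b) (kerT (rlKer 1)) h x =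
      kerApply (volIoo a b) (kerT (rlKer 1)) (fun y => P y * h y) x -
        kerApply (volIoo a b) (kerT (rlKer 1))
          (fun y => P' y * kerApply (volIoo a b) (kerT (rlKer 1)) h y) x := by
  have hint := hh.integrable one_le_two
  have hcomp := kerApply_kerApply_of_bound (ν := volIoo a b) (f := h) (x := x)
    (K := fun x y => kerT (rlKer 1) x y * P' y) (L := kerT (rlKer 1))
    (((measurable_rlKer 1).comp (measurable_id.prodMk measurable_const)).mul hP'.measurable)
    ((measurable_rlKer 1).comp measurable_swap) hint (C := M.toNNReal * (b - a).toNNReal) (by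
      refine ae_of_all _ fun t => ?_
      calc ∫⁻ y, ‖kerT (rlKer 1) x y * P' y * kerT (rlKer 1) y t‖ₑ ∂volIoo a b
          ≤ ∫⁻ _, (M.toNNReal : ℝ≥0∞) ∂volIoo a b := by
            refine lintegral_mono_ae ?_
            filter_upwards [ae_mem_volIoo a b] with y hy
            have h1 : ‖P' y‖ₑ ≤ M.toNNReal := by
              rw [← ofReal_norm]; exact ENNReal.ofReal_le_ofReal (hM y hy)
            calc _ = ‖kerT (rlKer 1) x y‖ₑ * ‖P' y‖ₑ * ‖kerT (rlKer 1) y t‖ₑ := by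
                  rw [enorm_mul, enorm_mul]
              _ ≤ 1 * M.toNNReal * 1 := by
                  gcongr
                  · exact enorm_kerT_rlKer_one_le x y
                  · exact enorm_kerT_rlKer_one_le y t
              _ = _ := by simp
        _ = _ := by
          rw [lintegral_const, Measure.restrict_apply_univ, Real.volume_Ioo, ENNReal.coe_mul]; rfl)
  have e1 : kerApply (volIoo a b) (kerT (rlKer 1))
      (fun y => P' y * kerApply (volIoo a b) (kerT (rlKer 1)) h y) x =
      kerApply (volIoo a b) (fun x y => kerT (rlKer 1) x y * P' y)
        (kerApply (volIoo a b) (kerT (rlKer 1)) h) x := by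
    simp only [kerApply, mul_assoc]
  -- Integration by parts in kernel form: the composed kernel integrates `P'` from `x` to `t`.
  have e2 : ∀ t ∈ Ioo a b, ∫ y, kerT (rlKer 1) x y * P' y * kerT (rlKer 1) y t ∂volIoo a b =
      kerT (rlKer 1) x t * (P t - P x) := fun t ht => by
    by_cases hxt : x < t
    · have e : ∀ y, kerT (rlKer 1) x y * P' y * kerT (rlKer 1) y t =
          if x < y then (if y < t then P' y else 0) else 0 := fun y => by
        rw [kerT_rlKer_one, kerT_rlKer_one]
        split_ifs <;> simp
      simp only [e]
      rw [setIntegral_Ioo_ite_gt hx, intervalIntegral.integral_of_le hx.2.le,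
        integral_Ioc_eq_integral_Ioo, setIntegral_Ioo_ite_lt ⟨hxt, ht.2⟩,
        intervalIntegral.integral_eq_sub_of_hasDerivAt (f := P), kerT_rlKer_one, if_pos hxt, one_mul]
      · intro y hy
        rw [uIcc_of_le hxt.le] at hy
        exact hd y ⟨hx.1.trans_le hy.1, hy.2.trans_lt ht.2⟩
      · exact hP'.intervalIntegrable _ _
    · have e : ∀ y, kerT (rlKer 1) x y * P' y * kerT (rlKer 1) y t = 0 := fun y => by
        rw [kerT_rlKer_one, kerT_rlKer_one]
        split_ifs with h1 h2
        · exact absurd (h1.trans h2) hxt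
        all_goals simp
      simp only [e, integral_zero]
      rw [kerT_rlKer_one, if_neg hxt, zero_mul]
  have hI : ∀ f : ℝ → ℝ, MemLp f 2 (volIoo a b) → IntervalIntegrable f volume x b := fun f hf =>
    (((intervalIntegrable_iff_integrableOn_Ioo_of_le hab.le).2 (hf.integrable one_le_two))).mono_set
      (by rw [uIcc_of_le hx.2.le, uIcc_of_le hab.le]; exact Icc_subset_Icc_left hx.1.le)
  have e3 : kerApply (volIoo a b) (fun x t => ∫ y, kerT (rlKer 1) x y * P' y *
      kerT (rlKer 1) y t ∂volIoo a b) h x =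
      kerApply (volIoo a b) (kerT (rlKer 1)) (fun t => P t * h t - P x * h t) x := by
    refine integral_congr_ae ?_
    filter_upwards [ae_mem_volIoo a b] with t ht
    rw [e2 t ht]
    ring
  rw [e1, hcomp, e3, kerApply_kerT_rlKer_one hx, kerApply_kerT_rlKer_one hx,
    kerApply_kerT_rlKer_one hx,
    intervalIntegral.integral_sub (hI _ hPh) ((hI _ hh).const_mul (P x)),
    intervalIntegral.integral_const_mul]
  ring

/-- The right fractional integral of the product of a `C¹` function and a fractional integral. -/
lemma kerApply_mul_eq_primitive (hab : a < b) (hs0 : 0 < s) (hs1 : s < 1) (hP : Continuous P)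
    (hP' : Continuous P') (hd : ∀ x ∈ Ioo a b, HasDerivAt P (P' x) x) (hM0 : 0 ≤ M)
    (hM : ∀ x ∈ Ioo a b, |P' x| ≤ M) {v h : ℝ → ℝ} (hh : MemLp h 2 (volIoo a b))
    (hv : MemLp v 2 (volIoo a b))
    (hPh : MemLp (fun y => P y * h y) 2 (volIoo a b))
    (hvh : v =ᵐ[volIoo a b] kerApply (volIoo a b) (kerT (rlKer s)) h) {x : ℝ} (hx : x ∈ Ioo a b) :
    kerApply (volIoo a b) (kerT (rlKer (1 - s))) (fun t => P t * v t) x =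
      kerApply (volIoo a b) (kerT (rlKer 1))
        (fun y => P y * h y - kerApply (volIoo a b) (commKer s P) v y) x := by
  set ν := volIoo a b with hν
  have hs1' : 0 < 1 - s := by linarith
  have hhi := hh.integrable one_le_two
  have hvi := hv.integrable one_le_two
  have hH : ∀ y ∈ Ioo a b, kerApply ν (kerT (rlKer (1 - s))) v y =
      kerApply ν (kerT (rlKer 1)) h y := fun y hy => by
    rw [kerApply_congr hvh, kerApply_kerT_rlKer_kerT_rlKer hs1' hs0 (by linarith) hy hhi,
      sub_add_cancel]
  have hKv : Integrable (fun t => kerT (rlKer (1 - s)) x t * v t) ν := by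
    refine (integrable_kerT_rlKer_mul hs1' hs0 (by linarith) hx hhi).congr ?_
    filter_upwards [hvh] with t ht using by rw [ht]
  have hSc := isSchur_commKer hs0 hs1 hP hd hM0 hM
  have hSc' := isSchur_commKer' hs0 hs1 hP hP' hd hM0 hM
  have hcomp := kerApply_kerApply_of_bound (ν := ν) (f := v) (x := x)
    (K := kerT (rlKer 1)) (L := commKer' s P P')
    ((measurable_rlKer 1).comp (measurable_id.prodMk measurable_const)) hSc'.meas hvi
    (C := ((s + 1) * M).toNNReal * rlBound a b (1 - s)) (by
      filter_upwards [hSc'.col] with t ht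
      refine le_trans (lintegral_mono fun y => ?_) ht
      rw [enorm_mul]
      exact mul_le_of_le_one_left' (enorm_kerT_rlKer_one_le x y))
  have e1 : kerApply ν (fun x t => ∫ y, kerT (rlKer 1) x y * commKer' s P P' y t ∂ν) v x =
      kerApply ν (fun x t => -(kerT (rlKer (1 - s)) x t * (P t - P x))) v x := by
    refine integral_congr_ae ?_
    filter_upwards [ae_mem_volIoo a b] with t ht
    rw [integral_kerT_rlKer_one_mul_commKer' hs0 hs1 hP hP' hd hM hx ht]
  have e2 : kerApply ν (kerT (rlKer 1)) (kerApply ν (commKer' s P P') v) x =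
      kerApply ν (kerT (rlKer 1)) (fun y => kerApply ν (commKer s P) v y -
        P' y * kerApply ν (kerT (rlKer 1)) h y) x := by
    refine kerApply_congr ?_ x
    filter_upwards [hSc.ae_integrable hv, (isSchur_rlKer a b hs1').swap.ae_integrable hv,
      ae_mem_volIoo a b] with y h1 h2 hy
    rw [← hH y hy]
    simp only [kerApply, commKer', sub_mul]
    rw [← integral_const_mul, ← integral_sub h1 (h2.const_mul _)]
    refine integral_congr_ae (ae_of_all _ fun t => ?_)
    ring
  have hI : ∀ f : ℝ → ℝ, MemLp f 2 ν → IntervalIntegrable f volume x b := fun f hf =>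
    (((intervalIntegrable_iff_integrableOn_Ioo_of_le hab.le).2 (hf.integrable one_le_two))).mono_set
      (by rw [uIcc_of_le hx.2.le, uIcc_of_le hab.le]; exact Icc_subset_Icc_left hx.1.le)
  have hC := hSc.memLp_kerApply hv
  have hHm := (isSchur_rlKer a b one_pos).swap.memLp_kerApply hh
  have hPH : MemLp (fun y => P' y * kerApply ν (kerT (rlKer 1)) h y) 2 ν := by
    refine hHm.of_le_mul (c := M) (hP'.aestronglyMeasurable.mul hHm.1) ?_
    filter_upwards [ae_mem_volIoo a b] with y hy
    rw [norm_mul]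
    exact mul_le_mul_of_nonneg_right (hM y hy) (norm_nonneg _)
  -- This splits `P t = P x + (P t - P x)` under the integral.
  have e3 : kerApply ν (kerT (rlKer (1 - s))) (fun t => P t * v t) x =
      P x * kerApply ν (kerT (rlKer (1 - s))) v x -
      kerApply ν (fun x t => -(kerT (rlKer (1 - s)) x t * (P t - P x))) v x := by
    simp only [kerApply]
    rw [← integral_const_mul, ← integral_sub (hKv.const_mul _)]
    · refine integral_congr_ae (ae_of_all _ fun t => ?_)
      ring
    · refine Integrable.mono' (hKv.norm.const_mul (M * (b - a))) ?_ ?_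
      · exact ((((measurable_rlKer (1 - s)).comp
          (measurable_id.prodMk measurable_const)).mul
          (hP.measurable.sub measurable_const)).neg.aestronglyMeasurable).mul hv.1
      · filter_upwards [ae_mem_volIoo a b] with t ht
        have h1 := abs_sub_le_of_hasDerivAt hd hM hx ht
        have h2 : |t - x| ≤ b - a := by
          rw [abs_le]; constructor <;> linarith [hx.1, hx.2, ht.1, ht.2]
        rw [norm_mul, norm_neg, norm_mul, norm_mul, Real.norm_eq_abs (P t - P x)]
        calc ‖kerT (rlKer (1 - s)) x t‖ * |P t - P x| * ‖v t‖
            = |P t - P x| * (‖kerT (rlKer (1 - s)) x t‖ * ‖v t‖) := by ring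
          _ ≤ (M * (b - a)) * (‖kerT (rlKer (1 - s)) x t‖ * ‖v t‖) := by
            gcongr
            exact h1.trans (by gcongr)
  -- The term with `P'` from differentiating `P · J^1 h` cancels the one contained in `commKer'`,
  -- leaving `P h` minus the commutator.
  rw [e3, hH x hx, mul_integral_right_eq hab hP' hd hM hh hPh hx, ← e1, ← hcomp, e2,
    kerApply_kerT_rlKer_one hx, kerApply_kerT_rlKer_one hx, kerApply_kerT_rlKer_one hx,
    kerApply_kerT_rlKer_one hx, intervalIntegral.integral_sub (hI _ hC) (hI _ hPH),
    intervalIntegral.integral_sub (hI _ hPh) (hI _ hC)]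
  ring

end Multiplication

/-! ### Multiplication operators -/

section MulOp

variable {X : Type*} [MeasurableSpace X] {ν : Measure X}

lemma memLp_mul_of_bound {m : X → ℝ} (hm : AEStronglyMeasurable m ν) {C : ℝ}
    (hC : ∀ᵐ x ∂ν, |m x| ≤ C) (f : Lp ℝ 2 ν) : MemLp (fun x => m x * f x) 2 ν :=
  (Lp.memLp f).of_le_mul (c := C) (hm.mul (Lp.aestronglyMeasurable f)) (hC.mono fun x hx => by
    rw [norm_mul]; exact mul_le_mul_of_nonneg_right hx (norm_nonneg _))

/-- Multiplication by an essentially bounded function. -/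
def mulOp {m : X → ℝ} (hm : AEStronglyMeasurable m ν) {C : ℝ} (hC : ∀ᵐ x ∂ν, |m x| ≤ C) :
    Lp ℝ 2 ν →L[ℝ] Lp ℝ 2 ν :=
  LinearMap.mkContinuous
    { toFun := fun f => (memLp_mul_of_bound hm hC f).toLp
      map_add' := fun f g => by
        rw [← MemLp.toLp_add]
        refine MemLp.toLp_congr _ _ ?_
        filter_upwards [Lp.coeFn_add f g] with x hx
        rw [hx, Pi.add_apply, Pi.add_apply, mul_add]
      map_smul' := fun c f => by
        rw [RingHom.id_apply, ← MemLp.toLp_const_smul]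
        refine MemLp.toLp_congr _ _ ?_
        filter_upwards [Lp.coeFn_smul c f] with x hx
        rw [hx, Pi.smul_apply, Pi.smul_apply, smul_eq_mul, smul_eq_mul, mul_left_comm] }
    C (fun f => by
      refine Lp.norm_le_mul_norm_of_ae_le_mul ?_
      filter_upwards [(memLp_mul_of_bound hm hC f).coeFn_toLp, hC] with x h1 h2
      rw [LinearMap.coe_mk, AddHom.coe_mk, h1, norm_mul]
      exact mul_le_mul_of_nonneg_right h2 (norm_nonneg _))

lemma mulOp_coe {m : X → ℝ} (hm : AEStronglyMeasurable m ν) {C : ℝ} (hC : ∀ᵐ x ∂ν, |m x| ≤ C)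
    (f : Lp ℝ 2 ν) : mulOp hm hC f =ᵐ[ν] fun x => m x * f x :=
  MemLp.coeFn_toLp (memLp_mul_of_bound hm hC f)

lemma norm_mulOp_le {m : X → ℝ} (hm : AEStronglyMeasurable m ν) {C : ℝ} (hC : ∀ᵐ x ∂ν, |m x| ≤ C)
    (f : Lp ℝ 2 ν) : ‖mulOp hm hC f‖ ≤ C * ‖f‖ := by
  refine Lp.norm_le_mul_norm_of_ae_le_mul ?_
  filter_upwards [mulOp_coe hm hC f, hC] with x h1 h2
  rw [h1, norm_mul]
  exact mul_le_mul_of_nonneg_right h2 (norm_nonneg _)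

end MulOp

/-! ### The semigroup law on `L²` -/

section Semigroup

variable {a b : ℝ}

/-- Equal primitives have equal derivatives; the derivative of order `τ = 0` of `f` is the common
middle term. -/
lemma ae_eq_of_kerApply_rlKer_one_eq (hab : a < b) {f g : ℝ → ℝ} (hf : MemLp f 2 (volIoo a b))
    (hg : MemLp g 2 (volIoo a b))
    (h : ∀ x ∈ Ioo a b, kerApply (volIoo a b) (rlKer 1) f x = kerApply (volIoo a b) (rlKer 1) g x) :
    f =ᵐ[volIoo a b] g := by
  have h1 := (leftRLDeriv_of_primitive (τ := 0) (w := f) hab hf fun x hx => by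
    rw [leftRLInt_eq_kerApply hx, sub_zero]).2
  have h2 := (leftRLDeriv_of_primitive (τ := 0) (w := f) hab hg fun x hx => by
    rw [leftRLInt_eq_kerApply hx, sub_zero, h x hx]).2
  exact h1.symm.trans h2

/-- The sum `σ + τ` may be below one, where pointwise composition is not available. A further
integral of order one lifts all compositions above that threshold and is cancelled at the end. -/
lemma leftOp_leftOp (hab : a < b) {σ τ : ℝ} (hσ : 0 < σ) (hτ : 0 < τ) (f : L2Ioo a b) :
    leftOp a b hσ (leftOp a b hτ f) = leftOp a b (add_pos hσ hτ) f := by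
  apply Lp.ext
  refine ae_eq_of_kerApply_rlKer_one_eq hab (Lp.memLp _) (Lp.memLp _) fun x hx => ?_
  have hf := (Lp.memLp f).integrable one_le_two
  have hf2 := (Lp.memLp (leftOp a b hτ f)).integrable one_le_two
  rw [kerApply_congr (leftOp_coe hσ _), kerApply_congr (leftOp_coe _ f),
    kerApply_rlKer_rlKer one_pos hσ (by linarith) hx hf2, kerApply_congr (leftOp_coe hτ f),
    kerApply_rlKer_rlKer (by linarith) hτ (by linarith) hx hf,
    kerApply_rlKer_rlKer one_pos (by linarith) (by linarith) hx hf, add_assoc]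

end Semigroup

/-! ### The bilinear form -/

/-- The coefficients of the bilinear form and their bounds. -/
structure FormCoeff (a b : ℝ) where
  /-- The coefficient of the derivatives of order `μ`. -/
  κ : ℝ → ℝ
  /-- The coefficient of the function. -/
  θ : ℝ → ℝ
  /-- The coefficient inside the fractional derivative. -/
  P : ℝ → ℝ
  /-- The derivative of `P`. -/
  P' : ℝ → ℝ
  /-- The bound of `κ`. -/
  L : ℝ
  /-- The bound of `θ`. -/
  Q : ℝ
  /-- The bound of `P`. -/
  N : ℝ
  /-- The bound of `P'`. -/
  M : ℝ
  κ_meas : AEStronglyMeasurable κ (volIoo a b)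
  κ_le : ∀ᵐ x ∂volIoo a b, |κ x| ≤ L
  θ_meas : AEStronglyMeasurable θ (volIoo a b)
  θ_le : ∀ᵐ x ∂volIoo a b, |θ x| ≤ Q
  P_cont : Continuous P
  P'_cont : Continuous P'
  P_deriv : ∀ x ∈ Ioo a b, HasDerivAt P (P' x) x
  P_le : ∀ x ∈ Ioo a b, |P x| ≤ N
  P'_le : ∀ x ∈ Ioo a b, |P' x| ≤ M
  L_nonneg : 0 ≤ L
  Q_nonneg : 0 ≤ Q
  N_nonneg : 0 ≤ N
  M_nonneg : 0 ≤ M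

namespace FormCoeff

variable {a b s : ℝ} (c : FormCoeff a b)

lemma P_ae : ∀ᵐ x ∂volIoo a b, |c.P x| ≤ c.N := (ae_mem_volIoo a b).mono c.P_le

lemma P'_ae : ∀ᵐ x ∂volIoo a b, |c.P' x| ≤ c.M := (ae_mem_volIoo a b).mono c.P'_le

/-- Multiplication by `κ`. -/
def mulκ : L2Ioo a b →L[ℝ] L2Ioo a b := mulOp c.κ_meas c.κ_le

/-- Multiplication by `θ`. -/
def mulθ : L2Ioo a b →L[ℝ] L2Ioo a b := mulOp c.θ_meas c.θ_le

/-- Multiplication by `P`. -/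
def mulP : L2Ioo a b →L[ℝ] L2Ioo a b := mulOp c.P_cont.aestronglyMeasurable c.P_ae

/-- Multiplication by `P'`. -/
def mulP' : L2Ioo a b →L[ℝ] L2Ioo a b := mulOp c.P'_cont.aestronglyMeasurable c.P'_ae

variable (hab : a < b) (hs0 : 0 < s) (hs1 : s < 1)

/-- The commutator of the right fractional derivative and the multiplication by `P`. -/
def commOp : L2Ioo a b →L[ℝ] L2Ioo a b :=
  schurOp (isSchur_commKer hs0 hs1 c.P_cont c.P_deriv c.M_nonneg c.P'_le)

/-- The right fractional derivative of order `s` of `P v`. -/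
def derivMul : HsZero s a b →ₗ[ℝ] L2Ioo a b :=
  (c.mulP : L2Ioo a b →ₗ[ℝ] L2Ioo a b) ∘ₗ derivR hab hs0 hs1 -
    (c.commOp hs0 hs1 : L2Ioo a b →ₗ[ℝ] L2Ioo a b) ∘ₗ (HsZero s a b).subtype

lemma derivMul_apply (v : HsZero s a b) :
    c.derivMul hab hs0 hs1 v = c.mulP (derivR hab hs0 hs1 v) - c.commOp hs0 hs1 v := rfl

lemma rightRLInt_mul_eq (v : HsZero s a b) {x : ℝ} (hx : x ∈ Ioo a b) :
    kerApply (volIoo a b) (kerT (rlKer (1 - s))) (fun t => c.P t * (v : L2Ioo a b) t) x =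
      kerApply (volIoo a b) (kerT (rlKer 1)) (c.derivMul hab hs0 hs1 v) x := by
  have hv := rightOp_coe hs0 (derivR hab hs0 hs1 v)
  rw [rightOp_derivR] at hv
  have hPh : MemLp (fun y => c.P y * derivR hab hs0 hs1 v y) 2 (volIoo a b) :=
    (Lp.memLp (c.mulP (derivR hab hs0 hs1 v))).ae_eq (mulOp_coe _ _ _)
  rw [kerApply_mul_eq_primitive hab hs0 hs1 c.P_cont c.P'_cont c.P_deriv c.M_nonneg c.P'_le
    (Lp.memLp (derivR hab hs0 hs1 v)) (Lp.memLp (v : L2Ioo a b)) hPh hv hx]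
  refine kerApply_congr ?_ x
  rw [derivMul_apply]
  filter_upwards [Lp.coeFn_sub (c.mulP (derivR hab hs0 hs1 v)) (c.commOp hs0 hs1 v),
    mulOp_coe c.P_cont.aestronglyMeasurable c.P_ae (derivR hab hs0 hs1 v),
    schurOp_coe (isSchur_commKer hs0 hs1 c.P_cont c.P_deriv c.M_nonneg c.P'_le)
      (v : L2Ioo a b)] with y h1 h2 h3
  rw [h1, Pi.sub_apply, mulP, commOp, h2, h3]

/-- The fractional integral of the derivative of `P v` is `P v`. -/
lemma rightOp_derivMul (v : HsZero s a b) :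
    rightOp a b hs0 (c.derivMul hab hs0 hs1 v) = c.mulP v := by
  have hs1' : 0 < 1 - s := by linarith
  -- After a further integral of order `1 - s` the total order is one, so the pointwise identity for
  -- `P v` applies.
  refine rightOp_injective hab hs1' (by linarith) ?_
  apply Lp.ext
  refine (rightOp_coe hs1' _).trans (EventuallyEq.trans ?_ (rightOp_coe hs1' _).symm)
  filter_upwards [ae_mem_volIoo a b] with x hx
  rw [kerApply_congr (rightOp_coe hs0 _), kerApply_kerT_rlKer_kerT_rlKer hs1' hs0 (by linarith) hx
    ((Lp.memLp _).integrable one_le_two), sub_add_cancel, ← c.rightRLInt_mul_eq hab hs0 hs1 v hx]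
  exact (kerApply_congr (mulOp_coe _ _ _) x).symm

lemma norm_derivMul_le (v : HsZero s a b) : ‖c.derivMul hab hs0 hs1 v‖ ≤
    (c.N + (s * c.M).toNNReal * rlBound a b (1 - s)) * hsZeroNorm v := by
  rw [derivMul_apply, add_mul]
  refine (norm_sub_le _ _).trans (add_le_add ?_ ?_)
  · refine (norm_mulOp_le _ _ _).trans (mul_le_mul_of_nonneg_left ?_ c.N_nonneg)
    exact (norm_derivR_le hab hs0 hs1 v).trans (hsSemi_le_hsZeroNorm v)
  · refine (norm_schurOp_le _ _).trans ?_
    rw [NNReal.coe_mul]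
    exact mul_le_mul_of_nonneg_left (norm_le_hsZeroNorm v) (by positivity)

/-- The bilinear form. -/
def form (hμ : 0 < 2 * s - 1) (α β : ℝ) : LinearMap.BilinForm ℝ (HsZero s a b) :=
  -α • (innerₗ (L2Ioo a b)).compl₁₂ (derivL hab hs0 hs1) (derivR hab hs0 hs1)
  - β • (innerₗ (L2Ioo a b)).compl₁₂ (derivR hab hs0 hs1) (derivL hab hs0 hs1)
  - α • (innerₗ (L2Ioo a b)).compl₁₂
      ((c.mulκ ∘L leftOp a b (sub_pos.2 hs1) : L2Ioo a b →ₗ[ℝ] L2Ioo a b) ∘ₗ derivL hab hs0 hs1)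
      (HsZero s a b).subtype
  + β • (innerₗ (L2Ioo a b)).compl₁₂
      ((c.mulκ ∘L rightOp a b (sub_pos.2 hs1) : L2Ioo a b →ₗ[ℝ] L2Ioo a b) ∘ₗ derivR hab hs0 hs1)
      (HsZero s a b).subtype
  + (innerₗ (L2Ioo a b)).compl₁₂
      ((leftOp a b hμ : L2Ioo a b →ₗ[ℝ] L2Ioo a b) ∘ₗ derivL hab hs0 hs1)
      (c.derivMul hab hs0 hs1)
  + (innerₗ (L2Ioo a b)).compl₁₂
      ((c.mulθ : L2Ioo a b →ₗ[ℝ] L2Ioo a b) ∘ₗ (HsZero s a b).subtype) (HsZero s a b).subtype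

lemma form_apply (hμ : 0 < 2 * s - 1) (α β : ℝ) (u v : HsZero s a b) :
    c.form hab hs0 hs1 hμ α β u v =
      -α * inner ℝ (derivL hab hs0 hs1 u) (derivR hab hs0 hs1 v)
      - β * inner ℝ (derivR hab hs0 hs1 u) (derivL hab hs0 hs1 v)
      - α * inner ℝ (c.mulκ (leftOp a b (sub_pos.2 hs1) (derivL hab hs0 hs1 u))) (v : L2Ioo a b)
      + β * inner ℝ (c.mulκ (rightOp a b (sub_pos.2 hs1) (derivR hab hs0 hs1 u))) (v : L2Ioo a b)
      + inner ℝ (leftOp a b hμ (derivL hab hs0 hs1 u)) (c.derivMul hab hs0 hs1 v)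
      + inner ℝ (c.mulθ u) (v : L2Ioo a b) := rfl

lemma abs_inner_le {x y : L2Ioo a b} {A B X Y : ℝ} (hx : ‖x‖ ≤ A * X) (hy : ‖y‖ ≤ B * Y) :
    |inner ℝ x y| ≤ A * B * (X * Y) := by
  refine (abs_real_inner_le_norm x y).trans ?_
  calc ‖x‖ * ‖y‖ ≤ (A * X) * (B * Y) :=
        mul_le_mul hx hy (norm_nonneg _) ((norm_nonneg _).trans hx)
    _ = _ := by ring

/-- The bilinear form is bounded. -/
lemma exists_form_bound (hμ : 0 < 2 * s - 1) (α β : ℝ) : ∃ C : ℝ, 0 < C ∧ ∀ u v : HsZero s a b,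
    |c.form hab hs0 hs1 hμ α β u v| ≤ C * hsZeroNorm u * hsZeroNorm v := by
  set D := c.N + (s * c.M).toNNReal * rlBound a b (1 - s)
  set R := (rlBound a b (1 - s) : ℝ)
  refine ⟨|α| * 1 + |β| * 1 + |α| * (c.L * R) + |β| * (c.L * R) + rlBound a b (2 * s - 1) * D +
    c.Q + 1, ?_, fun u v => ?_⟩
  · have := c.L_nonneg
    have := c.Q_nonneg
    have := c.N_nonneg
    positivity
  have hL : ∀ w : HsZero s a b, ‖derivL hab hs0 hs1 w‖ ≤ 1 * hsZeroNorm w := fun w => by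
    rw [one_mul]; exact (norm_derivL_le hab hs0 hs1 w).trans (hsSemi_le_hsZeroNorm w)
  have hR : ∀ w : HsZero s a b, ‖derivR hab hs0 hs1 w‖ ≤ 1 * hsZeroNorm w := fun w => by
    rw [one_mul]; exact (norm_derivR_le hab hs0 hs1 w).trans (hsSemi_le_hsZeroNorm w)
  have hI : ∀ w : HsZero s a b, ‖(w : L2Ioo a b)‖ ≤ 1 * hsZeroNorm w := fun w => by
    rw [one_mul]; exact norm_le_hsZeroNorm w
  have h3 : ‖c.mulκ (leftOp a b (sub_pos.2 hs1) (derivL hab hs0 hs1 u))‖ ≤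
      c.L * R * hsZeroNorm u := by
    refine (norm_mulOp_le _ _ _).trans ?_
    rw [mul_assoc]
    refine mul_le_mul_of_nonneg_left ((norm_schurOp_le _ _).trans ?_) c.L_nonneg
    exact mul_le_mul_of_nonneg_left ((hL u).trans_eq (one_mul _)) (NNReal.coe_nonneg _)
  have h4 : ‖c.mulκ (rightOp a b (sub_pos.2 hs1) (derivR hab hs0 hs1 u))‖ ≤
      c.L * R * hsZeroNorm u := by
    refine (norm_mulOp_le _ _ _).trans ?_
    rw [mul_assoc]
    refine mul_le_mul_of_nonneg_left ((norm_schurOp_le _ _).trans ?_) c.L_nonneg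
    exact mul_le_mul_of_nonneg_left ((hR u).trans_eq (one_mul _)) (NNReal.coe_nonneg _)
  have h5 : ‖leftOp a b hμ (derivL hab hs0 hs1 u)‖ ≤
      rlBound a b (2 * s - 1) * hsZeroNorm u :=
    (norm_schurOp_le _ _).trans
      (mul_le_mul_of_nonneg_left ((hL u).trans_eq (one_mul _)) (NNReal.coe_nonneg _))
  have h6 : ‖c.mulθ u‖ ≤ c.Q * hsZeroNorm u :=
    (norm_mulOp_le _ _ _).trans (mul_le_mul_of_nonneg_left (norm_le_hsZeroNorm u) c.Q_nonneg)
  have b1 := abs_inner_le (hL u) (hR v)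
  have b2 := abs_inner_le (hR u) (hL v)
  have b3 := abs_inner_le h3 (hI v)
  have b4 := abs_inner_le h4 (hI v)
  have b5 := abs_inner_le h5 (c.norm_derivMul_le hab hs0 hs1 v)
  have b6 := abs_inner_le h6 (hI v)
  rw [form_apply]
  have hnn : 0 ≤ hsZeroNorm u * hsZeroNorm v :=
    mul_nonneg (hsZeroNorm_nonneg u) (hsZeroNorm_nonneg v)
  have habs : ∀ x1 x2 x3 x4 x5 x6 : ℝ, |-α * x1 - β * x2 - α * x3 + β * x4 + x5 + x6| ≤
      |α| * |x1| + |β| * |x2| + |α| * |x3| + |β| * |x4| + |x5| + |x6| := by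
    intro x1 x2 x3 x4 x5 x6
    rw [← abs_mul, ← abs_mul, ← abs_mul, ← abs_mul]
    refine abs_le.2 ⟨?_, ?_⟩ <;>
    linarith [neg_abs_le (α * x1), le_abs_self (α * x1), neg_abs_le (β * x2), le_abs_self (β * x2),
      neg_abs_le (α * x3), le_abs_self (α * x3), neg_abs_le (β * x4), le_abs_self (β * x4),
      neg_abs_le x5, le_abs_self x5, neg_abs_le x6, le_abs_self x6]
  refine (habs _ _ _ _ _ _).trans ?_
  have m1 := mul_le_mul_of_nonneg_left b1 (abs_nonneg α)
  have m2 := mul_le_mul_of_nonneg_left b2 (abs_nonneg β)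
  have m3 := mul_le_mul_of_nonneg_left b3 (abs_nonneg α)
  have m4 := mul_le_mul_of_nonneg_left b4 (abs_nonneg β)
  rw [mul_assoc]
  nlinarith

/-- The identity `(D^{1-s} φ, D_b^s (P φ)) = -½ (P' φ, φ)` for test functions. -/
lemma inner_derivMul_test (hμ : 0 < 2 * s - 1) {u : HsZero s a b} (hu : IsTest (u : L2Ioo a b)) :
    inner ℝ (leftOp a b hμ (derivL hab hs0 hs1 u)) (c.derivMul hab hs0 hs1 u) =
      -(1 / 2) * inner ℝ (c.mulP' u) (u : L2Ioo a b) := by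
  obtain ⟨ψ, h1, h2, h3, h4⟩ := hu
  have hs1' : 0 < 1 - s := by linarith
  have hmem := memLp_deriv_test (a := a) (b := b) h1 h2
  have hD : derivL hab hs0 hs1 u = leftOp a b hs1' hmem.toLp :=
    leftOp_injective hab hs0 hs1 (by
      rw [leftOp_derivL, leftOp_toLp_deriv hs0 hs1' h1 h2 h3 h4])
  -- The orders add up as `(2s - 1) + (1 - s) = s`. Transposing `I^s` then turns the derivative of
  -- `P ψ` back into `P ψ`, and only `∫ ψ' P ψ` remains.
  have hT : leftOp a b hμ (derivL hab hs0 hs1 u) = leftOp a b hs0 hmem.toLp := by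
    rw [hD, leftOp_leftOp hab]
    congr 1
    simp only [show 2 * s - 1 + (1 - s) = s by ring]
  rw [hT, leftOp, inner_schurOp]
  change inner ℝ _ (rightOp a b hs0 (c.derivMul hab hs0 hs1 u)) = _
  rw [c.rightOp_derivMul hab hs0 hs1, inner_L2_eq, inner_L2_eq]
  have hψ : Continuous ψ := h1.continuous
  have hψ' : Continuous (deriv ψ) := (contDiff_deriv_of_contDiff h1).continuous
  have e1 : ∫ x, (hmem.toLp : L2Ioo a b) x * c.mulP u x ∂volIoo a b =
      ∫ x in a..b, deriv ψ x * (c.P x * ψ x) := by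
    rw [intervalIntegral.integral_of_le hab.le, integral_Ioc_eq_integral_Ioo]
    refine integral_congr_ae ?_
    filter_upwards [hmem.coeFn_toLp, mulOp_coe c.P_cont.aestronglyMeasurable c.P_ae
      (u : L2Ioo a b), h4] with x e1 e2 e3
    rw [e1, mulP, e2, e3]
  have e2 : ∫ x, c.mulP' u x * (u : L2Ioo a b) x ∂volIoo a b =
      ∫ x in a..b, c.P' x * ψ x * ψ x := by
    rw [intervalIntegral.integral_of_le hab.le, integral_Ioc_eq_integral_Ioo]
    refine integral_congr_ae ?_
    filter_upwards [mulOp_coe c.P'_cont.aestronglyMeasurable c.P'_ae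
      (u : L2Ioo a b), h4] with x e2 e3
    rw [mulP', e2, e3]
  have hP := c.P_cont
  have hP' := c.P'_cont
  have i1 : IntervalIntegrable (fun x => c.P' x * ψ x * ψ x) volume a b :=
    Continuous.intervalIntegrable (by fun_prop) _ _
  have i2 : IntervalIntegrable (fun x => 2 * (deriv ψ x * (c.P x * ψ x))) volume a b :=
    Continuous.intervalIntegrable (by fun_prop) _ _
  -- The integrand is the derivative of `P ψ²`, which vanishes at both endpoints.
  have e3 : ∫ x in a..b, (c.P' x * ψ x * ψ x + 2 * (deriv ψ x * (c.P x * ψ x))) = 0 := by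
    rw [intervalIntegral.integral_eq_sub_of_hasDerivAt_of_le (f := fun x => c.P x * ψ x * ψ x)
      hab.le (Continuous.continuousOn (by fun_prop)) _ (i1.add i2)]
    · simp [eq_zero_of_tsupport h3 b (by simp), eq_zero_of_tsupport h3 a (by simp)]
    · intro x hx
      have hd := (h1.differentiable (by simp)).differentiableAt.hasDerivAt (x := x)
      have := ((c.P_deriv x hx).mul hd).mul hd
      convert! this using 1
      simp only [Pi.mul_apply]
      ring
  rw [intervalIntegral.integral_add i1 i2, intervalIntegral.integral_const_mul] at e3
  rw [e1, e2]
  linarith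

/-- The identity `(D^{1-s} u, D_b^s (P u)) = -½ (P' u, u)`. -/
lemma inner_derivMul (hμ : 0 < 2 * s - 1) (u : HsZero s a b) :
    inner ℝ (leftOp a b hμ (derivL hab hs0 hs1 u)) (c.derivMul hab hs0 hs1 u) =
      -(1 / 2) * inner ℝ (c.mulP' u) (u : L2Ioo a b) := by
  obtain ⟨φ, hφ, hlim⟩ := exists_test_seq hs0.le hs1.le u
  have hu := tendsto_of_tendsto_hsZeroNorm hlim
  have hD : Tendsto (fun n => derivL hab hs0 hs1 (φ n)) atTop (𝓝 (derivL hab hs0 hs1 u)) := by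
    rw [tendsto_iff_norm_sub_tendsto_zero]
    refine squeeze_zero (fun n => norm_nonneg _) (fun n => ?_) hlim
    rw [← map_sub]
    exact (norm_derivL_le hab hs0 hs1 _).trans (hsSemi_le_hsZeroNorm _)
  have hM : Tendsto (fun n => c.derivMul hab hs0 hs1 (φ n)) atTop
      (𝓝 (c.derivMul hab hs0 hs1 u)) := by
    rw [tendsto_iff_norm_sub_tendsto_zero]
    have hlim' := hlim.const_mul (c.N + (s * c.M).toNNReal * rlBound a b (1 - s))
    rw [mul_zero] at hlim'
    refine squeeze_zero (fun n => norm_nonneg _) (fun n => ?_) hlim'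
    rw [← map_sub]
    exact c.norm_derivMul_le hab hs0 hs1 _
  refine tendsto_nhds_unique
    ((((leftOp a b hμ).continuous.tendsto _).comp hD).inner hM) ?_
  have h2 := (((c.mulP'.continuous.tendsto _).comp hu).inner hu).const_mul (-(1 / 2) : ℝ)
  exact h2.congr fun n => (c.inner_derivMul_test hab hs0 hs1 hμ (hφ n)).symm

/-- By `inner_derivMul` the sum is the integral of `(θ - P'/2) u²`; this is where the sign condition
on the coefficients enters. -/
lemma lower_terms_nonneg (hμ : 0 < 2 * s - 1)
    (hθ : ∀ x ∈ Ioo a b, 0 ≤ c.θ x - 1 / 2 * c.P' x) (u : HsZero s a b) :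
    0 ≤ inner ℝ (leftOp a b hμ (derivL hab hs0 hs1 u)) (c.derivMul hab hs0 hs1 u) +
      inner ℝ (c.mulθ u) (u : L2Ioo a b) := by
  rw [inner_derivMul, ← real_inner_smul_left, ← inner_add_left, inner_L2_eq]
  refine integral_nonneg_of_ae ?_
  filter_upwards [Lp.coeFn_add ((-(1 / 2) : ℝ) • c.mulP' u) (c.mulθ u),
    Lp.coeFn_smul (-(1 / 2) : ℝ) (c.mulP' u),
    mulOp_coe c.P'_cont.aestronglyMeasurable c.P'_ae (u : L2Ioo a b),
    mulOp_coe c.θ_meas c.θ_le (u : L2Ioo a b), ae_mem_volIoo a b] with x h1 h2 h3 h4 hx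
  rw [h1, Pi.add_apply, h2, Pi.smul_apply, mulP', h3, mulθ, h4, smul_eq_mul]
  have := mul_nonneg (hθ x hx) (mul_self_nonneg ((u : L2Ioo a b) x))
  simp only [Pi.zero_apply]
  linarith

/-- The bilinear form is coercive with respect to the semi-norm. -/
lemma form_coercive_semi (hμ : 0 < 2 * s - 1) {α β : ℝ} (hα : 0 ≤ α) (hβ : 0 ≤ β)
    (hαβ : α + β = 1) (hθ : ∀ x ∈ Ioo a b, 0 ≤ c.θ x - 1 / 2 * c.P' x) (u : HsZero s a b) :
    (-Real.cos (Real.pi * s) - c.L * (rlBound a b (1 - s) * rlBound a b s)) * hsSemi a b s u ^ 2 ≤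
      c.form hab hs0 hs1 hμ α β u u := by
  set N := hsSemi a b s u with hN
  have hu : ‖(u : L2Ioo a b)‖ ≤ rlBound a b s * N :=
    (norm_le_rlBound_mul_derivL hab hs0 hs1 u).trans
      (mul_le_mul_of_nonneg_left (norm_derivL_le hab hs0 hs1 u) (NNReal.coe_nonneg _))
  have h3 : ‖c.mulκ (leftOp a b (sub_pos.2 hs1) (derivL hab hs0 hs1 u))‖ ≤
      c.L * rlBound a b (1 - s) * N := by
    refine (norm_mulOp_le _ _ _).trans ?_
    rw [mul_assoc]
    refine mul_le_mul_of_nonneg_left ((norm_schurOp_le _ _).trans ?_) c.L_nonneg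
    exact mul_le_mul_of_nonneg_left (norm_derivL_le hab hs0 hs1 u) (NNReal.coe_nonneg _)
  have h4 : ‖c.mulκ (rightOp a b (sub_pos.2 hs1) (derivR hab hs0 hs1 u))‖ ≤
      c.L * rlBound a b (1 - s) * N := by
    refine (norm_mulOp_le _ _ _).trans ?_
    rw [mul_assoc]
    refine mul_le_mul_of_nonneg_left ((norm_schurOp_le _ _).trans ?_) c.L_nonneg
    exact mul_le_mul_of_nonneg_left (norm_derivR_le hab hs0 hs1 u) (NNReal.coe_nonneg _)
  have b3 := abs_le.1 (abs_inner_le h3 hu)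
  have b4 := abs_le.1 (abs_inner_le h4 hu)
  have h56 := c.lower_terms_nonneg hab hs0 hs1 hμ hθ u
  have hLR := inner_derivL_derivR hab hs0 hs1 u
  -- Both leading inner products become `cos(πs) |u|_s²`. Since `α + β = 1`, the weights disappear
  -- from the main term and from the total loss in the terms with `κ`.
  rw [form_apply, real_inner_comm (derivL hab hs0 hs1 u) (derivR hab hs0 hs1 u), hLR, ← hN]
  have m3 := mul_le_mul_of_nonneg_left b3.2 hα
  have m4 := mul_le_mul_of_nonneg_left b4.1 hβ
  have e : β = 1 - α := by linarith
  subst e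
  nlinarith

end FormCoeff


/-! ### The fractional derivatives of elements of the Sobolev space -/

section Identify

variable {a b s : ℝ} (hab : a < b) (hs0 : 0 < s) (hs1 : s < 1)

lemma pairing_eq_inner {F G : ℝ → ℝ} {f g : L2Ioo a b} (hF : F =ᵐ[volIoo a b] f)
    (hG : G =ᵐ[volIoo a b] g) : pairing a b F G = inner ℝ f g := by
  rw [inner_L2_eq]
  refine integral_congr_ae ?_
  filter_upwards [hF, hG] with x h1 h2
  rw [h1, h2]

lemma coe_ae_eq_leftOp_derivL (u : HsZero s a b) :
    (u : L2Ioo a b) =ᵐ[volIoo a b] kerApply (volIoo a b) (rlKer s) (derivL hab hs0 hs1 u) := by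
  have h := leftOp_coe hs0 (derivL hab hs0 hs1 u)
  rwa [leftOp_derivL] at h

lemma coe_ae_eq_rightOp_derivR (u : HsZero s a b) : (u : L2Ioo a b) =ᵐ[volIoo a b]
    kerApply (volIoo a b) (kerT (rlKer s)) (derivR hab hs0 hs1 u) := by
  have h := rightOp_coe hs0 (derivR hab hs0 hs1 u)
  rwa [rightOp_derivR] at h

lemma leftRLDeriv_hsZero (u : HsZero s a b) : LeftRLDerivInL2 a b s (u : L2Ioo a b) ∧
    leftRLDeriv a s (u : L2Ioo a b) =ᵐ[volIoo a b] derivL hab hs0 hs1 u :=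
  leftRLDeriv_of_rep hab hs0 hs1 (Lp.memLp _) (coe_ae_eq_leftOp_derivL hab hs0 hs1 u)

lemma rightRLDeriv_hsZero (u : HsZero s a b) : RightRLDerivInL2 a b s (u : L2Ioo a b) ∧
    rightRLDeriv b s (u : L2Ioo a b) =ᵐ[volIoo a b] derivR hab hs0 hs1 u :=
  rightRLDeriv_of_rep hab hs0 hs1 (Lp.memLp _) (coe_ae_eq_rightOp_derivR hab hs0 hs1 u)

/-- The form uses the integration orders `1 - s` and `2s - 1`. Taking `σ` with an equation, instead
of `s - τ`, lets the operator match the one in the form directly. -/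
lemma leftRLDeriv_hsZero_of_add_eq {σ τ : ℝ} (hσ : 0 < σ) (h : σ + τ = s) (u : HsZero s a b) :
    LeftRLDerivInL2 a b τ (u : L2Ioo a b) ∧
      leftRLDeriv a τ (u : L2Ioo a b) =ᵐ[volIoo a b] leftOp a b hσ (derivL hab hs0 hs1 u) := by
  have h1 := leftRLDeriv_of_rep_lt (τ := τ) hab hs0 (by linarith) (by linarith) (Lp.memLp _)
    (coe_ae_eq_leftOp_derivL hab hs0 hs1 u)
  rw [show s - τ = σ by linarith] at h1
  exact ⟨h1.1, h1.2.trans (leftOp_coe hσ _).symm⟩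

lemma rightRLDeriv_hsZero_of_add_eq {σ τ : ℝ} (hσ : 0 < σ) (h : σ + τ = s) (u : HsZero s a b) :
    RightRLDerivInL2 a b τ (u : L2Ioo a b) ∧
      rightRLDeriv b τ (u : L2Ioo a b) =ᵐ[volIoo a b] rightOp a b hσ (derivR hab hs0 hs1 u) := by
  have h1 := rightRLDeriv_of_rep_lt (τ := τ) hab hs0 (by linarith) (by linarith) (Lp.memLp _)
    (coe_ae_eq_rightOp_derivR hab hs0 hs1 u)
  rw [show s - τ = σ by linarith] at h1
  exact ⟨h1.1, h1.2.trans (rightOp_coe hσ _).symm⟩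

/-- The coefficient `P` needs to agree with `c.P` only inside the interval, since `c.P` is an
extension to the whole line. -/
lemma FormCoeff.rightRLDeriv_mul (c : FormCoeff a b) {P : ℝ → ℝ} (hP : ∀ x ∈ Ioo a b, P x = c.P x)
    (v : HsZero s a b) : RightRLDerivInL2 a b s (fun x => P x * (v : L2Ioo a b) x) ∧
    rightRLDeriv b s (fun x => P x * (v : L2Ioo a b) x) =ᵐ[volIoo a b]
      c.derivMul hab hs0 hs1 v := by
  refine rightRLDeriv_of_primitive hab (Lp.memLp _) fun x hx => ?_
  rw [rightRLInt_eq_kerApply hx, ← c.rightRLInt_mul_eq hab hs0 hs1 v hx]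
  refine kerApply_congr ?_ x
  filter_upwards [ae_mem_volIoo a b] with t ht
  rw [hP t ht]

end Identify

/-! ### The coefficients of the differential equation -/

section Coefficients

variable {a b μ : ℝ} {p q k : ℝ → ℝ}

/-- Compactness supplies the bounds `Q`, `N` and `M`, whose size is irrelevant. `L` has to be the
essential supremum itself, because that number enters the smallness hypothesis. -/
lemma exists_formCoeff (hab : a < b) (hp : ContDiffOn ℝ 1 p (Icc a b))
    (hq : ContinuousOn q (Icc a b)) (hk : ContDiffOn ℝ 1 k (Icc a b))
    (hkpos : ∀ x ∈ Icc a b, 0 < k x) :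
    ∃ c : FormCoeff a b,
      (∀ x ∈ Ioo a b, derivWithin k (Icc a b) x / k x = c.κ x) ∧
      (∀ x ∈ Ioo a b, q x / k x = c.θ x) ∧ (∀ x ∈ Ioo a b, p x / k x = c.P x) ∧
      (∀ x ∈ Ioo a b, derivWithin (fun y => p y / k y) (Icc a b) x = c.P' x) ∧
      c.L = (eLpNorm (fun x => derivWithin k (Icc a b) x / k x) ⊤ (volIoo a b)).toReal := by
  have hu : UniqueDiffOn ℝ (Icc a b) := uniqueDiffOn_Icc hab
  have hk0 : ∀ x ∈ Icc a b, k x ≠ 0 := fun x hx => (hkpos x hx).ne'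
  have hpk : ContDiffOn ℝ 1 (fun y => p y / k y) (Icc a b) := hp.div hk hk0
  have hκ : ContinuousOn (fun x => derivWithin k (Icc a b) x / k x) (Icc a b) :=
    (hk.continuousOn_derivWithin hu le_rfl).div hk.continuousOn hk0
  have hθ : ContinuousOn (fun x => q x / k x) (Icc a b) := hq.div hk.continuousOn hk0
  have hP' : ContinuousOn (derivWithin (fun y => p y / k y) (Icc a b)) (Icc a b) :=
    hpk.continuousOn_derivWithin hu le_rfl
  have hmeas : ∀ {f : ℝ → ℝ}, ContinuousOn f (Icc a b) → AEStronglyMeasurable f (volIoo a b) :=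
    fun hf => (hf.mono Ioo_subset_Icc_self).aestronglyMeasurable measurableSet_Ioo
  have hbd : ∀ {f : ℝ → ℝ}, ContinuousOn f (Icc a b) → ∃ C, 0 ≤ C ∧ ∀ x ∈ Ioo a b, |f x| ≤ C :=
    fun hf => by
      obtain ⟨C, hC⟩ := isCompact_Icc.exists_bound_of_continuousOn hf
      exact ⟨C, (norm_nonneg _).trans (hC a (left_mem_Icc.2 hab.le)),
        fun x hx => hC x (Ioo_subset_Icc_self hx)⟩
  obtain ⟨K, -, hK⟩ := hbd hκ
  obtain ⟨Q, hQ0, hQ⟩ := hbd hθ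
  obtain ⟨N, hN0, hN⟩ := hbd hpk.continuousOn
  obtain ⟨M, hM0, hM⟩ := hbd hP'
  -- Extension by the endpoint values keeps continuity on the line; differentiability is asked for
  -- only inside the interval.
  have hext : ∀ (f : ℝ → ℝ), ∀ x ∈ Ioo a b, IccExtend hab.le ((Icc a b).domRestrict f) x = f x :=
    fun f x hx => IccExtend_of_mem hab.le _ (Ioo_subset_Icc_self hx)
  have hfin : eLpNorm (fun x => derivWithin k (Icc a b) x / k x) ⊤ (volIoo a b) ≠ ⊤ :=
    (memLp_top_of_bound (hmeas hκ) K ((ae_mem_volIoo a b).mono hK)).2.ne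
  refine ⟨{
    κ := fun x => derivWithin k (Icc a b) x / k x
    θ := fun x => q x / k x
    P := IccExtend hab.le ((Icc a b).domRestrict fun y => p y / k y)
    P' := IccExtend hab.le ((Icc a b).domRestrict (derivWithin (fun y => p y / k y) (Icc a b)))
    L := (eLpNorm (fun x => derivWithin k (Icc a b) x / k x) ⊤ (volIoo a b)).toReal
    Q := Q
    N := N
    M := M
    κ_meas := hmeas hκ
    κ_le := ?_
    θ_meas := hmeas hθ
    θ_le := (ae_mem_volIoo a b).mono hQ
    P_cont := (hpk.continuousOn.domRestrict).Icc_extend'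
    P'_cont := hP'.domRestrict.Icc_extend'
    P_deriv := fun x hx => ?_
    P_le := fun x hx => (hext _ x hx).symm ▸ hN x hx
    P'_le := fun x hx => (hext _ x hx).symm ▸ hM x hx
    L_nonneg := ENNReal.toReal_nonneg
    Q_nonneg := hQ0
    N_nonneg := hN0
    M_nonneg := hM0 }, fun x _ => rfl, fun x _ => rfl, fun x hx => (hext (fun y => p y / k y) x hx).symm,
      fun x hx => (hext (derivWithin (fun y => p y / k y) (Icc a b)) x hx).symm, rfl⟩
  · filter_upwards [ae_le_eLpNormEssSup (f := fun x => derivWithin k (Icc a b) x / k x)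
      (μ := volIoo a b)] with x hx
    rw [← eLpNorm_exponent_top] at hx
    have := ENNReal.toReal_mono hfin hx
    rwa [toReal_enorm] at this
  · rw [hext _ x hx]
    have hd := ((hpk.differentiableOn one_ne_zero).differentiableAt
      (Icc_mem_nhds hx.1 hx.2)).hasDerivAt
    have hdw := (hd.hasDerivWithinAt (s := Icc a b)).derivWithin
      (hu x (Ioo_subset_Icc_self hx))
    rw [hdw]
    refine hd.congr_of_eventuallyEq ?_
    filter_upwards [Ioo_mem_nhds hx.1 hx.2] with y hy
    exact hext _ y hy

/-- The concrete form in terms of operators. -/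
lemma FormCoeff.form_eq_B2 (c : FormCoeff a b) (hab : a < b) (hs0 : 0 < (1 + μ) / 2)
    (hs1 : (1 + μ) / 2 < 1) (hμ : 0 < 2 * ((1 + μ) / 2) - 1)
    (hκ : ∀ x ∈ Ioo a b, derivWithin k (Icc a b) x / k x = c.κ x)
    (hθ : ∀ x ∈ Ioo a b, q x / k x = c.θ x) (hP : ∀ x ∈ Ioo a b, p x / k x = c.P x) (α β : ℝ)
    (u v : HsZero ((1 + μ) / 2) a b) :
    c.form hab hs0 hs1 hμ α β u v = B2 a b α β μ p q k (u : L2Ioo a b) (v : L2Ioo a b) := by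
  have hmul : ∀ {m m' w : ℝ → ℝ} {f g : L2Ioo a b}, (∀ x ∈ Ioo a b, m x = m' x) →
      w =ᵐ[volIoo a b] f → g =ᵐ[volIoo a b] (fun x => m' x * f x) →
      (fun x => m x * w x) =ᵐ[volIoo a b] g := fun h1 h2 h3 => by
    filter_upwards [ae_mem_volIoo a b, h2, h3] with x hx h2 h3
    rw [h1 x hx, h2, h3]
  have hs : 0 < 1 - (1 + μ) / 2 := sub_pos.2 hs1
  rw [form_apply, B2,
    pairing_eq_inner (leftRLDeriv_hsZero hab hs0 hs1 u).2 (rightRLDeriv_hsZero hab hs0 hs1 v).2,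
    pairing_eq_inner (rightRLDeriv_hsZero hab hs0 hs1 u).2 (leftRLDeriv_hsZero hab hs0 hs1 v).2,
    pairing_eq_inner (hmul hκ
      (leftRLDeriv_hsZero_of_add_eq hab hs0 hs1 (τ := μ) hs (by ring) u).2
      (mulOp_coe c.κ_meas c.κ_le _)) EventuallyEq.rfl,
    pairing_eq_inner (hmul hκ
      (rightRLDeriv_hsZero_of_add_eq hab hs0 hs1 (τ := μ) hs (by ring) u).2
      (mulOp_coe c.κ_meas c.κ_le _)) EventuallyEq.rfl,
    pairing_eq_inner
      (leftRLDeriv_hsZero_of_add_eq hab hs0 hs1 (τ := (1 - μ) / 2) hμ (by ring) u).2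
      (c.rightRLDeriv_mul hab hs0 hs1 hP v).2,
    pairing_eq_inner (hmul hθ EventuallyEq.rfl (mulOp_coe c.θ_meas c.θ_le _)) EventuallyEq.rfl]
  rfl

end Coefficients


/-! ### Coercivity -/

section Coercivity

variable {a b s : ℝ}

/-- Euler's reflection formula `Γ(s) Γ(1-s) = π / sin(πs)`. -/
lemma rlBound_mul_rlBound (hab : a < b) (hs0 : 0 < s) (hs1 : s < 1) :
    (rlBound a b (1 - s) : ℝ) * rlBound a b s =
      (b - a) * Real.sin (Real.pi * s) / (Real.pi * (s * (1 - s))) := by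
  have hba : 0 < b - a := sub_pos.2 hab
  have hs1' : 0 < 1 - s := by linarith
  have hsin : 0 < Real.sin (Real.pi * s) :=
    Real.sin_pos_of_pos_of_lt_pi (by positivity) (by nlinarith [Real.pi_pos])
  have hΓ1 := Real.Gamma_pos_of_pos hs0
  have hΓ2 := Real.Gamma_pos_of_pos hs1'
  have hΓ := Real.Gamma_mul_Gamma_one_sub s
  rw [rlBound, rlBound, Real.Gamma_add_one hs1'.ne', Real.Gamma_add_one hs0.ne',
    Real.coe_toNNReal _ (by positivity), Real.coe_toNNReal _ (by positivity), div_mul_div_comm,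
    ← Real.rpow_add hba, sub_add_cancel, Real.rpow_one,
    show (1 - s) * Real.Gamma (1 - s) * (s * Real.Gamma s) =
      s * (1 - s) * (Real.Gamma s * Real.Gamma (1 - s)) by ring, hΓ]
  have := Real.pi_pos
  field_simp

/-- The hypothesis is the negative of this constant multiplied by `4π s(1-s) / sin(πs)`, which is
positive. -/
lemma coercivity_constant_pos (hab : a < b) (hs0 : 0 < s) (hs1 : s < 1) {L : ℝ}
    (h : Real.pi * (4 * (s * (1 - s))) * Real.cot (Real.pi * s) + 4 * (b - a) * L < 0) :
    0 < -Real.cos (Real.pi * s) - L * (rlBound a b (1 - s) * rlBound a b s) := by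
  have hsin : 0 < Real.sin (Real.pi * s) :=
    Real.sin_pos_of_pos_of_lt_pi (by positivity) (by nlinarith [Real.pi_pos])
  have hpi := Real.pi_pos
  have hs1' : 0 < 1 - s := by linarith
  have hss : 0 < s * (1 - s) := mul_pos hs0 hs1'
  rw [rlBound_mul_rlBound hab hs0 hs1]
  rw [Real.cot_eq_cos_div_sin] at h
  have e : -Real.cos (Real.pi * s) -
      L * ((b - a) * Real.sin (Real.pi * s) / (Real.pi * (s * (1 - s)))) =
      -(Real.pi * (4 * (s * (1 - s))) * (Real.cos (Real.pi * s) / Real.sin (Real.pi * s)) +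
        4 * (b - a) * L) * (Real.sin (Real.pi * s) / (4 * (Real.pi * (s * (1 - s))))) := by
    field_simp
    ring
  rw [e]
  exact mul_pos (neg_pos.2 h) (by positivity)

lemma FormCoeff.form_coercive (c : FormCoeff a b) (hab : a < b) (hs0 : 0 < s) (hs1 : s < 1)
    (hμ : 0 < 2 * s - 1) {α β : ℝ} (hα : 0 ≤ α) (hβ : 0 ≤ β)
    (hαβ : α + β = 1) (hθ : ∀ x ∈ Ioo a b, 0 ≤ c.θ x - 1 / 2 * c.P' x)
    (h : Real.pi * (4 * (s * (1 - s))) * Real.cot (Real.pi * s) + 4 * (b - a) * c.L < 0) :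
    ∃ Q : ℝ, 0 < Q ∧ ∀ u : HsZero s a b,
      Q * hsZeroNorm u ^ 2 ≤ c.form hab hs0 hs1 hμ α β u u := by
  have hδ := coercivity_constant_pos hab hs0 hs1 h
  -- The Poincaré inequality gives `‖u‖² + |u|_s² ≤ (R_s² + 1) |u|_s²`.
  refine ⟨_ / (rlBound a b s ^ 2 + 1), div_pos hδ (by positivity), fun u => ?_⟩
  refine le_trans ?_ (c.form_coercive_semi hab hs0 hs1 hμ hα hβ hαβ hθ u)
  have hu : ‖(u : L2Ioo a b)‖ ≤ rlBound a b s * hsSemi a b s u :=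
    (norm_le_rlBound_mul_derivL hab hs0 hs1 u).trans
      (mul_le_mul_of_nonneg_left (norm_derivL_le hab hs0 hs1 u) (NNReal.coe_nonneg _))
  have hu2 := pow_le_pow_left₀ (norm_nonneg _) hu 2
  rw [div_mul_eq_mul_div, div_le_iff₀ (by positivity), mul_assoc, hsZeroNorm_sq]
  refine mul_le_mul_of_nonneg_left ?_ hδ.le
  rw [mul_pow] at hu2
  linarith

lemma exists_hsZeroNorm_le_derivL (hab : a < b) (hs0 : 0 < s) (hs1 : s < 1)
    (hcos : Real.cos (Real.pi * s) < 0) :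
    ∃ K : ℝ, 0 ≤ K ∧ ∀ u : HsZero s a b, hsZeroNorm u ≤ K * ‖derivL hab hs0 hs1 u‖ := by
  have hc : 0 < -Real.cos (Real.pi * s) := neg_pos.2 hcos
  refine ⟨rlBound a b s + (-Real.cos (Real.pi * s))⁻¹, by positivity, fun u => ?_⟩
  refine (hsZeroNorm_le u).trans ?_
  rw [add_mul]
  refine add_le_add (norm_le_rlBound_mul_derivL hab hs0 hs1 u) ?_
  rw [inv_mul_eq_div, le_div_iff₀ hc, mul_comm]
  exact hsSemi_le_derivL hab hs0 hs1 u

/-- The Lax-Milgram theorem on the fractional Sobolev space. -/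
lemma exists_unique_of_coercive (hab : a < b) (hs0 : 0 < s) (hs1 : s < 1)
    (hcos : Real.cos (Real.pi * s) < 0) (B : LinearMap.BilinForm ℝ (HsZero s a b))
    {C c M : ℝ} (hB : ∀ u v, |B u v| ≤ C * hsZeroNorm u * hsZeroNorm v) (hC : 0 < C)
    (hc : 0 < c) (hcoer : ∀ u, c * hsZeroNorm u ^ 2 ≤ B u u) (l : HsZero s a b →ₗ[ℝ] ℝ)
    (hM : 0 ≤ M) (hl : ∀ v, |l v| ≤ M * hsZeroNorm v) :
    ∃ u, (∀ v, B u v = l v) ∧ (∀ w, (∀ v, B w v = l v) → w = u) ∧ c * hsZeroNorm u ≤ M := by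
  obtain ⟨K, hK0, hK⟩ := exists_hsZeroNorm_le_derivL hab hs0 hs1 hcos
  have hle : ∀ u : HsZero s a b, ‖derivL hab hs0 hs1 u‖ ≤ hsZeroNorm u := fun u =>
    (norm_derivL_le hab hs0 hs1 u).trans (hsSemi_le_hsZeroNorm u)
  -- Lax-Milgram is applied on the closed range of the left derivative, whose norm is equivalent to
  -- the Sobolev norm; completeness of the Sobolev space itself is never invoked.
  set e := LinearEquiv.ofInjective (derivL hab hs0 hs1) (derivL_injective hab hs0 hs1)
  have he : ∀ u, ‖e u‖ = ‖derivL hab hs0 hs1 u‖ := fun u => rfl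
  have : CompleteSpace (LinearMap.range (derivL hab hs0 hs1)) :=
    (isClosed_range_derivL hab hs0 hs1 hcos).completeSpace_coe
  obtain ⟨u, hu⟩ := exists_of_coercive e B (C := C * K * K) (c := c) (M := M * K)
    (fun u v => (hB u v).trans (by
      rw [he, he]
      calc C * hsZeroNorm u * hsZeroNorm v
          ≤ C * (K * ‖derivL hab hs0 hs1 u‖) * (K * ‖derivL hab hs0 hs1 v‖) :=
            mul_le_mul (mul_le_mul_of_nonneg_left (hK u) hC.le) (hK v) (hsZeroNorm_nonneg v)
              (by positivity)
        _ = _ := by ring)) hc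
    (fun u => (mul_le_mul_of_nonneg_left
      (pow_le_pow_left₀ (norm_nonneg _) ((he u).trans_le (hle u)) 2) hc.le).trans (hcoer u)) l
    (fun v => (hl v).trans (by
      rw [mul_assoc]; exact mul_le_mul_of_nonneg_left (hK v) hM))
  refine ⟨u, hu, fun w hw => ?_, ?_⟩
  · have h1 := hcoer (w - u)
    rw [map_sub B, LinearMap.sub_apply, hw, hu, sub_self] at h1
    have h2 : hsZeroNorm (w - u) = 0 :=
      pow_eq_zero_iff two_ne_zero |>.1
        (le_antisymm (nonpos_of_mul_nonpos_right h1 hc) (sq_nonneg _))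
    have h3 := norm_le_hsZeroNorm (w - u)
    rw [h2, norm_le_zero_iff] at h3
    exact sub_eq_zero.1 (Subtype.ext h3)
  · have h1 := (hcoer u).trans ((le_abs_self _).trans ((congrArg abs (hu u)).trans_le (hl u)))
    rcases (hsZeroNorm_nonneg u).eq_or_lt with h | h
    · rw [← h, mul_zero]; exact hM
    · rw [sq, ← mul_assoc] at h1
      exact le_of_mul_le_mul_right h1 h

end Coercivity


/-! ### Integrable right-hand sides -/

section SquareKernel

variable {X : Type*} [MeasurableSpace X] {ν : Measure X} [SFinite ν]

/-- A bound from `L¹` to `L²` for kernels with square integrable columns: Cauchy-Schwarz with weight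
`|f|`, followed by Tonelli. -/
lemma lintegral_kernel_sq_le {K : X → X → ℝ} (hK : Measurable (Function.uncurry K)) {A : ℝ≥0∞}
    (hA : ∀ᵐ t ∂ν, ∫⁻ x, ‖K x t‖ₑ ^ 2 ∂ν ≤ A) {f : X → ℝ} (hf : AEStronglyMeasurable f ν) :
    ∫⁻ x, (∫⁻ t, ‖K x t‖ₑ * ‖f t‖ₑ ∂ν) ^ 2 ∂ν ≤ A * (∫⁻ t, ‖f t‖ₑ ∂ν) ^ 2 := by
  have hfe : AEMeasurable (fun t => ‖f t‖ₑ) ν := hf.enorm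
  have hKe : ∀ x, Measurable fun t => ‖K x t‖ₑ := fun x =>
    (hK.comp measurable_prodMk_left).enorm
  have hm : AEMeasurable (fun z : X × X => ‖f z.2‖ₑ * ‖K z.1 z.2‖ₑ ^ 2) (ν.prod ν) :=
    (hf.comp_snd.enorm).mul ((hK.enorm.pow_const 2).aemeasurable)
  calc ∫⁻ x, (∫⁻ t, ‖K x t‖ₑ * ‖f t‖ₑ ∂ν) ^ 2 ∂ν
      ≤ ∫⁻ x, (∫⁻ t, ‖f t‖ₑ ∂ν) * ∫⁻ t, ‖f t‖ₑ * ‖K x t‖ₑ ^ 2 ∂ν ∂ν := by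
        refine lintegral_mono fun x => ?_
        simp only [mul_comm ‖K x _‖ₑ]
        exact lintegral_mul_sq_le hfe (hKe x).aemeasurable
    _ = (∫⁻ t, ‖f t‖ₑ ∂ν) * ∫⁻ x, ∫⁻ t, ‖f t‖ₑ * ‖K x t‖ₑ ^ 2 ∂ν ∂ν :=
        lintegral_const_mul'' _ hm.lintegral_prod_right'
    _ = (∫⁻ t, ‖f t‖ₑ ∂ν) * ∫⁻ t, ∫⁻ x, ‖f t‖ₑ * ‖K x t‖ₑ ^ 2 ∂ν ∂ν := by
        rw [lintegral_lintegral_swap hm]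
    _ ≤ (∫⁻ t, ‖f t‖ₑ ∂ν) * ∫⁻ t, ‖f t‖ₑ * A ∂ν := by
        refine mul_le_mul_right (lintegral_mono_ae ?_) _
        filter_upwards [hA] with t ht
        rw [lintegral_const_mul _ (by
          have := hK.comp (measurable_prodMk_right (y := t)); exact this.enorm.pow_const 2)]
        gcongr
    _ = A * (∫⁻ t, ‖f t‖ₑ ∂ν) ^ 2 := by
        rw [lintegral_mul_const'' _ hfe]; ring

variable {K : X → X → ℝ} (hK : Measurable (Function.uncurry K)) {A : ℝ≥0∞} (hA0 : A ≠ ⊤)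
  (hA : ∀ᵐ t ∂ν, ∫⁻ x, ‖K x t‖ₑ ^ 2 ∂ν ≤ A) {f : X → ℝ} (hf : Integrable f ν)

include hK hA0 hA hf

lemma memLp_kerApply_of_integrable : MemLp (kerApply ν K f) 2 ν := by
  refine ⟨aestronglyMeasurable_kerApply hK hf.1, ?_⟩
  have h : eLpNorm (kerApply ν K f) 2 ν ^ 2 < ⊤ := by
    rw [eLpNorm_two_sq]
    refine (lintegral_mono fun x => pow_le_pow_left' (enorm_kerApply_le K f x) 2).trans_lt ?_
    exact (lintegral_kernel_sq_le hK hA hf.1).trans_lt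
      (ENNReal.mul_lt_top hA0.lt_top (ENNReal.pow_lt_top hf.2))
  by_contra hc
  rw [not_lt_top_iff.1 hc] at h
  simp at h

lemma integrable_kernel_of_integrable {g : X → ℝ} (hg : MemLp g 2 ν) :
    Integrable (fun p : X × X => K p.1 p.2 * f p.2 * g p.1) (ν.prod ν) := by
  refine integrable_kernel_of_lintegral_lt_top hK hf.1 hg.1 ?_
  have hm : AEMeasurable (fun x => ∫⁻ t, ‖K x t‖ₑ * ‖f t‖ₑ ∂ν) ν :=
    AEMeasurable.lintegral_prod_right' (f := fun p : X × X => ‖K p.1 p.2‖ₑ * ‖f p.2‖ₑ)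
      (hK.enorm.aemeasurable.mul hf.1.comp_snd.enorm)
  refine (ENNReal.lintegral_mul_le_Lp_mul_Lq ν Real.HolderConjugate.two_two hm hg.1.enorm).trans_lt
    ?_
  simp only [ENNReal.rpow_two]
  refine ENNReal.mul_lt_top (ENNReal.rpow_lt_top_of_nonneg (by norm_num) ?_)
    (ENNReal.rpow_lt_top_of_nonneg (by norm_num) ?_)
  · exact ((lintegral_kernel_sq_le hK hA hf.1).trans_lt
      (ENNReal.mul_lt_top hA0.lt_top (ENNReal.pow_lt_top hf.2))).ne
  · rw [← eLpNorm_two_sq]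
    exact (ENNReal.pow_lt_top hg.2).ne

lemma integrable_mul_kerApply_kerT {g : X → ℝ} (hg : MemLp g 2 ν) :
    Integrable (fun t => f t * kerApply ν (kerT K) g t) ν := by
  have h := (integrable_kernel_of_integrable hK hA0 hA hf hg).integral_prod_right
  refine h.congr (ae_of_all _ fun t => ?_)
  simp only [kerApply, kerT, ← integral_const_mul]
  exact integral_congr_ae (ae_of_all _ fun x => by ring)

end SquareKernel

/-! ### The load functional -/

section Load

variable {a b s : ℝ}

/-- The square of the kernel of order `s` is a multiple of the kernel of order `2s - 1`, which is
integrable precisely because `s > 1/2`. -/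
lemma lintegral_rlKer_sq_le (hμ : 0 < 2 * s - 1) : ∀ᵐ t ∂volIoo a b,
    ∫⁻ x, ‖rlKer s x t‖ₑ ^ 2 ∂volIoo a b ≤
      ENNReal.ofReal (Real.Gamma (2 * s - 1) / Real.Gamma s ^ 2) * rlBound a b (2 * s - 1) := by
  have hΓ := Real.Gamma_pos_of_pos hμ
  have hΓs := Real.Gamma_pos_of_pos (show 0 < s by linarith)
  have hc : 0 ≤ Real.Gamma (2 * s - 1) / Real.Gamma s ^ 2 := by positivity
  have e : ∀ x t, ‖rlKer s x t‖ₑ ^ 2 =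
      ENNReal.ofReal (Real.Gamma (2 * s - 1) / Real.Gamma s ^ 2) * ‖rlKer (2 * s - 1) x t‖ₑ :=
    fun x t => by
      rw [← Real.enorm_of_nonneg hc, ← enorm_mul, ← enorm_pow]
      congr 1
      rw [rlKer, rlKer]
      split_ifs with h
      · rw [div_pow, ← Real.rpow_natCast, ← Real.rpow_mul (sub_pos.2 h).le,
          show (s - 1) * ((2 : ℕ) : ℝ) = 2 * s - 1 - 1 by push_cast; ring]
        field_simp
      · simp
  filter_upwards [(isSchur_rlKer a b hμ).col] with t ht
  simp only [e]
  rw [lintegral_const_mul' _ _ ENNReal.ofReal_ne_top]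
  gcongr

/-- The two endpoint singularities are separated at the midpoint, where each weight is continuous on
the other's half; `g / k` is continuous throughout. -/
lemma MemHStar.integrable_div {f k : ℝ → ℝ} (hab : a < b) (hf : MemHStar a b f)
    (hk : ContinuousOn k (Icc a b)) (hk0 : ∀ x ∈ Icc a b, k x ≠ 0) :
    Integrable (fun x => f x / k x) (volIoo a b) := by
  obtain ⟨lam, hlam, -, ε₁, ε₂, h1, h2, g, ⟨C, hg⟩, -, -, hfg⟩ := hf
  have hgk : ContinuousOn (fun x => g x / k x) (uIcc a b) := by
    rw [uIcc_of_le hab.le]; exact (hg.continuousOn hlam).div hk hk0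
  have hm1 : a < (a + b) / 2 := by linarith
  have hm2 : (a + b) / 2 < b := by linarith
  have i1 : IntervalIntegrable (fun x => (x - a) ^ (ε₁ - 1)) volume a ((a + b) / 2) := by
    have := (intervalIntegral.intervalIntegrable_rpow' (a := 0) (b := (a + b) / 2 - a)
      (show -1 < ε₁ - 1 by linarith)).comp_sub_right a
    simpa using this
  have i2 : IntervalIntegrable (fun x => (b - x) ^ (ε₂ - 1)) volume ((a + b) / 2) b := by
    have := (intervalIntegral.intervalIntegrable_rpow' (a := b - (a + b) / 2) (b := 0)
      (show -1 < ε₂ - 1 by linarith)).comp_sub_left b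
    simpa using this
  have j1 : IntervalIntegrable (fun x => (x - a) ^ (ε₁ - 1) * (b - x) ^ (ε₂ - 1)) volume a
      ((a + b) / 2) := i1.mul_continuousOn (by
    rw [uIcc_of_le hm1.le]
    exact (continuousOn_const.sub continuousOn_id).rpow_const fun x hx =>
      Or.inl (sub_pos.2 (hx.2.trans_lt hm2)).ne')
  have j2 : IntervalIntegrable (fun x => (x - a) ^ (ε₁ - 1) * (b - x) ^ (ε₂ - 1)) volume
      ((a + b) / 2) b := i2.continuousOn_mul (by
    rw [uIcc_of_le hm2.le]
    exact (continuousOn_id.sub continuousOn_const).rpow_const fun x hx =>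
      Or.inl (sub_pos.2 (hm1.trans_le hx.1)).ne')
  have h := (intervalIntegrable_iff_integrableOn_Ioo_of_le hab.le).1
    ((j1.trans j2).continuousOn_mul hgk)
  refine Integrable.congr h ?_
  filter_upwards [ae_mem_volIoo a b] with x hx
  rw [hfg x hx, show ε₁ - 1 = -(1 - ε₁) by ring, show ε₂ - 1 = -(1 - ε₂) by ring,
    Real.rpow_neg (sub_pos.2 hx.1).le, Real.rpow_neg (sub_pos.2 hx.2).le]
  simp only [div_eq_mul_inv, mul_inv]
  ring

variable {F : ℝ → ℝ}

lemma memLp_kerApply_rlKer_of_integrable (hμ : 0 < 2 * s - 1) (hF : Integrable F (volIoo a b)) :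
    MemLp (kerApply (volIoo a b) (rlKer s) F) 2 (volIoo a b) :=
  memLp_kerApply_of_integrable (measurable_rlKer s) (by finiteness) (lintegral_rlKer_sq_le hμ) hF

lemma leftRLInt_ae_eq (σ : ℝ) (w : ℝ → ℝ) :
    leftRLInt a σ w =ᵐ[volIoo a b] kerApply (volIoo a b) (rlKer σ) w :=
  (ae_mem_volIoo a b).mono fun _ hx => leftRLInt_eq_kerApply hx σ w

lemma memLp_leftRLInt (hμ : 0 < 2 * s - 1) (hF : Integrable F (volIoo a b)) :
    MemLp (leftRLInt a s F) 2 (volIoo a b) :=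
  (memLp_kerApply_rlKer_of_integrable hμ hF).ae_eq (leftRLInt_ae_eq s F).symm

lemma integrable_mul_hsZero (hab : a < b) (hs0 : 0 < s) (hs1 : s < 1) (hμ : 0 < 2 * s - 1)
    (hF : Integrable F (volIoo a b)) (v : HsZero s a b) :
    Integrable (fun x => F x * (v : L2Ioo a b) x) (volIoo a b) := by
  refine (integrable_mul_kerApply_kerT (measurable_rlKer s) (by finiteness)
    (lintegral_rlKer_sq_le hμ) hF (Lp.memLp (derivR hab hs0 hs1 v))).congr ?_
  filter_upwards [coe_ae_eq_rightOp_derivR hab hs0 hs1 v] with x hx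
  rw [hx]

/-- With `v = J^s h`, moving the kernel to the other side exhibits the load as an `L²` functional of
the right derivative of `v`. -/
lemma pairing_hsZero_eq_inner (hab : a < b) (hs0 : 0 < s) (hs1 : s < 1) (hμ : 0 < 2 * s - 1)
    (hF : Integrable F (volIoo a b)) (v : HsZero s a b) :
    pairing a b F (v : L2Ioo a b) =
      inner ℝ ((memLp_leftRLInt hμ hF).toLp) (derivR hab hs0 hs1 v) := by
  rw [inner_L2_eq]
  have h := integral_kerApply_mul (integrable_kernel_of_integrable (measurable_rlKer s)
    (by finiteness) (lintegral_rlKer_sq_le hμ) hF (Lp.memLp (derivR hab hs0 hs1 v)))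
  refine Eq.trans ?_ (h.symm.trans ?_)
  · refine integral_congr_ae ?_
    filter_upwards [coe_ae_eq_rightOp_derivR hab hs0 hs1 v] with x hx
    rw [hx]
  · refine integral_congr_ae ?_
    filter_upwards [(memLp_leftRLInt hμ hF).coeFn_toLp, leftRLInt_ae_eq s F] with x h1 h2
    rw [h1, h2]

end Load

end

theorem mainTheorem4 (a b α β μ : ℝ) (p q k : ℝ → ℝ) (hab : a < b)
    (hα : 0 < α ∧ α < 1) (hβ : 0 < β ∧ β < 1) (hαβ : α + β = 1) (hμ : 0 < μ ∧ μ < 1)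
    (hp : ContDiffOn ℝ 1 p (Icc a b)) (hq : ContDiffOn ℝ 1 q (Icc a b))
    (hk : ContDiffOn ℝ 1 k (Icc a b))
    (hp' : MemHolderSome a b (derivWithin p (Icc a b)))
    (hk' : MemHolderSome a b (derivWithin k (Icc a b)))
    (hkpos : ∀ x ∈ Icc a b, 0 < k x)
    (hqpk : ∀ x ∈ Icc a b,
      0 ≤ q x / k x - 1 / 2 * derivWithin (fun y => p y / k y) (Icc a b) x)
    (hcot : Real.pi * (1 - μ ^ 2) * Real.cot ((1 + μ) * Real.pi / 2) +
      4 * (b - a) * (eLpNorm (fun x => derivWithin k (Icc a b) x / k x) ⊤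
        (volume.restrict (Ioo a b))).toReal < 0) :
    -- all the functions paired in the form exist and are square integrable
    (∀ u : HsZero ((1 + μ) / 2) a b,
      LeftRLDerivInL2 a b ((1 + μ) / 2) (u : L2Ioo a b) ∧
      RightRLDerivInL2 a b ((1 + μ) / 2) (u : L2Ioo a b) ∧
      LeftRLDerivInL2 a b μ (u : L2Ioo a b) ∧
      RightRLDerivInL2 a b μ (u : L2Ioo a b) ∧
      LeftRLDerivInL2 a b ((1 - μ) / 2) (u : L2Ioo a b) ∧
      RightRLDerivInL2 a b ((1 + μ) / 2) (fun x => p x / k x * (u : L2Ioo a b) x)) ∧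
    -- the form is bilinear
    (∃ B : LinearMap.BilinForm ℝ (HsZero ((1 + μ) / 2) a b),
      ∀ u v, B u v = B2 a b α β μ p q k (u : L2Ioo a b) (v : L2Ioo a b)) ∧
    -- it is bounded
    (∃ Q₁ : ℝ, 0 < Q₁ ∧ ∀ u v : HsZero ((1 + μ) / 2) a b,
      |B2 a b α β μ p q k (u : L2Ioo a b) (v : L2Ioo a b)| ≤
        Q₁ * hsZeroNorm u * hsZeroNorm v) ∧
    -- it is coercive
    (∃ Q₂ : ℝ, 0 < Q₂ ∧ ∀ u : HsZero ((1 + μ) / 2) a b,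
      Q₂ * hsZeroNorm u ^ 2 ≤ B2 a b α β μ p q k (u : L2Ioo a b) (u : L2Ioo a b)) ∧
    -- unique weak solution and norm estimate, with a constant that does not depend on `f`
    (∃ C : ℝ, 0 < C ∧ ∀ f : ℝ → ℝ, MemHStar a b f →
      (∀ v : HsZero ((1 + μ) / 2) a b,
        IntegrableOn (fun x => f x / k x * (v : L2Ioo a b) x) (Ioo a b)) ∧
      MemLp (leftRLInt a ((1 + μ) / 2) (fun x => f x / k x)) 2 (volume.restrict (Ioo a b)) ∧
      ∃ u : HsZero ((1 + μ) / 2) a b,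
        (∀ v : HsZero ((1 + μ) / 2) a b,
          B2 a b α β μ p q k (u : L2Ioo a b) (v : L2Ioo a b) =
            pairing a b (fun x => f x / k x) (v : L2Ioo a b)) ∧
        (∀ w : HsZero ((1 + μ) / 2) a b,
          (∀ v : HsZero ((1 + μ) / 2) a b,
            B2 a b α β μ p q k (w : L2Ioo a b) (v : L2Ioo a b) =
              pairing a b (fun x => f x / k x) (v : L2Ioo a b)) → w = u) ∧
        hsZeroNorm u ≤ C * (eLpNorm (leftRLInt a ((1 + μ) / 2) (fun x => f x / k x)) 2
          (volume.restrict (Ioo a b))).toReal) := by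
  have hs0 : 0 < (1 + μ) / 2 := by linarith [hμ.1]
  have hs1 : (1 + μ) / 2 < 1 := by linarith [hμ.2]
  have hs1' : 0 < 1 - (1 + μ) / 2 := sub_pos.2 hs1
  have hμ' : 0 < 2 * ((1 + μ) / 2) - 1 := by linarith [hμ.1]
  -- The order lies strictly between `1/2` and `1`, so the angle lies in the second quadrant.
  have hcos : Real.cos (Real.pi * ((1 + μ) / 2)) < 0 :=
    Real.cos_neg_of_pi_div_two_lt_of_lt (by nlinarith [Real.pi_pos, mul_pos Real.pi_pos hμ.1])
      (by nlinarith [Real.pi_pos, mul_pos Real.pi_pos hs1'])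
  have hk0 : ∀ x ∈ Icc a b, k x ≠ 0 := fun x hx => (hkpos x hx).ne'
  obtain ⟨c, cκ, cθ, cP, cP', cL⟩ := exists_formCoeff hab hp hq.continuousOn hk hkpos
  have hform := c.form_eq_B2 hab hs0 hs1 hμ' cκ cθ cP α β
  obtain ⟨Q₁, hQ₁, hbound⟩ := c.exists_form_bound hab hs0 hs1 hμ' α β
  obtain ⟨Q₂, hQ₂, hcoer⟩ := c.form_coercive hab hs0 hs1 hμ' hα.1.le hβ.1.le hαβ
    (fun x hx => by
      rw [← cθ x hx, ← cP' x hx]; exact hqpk x (Ioo_subset_Icc_self hx))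
    (by
      rw [cL]
      -- For `s = (1 + μ)/2` one has `4 s (1 - s) = 1 - μ²`.
      convert hcot using 4 <;> ring)
  refine ⟨fun u => ⟨(leftRLDeriv_hsZero hab hs0 hs1 u).1, (rightRLDeriv_hsZero hab hs0 hs1 u).1,
      (leftRLDeriv_hsZero_of_add_eq hab hs0 hs1 hs1' (by ring) u).1,
      (rightRLDeriv_hsZero_of_add_eq hab hs0 hs1 hs1' (by ring) u).1,
      (leftRLDeriv_hsZero_of_add_eq hab hs0 hs1 hμ' (by ring) u).1,
      (c.rightRLDeriv_mul hab hs0 hs1 cP u).1⟩,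
    ⟨c.form hab hs0 hs1 hμ' α β, hform⟩, ⟨Q₁, hQ₁, fun u v => hform u v ▸ hbound u v⟩,
    ⟨Q₂, hQ₂, fun u => hform u u ▸ hcoer u⟩, Q₂⁻¹, inv_pos.2 hQ₂, fun f hf => ?_⟩
  have hF := hf.integrable_div hab hk.continuousOn hk0
  have hmem := memLp_leftRLInt (s := (1 + μ) / 2) hμ' hF
  refine ⟨integrable_mul_hsZero hab hs0 hs1 hμ' hF, hmem, ?_⟩
  set g : L2Ioo a b := hmem.toLp with hg
  have hgn : ‖g‖ = (eLpNorm (leftRLInt a ((1 + μ) / 2) (fun x => f x / k x)) 2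
      (volume.restrict (Ioo a b))).toReal := Lp.norm_toLp _ hmem
  -- The functional `v ↦ (g, h_v)`, with `h_v` the right derivative of `v`, is bounded by `‖g‖`.
  -- Coercivity then gives `Q₂ ‖u‖ ≤ ‖g‖`, which is the source of the constant `Q₂⁻¹`.
  obtain ⟨u, hu, huniq, hle⟩ := exists_unique_of_coercive hab hs0 hs1 hcos
    (c.form hab hs0 hs1 hμ' α β) hbound hQ₁ hQ₂ hcoer (innerₗ (L2Ioo a b) g ∘ₗ derivR hab hs0 hs1)
    (norm_nonneg g) (fun v => (abs_real_inner_le_norm _ _).trans (mul_le_mul_of_nonneg_left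
      ((norm_derivR_le hab hs0 hs1 v).trans (hsSemi_le_hsZeroNorm v)) (norm_nonneg g)))
  have hpair := pairing_hsZero_eq_inner hab hs0 hs1 hμ' hF
  refine ⟨u, fun v => ?_, fun w hw => huniq w fun v => ?_, ?_⟩
  · rw [← hform, hu, hpair]; rfl
  · rw [hform, hw, hpair]; rfl
  · rwa [← hgn, inv_mul_eq_div, le_div_iff₀' hQ₂]
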